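/- A hypergraph $G=(V,E)$ has a finite vertex set $V$ and a finite set $E$ of hyperedges, each a subset of $V$; parallel hyperedges are allowed. Let $n=|V|$ and $p=\sum_{e\in E}|e|$. For $F\subseteq E$, $F$ is a $k$-cut-set if $G-F$ has at least $k$ connected components, and a minimum $k$-cut-set if moreover $|F|$ is smallest possible. For $U\subseteq V$ let $\delta(U)$ be the set of hyperedges meeting both $U$ and $V\setminus U$; for a partition $(U_1,\dots,U_k)$ of $V$ into non-empty parts (a $k$-partition) let $\delta(U_1,\dots,U_k)$ be the set of hyperedges meeting at least two parts. For disjoint non-empty $S,T\subseteq V$, a minimum $(S,T)$-terminal cut is a set $U$ with $S\subseteq U\subseteq V\setminus T$ minimizing $|\delta(U)|$; it is source minimal if no proper subset of $U$ is also a minimum $(S,T)$-terminal cut. For an integer $k\ge 2$, Algorithm Enum-Cuts$(G,k)$ is the following. Start with $\mathcal C=\mathcal F=\emptyset$. For all pairs of disjoint non-empty $S,T\subseteq V$ with $|S|,|T|\le 2k-1$, compute the source minimal minimum $(S,T)$-terminal cut $U$; if $G-\delta(U)$ has at least $k$ connected components, add $\delta(U)$ to $\mathcal F$, otherwise add $U$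 to $\mathcal C$. Then, for each $k$-partition $(U_1,\dots,U_k)$ of $V$ with all $U_i\in\mathcal C$, add $\delta(U_1,\dots,U_k)$ to $\mathcal F$. Return the family of those $k$-cut-sets in $\mathcal F$ that have the smallest cardinality among the $k$-cut-sets in $\mathcal F$. Theorem. Let $k\ge 2$ be an integer. (1) For every hypergraph $G$, Enum-Cuts$(G,k)$ returns exactly the family of all minimum $k$-cut-sets of $G$. (2) The family returned has cardinality $O(n^{2k(2k-1)})$. (3) On hypergraphs with $n\ge 1$ and with no empty hyperedge, Enum-Cuts$(G,k)$ can be implemented (with $k$ part of the input, each set of the returned family being listed exactly once) to run in time $O(n^{4k-2})\,T(n,p)+O(n^{4k^2-2k}p)$, where $T(n,p)\ge 1$ is the time complexity for computing the source minimal minimum $(\{s\},\{t\})$-terminal cut, $s\neq t$, in an $n$-vertex hypergraph of size $p$ with no empty hyperedge. The constants in the $O$-terms depend only on $k$. Time is the number of steps on a uniform-cost random access machine whose operations are addition, truncated subtraction, comparison and indexed memory access on natural numbers. In (3), $T$ is any bound on the running time of a program for the terminal cut problem; the implementation uses this program as a subroutine, and a call costs the running time of the subroutine plus the lengths of the lists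 passed and returned, plus one step. -/

import Mathlib

/-! ### Hypergraphs, `k`-cut-sets and terminal cuts -/

/-- A hypergraph with vertex type `V` and hyperedges indexed by `E`; parallel hyperedges are
allowed, so a set of hyperedges is a `Finset E`. -/
structure MultiHypergraph (V E : Type*) where
  edge : E → Finset V

namespace MultiHypergraph

variable {V E : Type*}

/-- The representation size `p = ∑ e, |e|`. -/
def size [Fintype E] (G : MultiHypergraph V E) : ℕ := ∑ e, (G.edge e).card

/-- No hyperedge is the empty set. -/
def NoEmptyEdge (G : MultiHypergraph V E) : Prop := ∀ e, (G.edge e).Nonempty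

/-- Two distinct vertices are adjacent if they lie in a common hyperedge outside `F`. The connected
components of this graph are the connected components of the hypergraph `G - F`. -/
def graphAfterRemoval (G : MultiHypergraph V E) (F : Finset E) : SimpleGraph V :=
  SimpleGraph.fromRel fun u v => ∃ e, e ∉ F ∧ u ∈ G.edge e ∧ v ∈ G.edge e

/-- The number of connected components of `G - F`. -/
noncomputable def numComponents (G : MultiHypergraph V E) (F : Finset E) : ℕ :=
  Nat.card (G.graphAfterRemoval F).ConnectedComponent

/-- `F` is a `k`-cut-set: `G - F` has at least `k` connected components. -/
def IsKCutSet (G : MultiHypergraph V E) (k : ℕ) (F : Finset E) : Prop :=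
  k ≤ G.numComponents F

/-- The family of all minimum `k`-cut-sets of `G`. -/
def minKCutSets (G : MultiHypergraph V E) (k : ℕ) : Set (Finset E) :=
  {F | G.IsKCutSet k F ∧ ∀ F', G.IsKCutSet k F' → F.card ≤ F'.card}

/-- `(P 0, …, P (k - 1))` is a partition of the vertex set into `k` non-empty parts. -/
def IsKPartition {k : ℕ} (P : Fin k → Finset V) : Prop :=
  (∀ i, (P i).Nonempty) ∧ (∀ i j, i ≠ j → Disjoint (P i) (P j)) ∧ ∀ v, ∃ i, v ∈ P i

open Classical in
/-- `δ(P 0, …, P (k - 1))`: the hyperedges that meet at least two of the parts. -/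
noncomputable def crossing [Fintype E] (G : MultiHypergraph V E) {k : ℕ} (P : Fin k → Finset V) :
    Finset E :=
  Finset.univ.filter fun e =>
    ∃ i j, i ≠ j ∧ (∃ u ∈ G.edge e, u ∈ P i) ∧ (∃ v ∈ G.edge e, v ∈ P j)

open Classical in
/-- `δ(U)`: the hyperedges that meet both `U` and its complement. -/
noncomputable def cut [Fintype E] (G : MultiHypergraph V E) (U : Finset V) : Finset E :=
  Finset.univ.filter fun e => (∃ u ∈ G.edge e, u ∈ U) ∧ (∃ v ∈ G.edge e, v ∉ U)

/-- `U` is the source set of an `(S, T)`-terminal cut: `S ⊆ U ⊆ V \ T`. -/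
def IsTerminalCut (S T U : Finset V) : Prop := S ⊆ U ∧ Disjoint U T

/-- `U` is the source set of a minimum `(S, T)`-terminal cut. -/
def IsMinTerminalCut [Fintype E] (G : MultiHypergraph V E) (S T U : Finset V) : Prop :=
  IsTerminalCut S T U ∧ ∀ U', IsTerminalCut S T U' → (G.cut U).card ≤ (G.cut U').card

/-- `U` is the source set of a source minimal minimum `(S, T)`-terminal cut: it is
inclusion-minimal among the source sets of minimum `(S, T)`-terminal cuts. -/
def IsSourceMinimalCut [Fintype E] (G : MultiHypergraph V E) (S T U : Finset V) : Prop :=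
  Minimal (G.IsMinTerminalCut S T) U

/-! ### The algorithm `Enum-Cuts` -/

/-- The pairs `(S, T)` over which the first loop ranges: disjoint, non-empty, and with at most
`2k - 1` vertices each. -/
def IsTerminalPair (k : ℕ) (S T : Finset V) : Prop :=
  S.Nonempty ∧ T.Nonempty ∧ Disjoint S T ∧ S.card ≤ 2 * k - 1 ∧ T.card ≤ 2 * k - 1

/-- The source sets `U` computed in the first loop. -/
def computedSources [Fintype E] (G : MultiHypergraph V E) (k : ℕ) : Set (Finset V) :=
  {U | ∃ S T, IsTerminalPair k S T ∧ G.IsSourceMinimalCut S T U}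

/-- The collection `𝒞` after the first loop: the computed source sets `U` for which `G - δ(U)` has
fewer than `k` connected components. -/
def collection [Fintype E] (G : MultiHypergraph V E) (k : ℕ) : Set (Finset V) :=
  {U ∈ G.computedSources k | ¬ G.IsKCutSet k (G.cut U)}

/-- The candidate family `𝓕` after the second loop: the sets `δ(U)` for the computed source sets
`U` for which `G - δ(U)` has at least `k` connected components, and the sets `δ(U₁, …, U_k)` for the
`k`-partitions `(U₁, …, U_k)` with all parts in `𝒞`. -/
def candidates [Fintype E] (G : MultiHypergraph V E) (k : ℕ) : Set (Finset E) :=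
  {F | ∃ U ∈ G.computedSources k, G.IsKCutSet k (G.cut U) ∧ F = G.cut U} ∪
  {F | ∃ P : Fin k → Finset V, IsKPartition P ∧ (∀ i, P i ∈ G.collection k) ∧ F = G.crossing P}

/-- The family returned by `Enum-Cuts(G, k)`: the cheapest ones among the `k`-cut-sets in `𝓕`. -/
def enumCuts [Fintype E] (G : MultiHypergraph V E) (k : ℕ) : Set (Finset E) :=
  {F ∈ G.candidates k | G.IsKCutSet k F ∧
    ∀ F' ∈ G.candidates k, G.IsKCutSet k F' → F.card ≤ F'.card}

end MultiHypergraph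

/-! ### A random access machine

Uniform-cost RAM programs in structured form. A program has named registers and named arrays (each
program mentions finitely many), holding natural numbers. The only operations are addition, truncated
subtraction, comparison and indexed array access, each at unit cost. -/

namespace Ram

/-- A memory state: register contents, and the contents of cell `i` of array `a`. -/
structure State where
  reg : ℕ → ℕ
  mem : ℕ → ℕ → ℕ

/-- Array `a` read as a list: cell `0` holds the length, the following cells the entries. -/
def State.readList (s : State) (a : ℕ) : List ℕ :=
  (List.range (s.mem a 0)).map fun i => s.mem a (i + 1)

/-- Store a list in array `a`, in the format of `State.readList`; other cells are unchanged. -/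
def State.writeList (s : State) (a : ℕ) (l : List ℕ) : State where
  reg := s.reg
  mem := Function.update s.mem a fun i =>
    if i = 0 then l.length else if i ≤ l.length then l.getD (i - 1) 0 else s.mem a i

/-- The initial state: the input list is in array `0`, everything else is zero. -/
def State.ofInput (w : List ℕ) : State :=
  State.writeList ⟨fun _ => 0, fun _ _ => 0⟩ 0 w

/-- The output is the list in array `1`. -/
def State.output (s : State) : List ℕ := s.readList 1

inductive Expr where
  | lit (c : ℕ)
  | reg (x : ℕ)
  | get (a : ℕ) (i : Expr)
  | add (e f : Expr)
  | sub (e f : Expr)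
  | lt (e f : Expr)
  | eq (e f : Expr)

def Expr.eval (s : State) : Expr → ℕ
  | lit c => c
  | reg x => s.reg x
  | get a i => s.mem a (i.eval s)
  | add e f => e.eval s + f.eval s
  | sub e f => e.eval s - f.eval s
  | lt e f => if e.eval s < f.eval s then 1 else 0
  | eq e f => if e.eval s = f.eval s then 1 else 0

/-- The number of operations performed when an expression is evaluated. -/
def Expr.cost : Expr → ℕ
  | lit _ => 1
  | reg _ => 1
  | get _ i => i.cost + 1
  | add e f => e.cost + f.cost + 1
  | sub e f => e.cost + f.cost + 1
  | lt e f => e.cost + f.cost + 1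
  | eq e f => e.cost + f.cost + 1

/-- Programs. A condition holds if its value is non-zero. `call Q dst src` runs `Q` as a subroutine
with its own memory: the list in array `src` is copied to the input of `Q`, and the output of `Q` is
copied to array `dst`. -/
inductive Prog where
  | skip
  | set (x : ℕ) (e : Expr)
  | put (a : ℕ) (i e : Expr)
  | seq (P Q : Prog)
  | ite (b : Expr) (P Q : Prog)
  | loop (b : Expr) (P : Prog)
  | call (Q : Prog) (dst src : ℕ)

/-- `Exec P s t s'`: started in state `s`, the program `P` halts after `t` steps in state `s'`. -/
inductive Exec : Prog → State → ℕ → State → Prop where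
  | skip (s : State) : Exec Prog.skip s 1 s
  | set (s : State) (x : ℕ) (e : Expr) :
      Exec (Prog.set x e) s (e.cost + 1)
        ⟨Function.update s.reg x (e.eval s), s.mem⟩
  | put (s : State) (a : ℕ) (i e : Expr) :
      Exec (Prog.put a i e) s (i.cost + e.cost + 1)
        ⟨s.reg, Function.update s.mem a (Function.update (s.mem a) (i.eval s) (e.eval s))⟩
  | seq {P Q : Prog} {s s₁ s₂ : State} {t₁ t₂ : ℕ} :
      Exec P s t₁ s₁ → Exec Q s₁ t₂ s₂ → Exec (Prog.seq P Q) s (t₁ + t₂) s₂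
  | ite_true {b : Expr} {P Q : Prog} {s s₁ : State} {t : ℕ} :
      b.eval s ≠ 0 → Exec P s t s₁ → Exec (Prog.ite b P Q) s (b.cost + 1 + t) s₁
  | ite_false {b : Expr} {P Q : Prog} {s s₁ : State} {t : ℕ} :
      b.eval s = 0 → Exec Q s t s₁ → Exec (Prog.ite b P Q) s (b.cost + 1 + t) s₁
  | loop_true {b : Expr} {P : Prog} {s s₁ s₂ : State} {t₁ t₂ : ℕ} :
      b.eval s ≠ 0 → Exec P s t₁ s₁ → Exec (Prog.loop b P) s₁ t₂ s₂ →
        Exec (Prog.loop b P) s (b.cost + 1 + t₁ + t₂) s₂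
  | loop_false {b : Expr} {P : Prog} {s : State} :
      b.eval s = 0 → Exec (Prog.loop b P) s (b.cost + 1) s
  /-- A call costs the running time of the subroutine plus the length of the lists copied. -/
  | call {Q : Prog} {dst src : ℕ} {s s₁ : State} {t : ℕ} :
      Exec Q (State.ofInput (s.readList src)) t s₁ →
        Exec (Prog.call Q dst src) s
          (t + (s.readList src).length + s₁.output.length + 1)
          (s.writeList dst s₁.output)

/-- On input `w`, the program `P` halts after `t` steps with output `out`. -/
def Prog.RunsTo (P : Prog) (w : List ℕ) (t : ℕ) (out : List ℕ) : Prop :=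
  ∃ s, Exec P (State.ofInput w) t s ∧ s.output = out

end Ram

/-! ### Encodings and computational problems -/

/-- The elements of a subset of `{0, …, n - 1}`, listed in increasing order. -/
def encodeFinset {n : ℕ} (A : Finset (Fin n)) : List ℕ :=
  ((List.finRange n).filter fun v => v ∈ A).map Fin.val

/-- A list of sets: the number of sets and then, for each of them, its cardinality and elements. -/
def encodeSetList {n : ℕ} (L : List (Finset (Fin n))) : List ℕ :=
  L.length :: L.flatMap fun A => A.card :: encodeFinset A

/-- A hypergraph: the number of vertices, followed by the list of its hyperedges. -/
def MultiHypergraph.encode {n m : ℕ} (G : MultiHypergraph (Fin n) (Fin m)) : List ℕ :=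
  n :: encodeSetList ((List.finRange m).map G.edge)

/-- `Q` computes the source minimal minimum `(s, t)`-terminal cut of any two distinct vertices of any
`n`-vertex hypergraph of size `p` within `T n p` steps; it lists the source set, in any order. -/
def SolvesSourceMinimalCut (Q : Ram.Prog) (T : ℕ → ℕ → ℕ) : Prop :=
  ∀ (n m : ℕ) (G : MultiHypergraph (Fin n) (Fin m)), G.NoEmptyEdge →
    ∀ s t : Fin n, s ≠ t →
      ∃ (U : Finset (Fin n)) (out : List ℕ) (time : ℕ),
        G.IsSourceMinimalCut {s} {t} U ∧ out.Perm (encodeFinset U) ∧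
        Q.RunsTo (s.val :: t.val :: G.encode) time out ∧ time ≤ T n G.size

namespace MultiHypergraph

variable {V E : Type*}

/-! ### Cut-sets and labelings -/

/-! A minimum `k`-cut-set `F` is the set of hyperedges crossing some `k`-partition `P`, and the
structural claim is that the parts can be recovered from terminal sets of bounded size. Always `δ(P
i) ⊆ F`. If every inclusion is proper, each `|δ(P i)|` is smaller than all `k`-cut-sets; then `P i`
is the unique minimum `(S, T)`-terminal cut for some `S` and `T` with at most `2k - 1` elements
(`exists_terminals_of_lt`), so all parts enter `𝒞`. If `δ(P i) = F` for some `i`, the source minimal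
cut `X` for suitable small terminals may differ from `P i`, but `δ(X) = F`
(`exists_terminals_of_cut_mem`). Hence every minimum `k`-cut-set is a candidate, and keeping the
cheapest candidates leaves exactly these.

The heart is `exists_small_source`. Put `D = |δ(U)|` and let `S` be a point of `U` together with an
inclusion-minimal transversal of the unwanted sets `Q ⊇ V \ U` with `|δ(Q)| ≤ D`. If `S` is too
large, minimality provides at least `2k - 1` unwanted sets, each with a private element. Classify
the vertices as lying in none, exactly one, or at least two of these sets, regard the classes as
points of a small graph, and let the spread of a hyperedge be the diameter of its classes. Adding
the sets one at a time, `sum_spread_le` bounds the total spread by `2D`: the first two sets cost at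
most `D` each, and every later set is compensated by the cut of its intersection with the vertices
already covered twice. Conversely, two disjoint groups of `k - 1` sets define two `k`-cut-sets, each
separating the private regions of its group from one another and from the rest, and
`partCut_add_le_spread` bounds the sum of their sizes by the total spread. Both have size at least
`D`. This is absurd if all `k`-cut-sets are larger than `D`; otherwise equality holds throughout,
which forces `δ(A) = δ(U)` for an unwanted set `A`, and such sets are not unwanted in that case.
Submodularity then combines the sets obtained for `U` and for its complement.

Tuples of length `2k - 1` give at most `n ^ (4k - 2)` computed sources, and a candidate comes from
one source or from `k` of them; this is the cardinality bound.

The program encodes terminal pairs as vertex labels. A label is a binary number whose low `2k - 1`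
digits describe `T` and whose high digits describe `S`; all labelings occur in a tree in which a
child is twice its parent plus an input row (`rowSums`). For each labeling the terminals are
contracted to two vertices, and singletons are added so that the size, and hence the bound `T n p`,
is unchanged; the subroutine then returns a source set. A second tree forms the labels given by `k -
1` source sets. These suffice, since every candidate is a union of `k - 1` cuts of sources. For
every such labeling the machine counts the components left after removing the hyperedges with
non-constant labels, and keeps the cheapest `k`-cut-sets, using the binary code of a set as an
address to avoid duplicates. Using `k - 1` sources rather than `k` leaves room for the quadratic
cost of an evaluation (`time_le`). -/

theorem mem_cut [Fintype E] {G : MultiHypergraph V E} {U : Finset V} {e : E} :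
    e ∈ G.cut U ↔ (∃ u ∈ G.edge e, u ∈ U) ∧ ∃ v ∈ G.edge e, v ∉ U := by
  simp [cut]

theorem mem_crossing [Fintype E] {G : MultiHypergraph V E} {k : ℕ} {P : Fin k → Finset V} {e : E} :
    e ∈ G.crossing P ↔
      ∃ i j, i ≠ j ∧ (∃ u ∈ G.edge e, u ∈ P i) ∧ (∃ v ∈ G.edge e, v ∈ P j) := by
  simp [crossing]

theorem eq_of_reachable {G : MultiHypergraph V E} {F : Finset E} {α : Type*} {f : V → α}
    (hf : ∀ e, e ∉ F → ∀ u ∈ G.edge e, ∀ v ∈ G.edge e, f u = f v) {u v : V}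
    (h : (G.graphAfterRemoval F).Reachable u v) : f u = f v := by
  obtain ⟨p⟩ := h
  induction p with
  | nil => rfl
  | cons hadj _ ih =>
    refine Eq.trans ?_ ih
    simp only [graphAfterRemoval, SimpleGraph.fromRel_adj] at hadj
    obtain ⟨-, ⟨e, he, hu, hv⟩ | ⟨e, he, hu, hv⟩⟩ := hadj
    · exact hf e he _ hu _ hv
    · exact hf e he _ hv _ hu

theorem reachable_of_mem_edge {G : MultiHypergraph V E} {F : Finset E} {e : E} (he : e ∉ F) {u v : V}
    (hu : u ∈ G.edge e) (hv : v ∈ G.edge e) : (G.graphAfterRemoval F).Reachable u v := by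
  by_cases h : u = v
  · rw [h]
  · refine SimpleGraph.Adj.reachable ?_
    simp only [graphAfterRemoval, SimpleGraph.fromRel_adj]
    exact ⟨h, Or.inl ⟨e, he, hu, hv⟩⟩

/-- Such a labeling factors through the components, so there are at least as many components as
labels. -/
theorem isKCutSet_of_labeling [Finite V] {G : MultiHypergraph V E} {F : Finset E} {k : ℕ}
    {α : Type*} (f : V → α)
    (hf : ∀ e, e ∉ F → ∀ u ∈ G.edge e, ∀ v ∈ G.edge e, f u = f v)
    (hk : k ≤ (Set.range f).ncard) : G.IsKCutSet k F := by
  refine hk.trans ?_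
  have : Finite (G.graphAfterRemoval F).ConnectedComponent := Quot.finite _
  let g : (G.graphAfterRemoval F).ConnectedComponent → Set.range f :=
    Quot.lift (fun v => ⟨f v, v, rfl⟩) fun u v h => Subtype.ext (eq_of_reachable hf h)
  refine Nat.card_le_card_of_surjective g ?_
  rintro ⟨_, v, rfl⟩
  exact ⟨Quot.mk _ v, rfl⟩

/-- Embed `Fin k` into the components. `invFun` sends all components outside the range to a default
label, which merges the surplus ones. -/
theorem IsKCutSet.exists_labeling [Finite V] {G : MultiHypergraph V E} {F : Finset E} {k : ℕ}
    (hk : 0 < k) (h : G.IsKCutSet k F) :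
    ∃ f : V → Fin k, Function.Surjective f ∧
      ∀ e, e ∉ F → ∀ u ∈ G.edge e, ∀ v ∈ G.edge e, f u = f v := by
  have : Finite (G.graphAfterRemoval F).ConnectedComponent := Quot.finite _
  have : Fintype (G.graphAfterRemoval F).ConnectedComponent := Fintype.ofFinite _
  have : NeZero k := ⟨hk.ne'⟩
  have hc : Fintype.card (Fin k) ≤ Fintype.card (G.graphAfterRemoval F).ConnectedComponent := by
    simpa [IsKCutSet, numComponents, Nat.card_eq_fintype_card] using h
  obtain ⟨g⟩ := Function.Embedding.nonempty_of_card_le hc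
  refine ⟨fun v => Function.invFun g (SimpleGraph.connectedComponentMk _ v), ?_, ?_⟩
  · intro i
    obtain ⟨v, hv⟩ := (g i).exists_rep
    refine ⟨v, ?_⟩
    have : SimpleGraph.connectedComponentMk _ v = g i := hv
    simp only [this]
    exact Function.leftInverse_invFun g.injective i
  · intro e he u hu v hv
    simp only [SimpleGraph.ConnectedComponent.eq.mpr (reachable_of_mem_edge he hu hv)]

theorem IsKPartition.unique {k : ℕ} {P : Fin k → Finset V} (hP : IsKPartition P) {i j : Fin k}
    {v : V} (hi : v ∈ P i) (hj : v ∈ P j) : i = j := by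
  by_contra h
  exact Finset.disjoint_left.mp (hP.2.1 i j h) hi hj

theorem IsKPartition.isKCutSet_crossing [Finite V] [Fintype E] {G : MultiHypergraph V E} {k : ℕ}
    {P : Fin k → Finset V} (hP : IsKPartition P) : G.IsKCutSet k (G.crossing P) := by
  choose f hf using hP.2.2
  refine isKCutSet_of_labeling f ?_ ?_
  · intro e he u hu v hv
    by_contra h
    exact he (mem_crossing.mpr ⟨f u, f v, h, ⟨u, hu, hf u⟩, ⟨v, hv, hf v⟩⟩)
  · have : Set.range f = Set.univ := by
      refine Set.range_eq_univ.mpr fun i => ?_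
      obtain ⟨v, hv⟩ := hP.1 i
      exact ⟨v, hP.unique (hf v) hv⟩
    simp [this, Set.ncard_univ]

/-- The hyperedges crossing the classes of a labeling lie in `F` and already form a `k`-cut-set, so
minimality of `F` gives equality. -/
theorem exists_isKPartition_of_mem_minKCutSets [Fintype V] [Fintype E] {G : MultiHypergraph V E}
    {k : ℕ} (hk : 0 < k) {F : Finset E} (hF : F ∈ G.minKCutSets k) :
    ∃ P : Fin k → Finset V, IsKPartition P ∧ F = G.crossing P := by
  classical
  obtain ⟨f, hf, hmono⟩ := hF.1.exists_labeling hk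
  have hP : IsKPartition fun i => Finset.univ.filter fun v => f v = i := by
    refine ⟨fun i => ?_, fun i j hij => ?_, fun v => ⟨f v, by simp⟩⟩
    · obtain ⟨v, hv⟩ := hf i
      exact ⟨v, by simpa using hv⟩
    · rw [Finset.disjoint_left]
      intro v hi hj
      simp only [Finset.mem_filter, Finset.mem_univ, true_and] at hi hj
      exact hij (hi.symm.trans hj)
  refine ⟨_, hP, (Finset.eq_of_subset_of_card_le ?_ (hF.2 _ hP.isKCutSet_crossing)).symm⟩
  intro e he
  obtain ⟨i, j, hij, ⟨u, hu, hui⟩, ⟨v, hv, hvj⟩⟩ := mem_crossing.mp he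
  simp only [Finset.mem_filter, Finset.mem_univ, true_and] at hui hvj
  by_contra h
  exact hij (hui ▸ hvj ▸ hmono e h u hu v hv)

theorem IsKPartition.cut_subset_crossing [Fintype E] {G : MultiHypergraph V E} {k : ℕ}
    {P : Fin k → Finset V} (hP : IsKPartition P) (i : Fin k) : G.cut (P i) ⊆ G.crossing P := by
  intro e he
  obtain ⟨⟨u, hu, hui⟩, ⟨v, hv, hvi⟩⟩ := mem_cut.mp he
  obtain ⟨j, hj⟩ := hP.2.2 v
  exact mem_crossing.mpr ⟨i, j, fun h => hvi (h ▸ hj), ⟨u, hu, hui⟩, ⟨v, hv, hj⟩⟩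

/-! ### Submodularity -/

theorem cut_compl [Fintype V] [DecidableEq V] [Fintype E] (G : MultiHypergraph V E)
    (U : Finset V) : G.cut Uᶜ = G.cut U := by
  ext e
  simp only [mem_cut, Finset.mem_compl, not_not]
  exact and_comm

/-- Submodularity hyperedge by hyperedge: one that crosses `X ∩ U` or `X ∪ U` crosses `X` or `U`,
and one that crosses both of the former crosses both of the latter. -/
theorem card_cut_inter_add_card_cut_union_le [DecidableEq V] [Fintype E] (G : MultiHypergraph V E)
    (X U : Finset V) :
    (G.cut (X ∩ U)).card + (G.cut (X ∪ U)).card ≤ (G.cut X).card + (G.cut U).card := by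
  classical
  rw [← Finset.card_union_add_card_inter, ← Finset.card_union_add_card_inter (G.cut X)]
  refine Nat.add_le_add (Finset.card_le_card ?_) (Finset.card_le_card ?_) <;> intro e <;>
    simp only [Finset.mem_union, Finset.mem_inter, mem_cut] <;> grind

/-- Two source minimal minimum terminal cuts for the same terminals are equal. -/
theorem IsSourceMinimalCut.unique [Fintype E] {G : MultiHypergraph V E} {S T U U' : Finset V}
    (h : G.IsSourceMinimalCut S T U) (h' : G.IsSourceMinimalCut S T U') : U = U' := by
  classical
  have hterm : IsTerminalCut S T (U ∩ U') :=
    ⟨Finset.subset_inter h.1.1.1 h'.1.1.1, h.1.1.2.mono_left Finset.inter_subset_left⟩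
  have hterm' : IsTerminalCut S T (U ∪ U') :=
    ⟨h.1.1.1.trans Finset.subset_union_left, Finset.disjoint_union_left.mpr ⟨h.1.1.2, h'.1.1.2⟩⟩
  have hle : (G.cut (U ∩ U')).card ≤ (G.cut U).card := by
    have := G.card_cut_inter_add_card_cut_union_le U U'
    have := h'.1.2 _ hterm'
    omega
  have hmin : G.IsMinTerminalCut S T (U ∩ U') := ⟨hterm, fun X hX => hle.trans (h.1.2 X hX)⟩
  have h₁ : U ⊆ U ∩ U' := h.2 hmin Finset.inter_subset_left
  have h₂ : U' ⊆ U ∩ U' := h'.2 hmin Finset.inter_subset_right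
  exact (h₁.trans Finset.inter_subset_right).antisymm (h₂.trans Finset.inter_subset_left)

theorem exists_isSourceMinimalCut [Fintype V] [Fintype E] (G : MultiHypergraph V E)
    {S T : Finset V} (h : Disjoint S T) : ∃ U, G.IsSourceMinimalCut S T U := by
  classical
  obtain ⟨U, hU, hmin⟩ := Finset.exists_min_image
    ((Finset.univ : Finset (Finset V)).filter fun U => IsTerminalCut S T U)
    (fun U => (G.cut U).card) ⟨S, Finset.mem_filter.mpr ⟨Finset.mem_univ _, Finset.Subset.refl _, h⟩⟩
  have : G.IsMinTerminalCut S T U := ⟨by simpa using hU, fun X hX => hmin X (by simpa using hX)⟩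
  obtain ⟨M, -, hM⟩ := exists_minimal_le_of_wellFoundedLT (G.IsMinTerminalCut S T) U this
  exact ⟨M, hM⟩

/-! ### Uncrossing a family of sets -/

/-- The position of a vertex relative to a family of sets: in none of them, in exactly one of them,
or in at least two of them. -/
inductive Position (ι : Type*) where
  | none
  | one (i : ι)
  | many

namespace Position

variable {ι : Type*}

/-- The new position of a vertex when a set with index `j` that contains it joins the family. -/
def bump (j : ι) : Position ι → Position ι
  | none => one j
  | one _ => many
  | many => many

open Classical in
/-- The graph distance of two positions if `none` and `many` are joined to each `one i`. -/
noncomputable def dist : Position ι → Position ι → ℕ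
  | none, none => 0
  | many, many => 0
  | none, many => 2
  | many, none => 2
  | one i, one j => if i = j then 0 else 2
  | one _, none => 1
  | one _, many => 1
  | none, one _ => 1
  | many, one _ => 1

/-- Bumping does not expand distances in the graph of positions. -/
theorem dist_bump_le (j : ι) (a b : Position ι) : (a.bump j).dist (b.bump j) ≤ a.dist b := by
  cases a <;> cases b <;> simp [bump, dist]

/-- Bumping fixes a position or moves it along one edge of the graph. -/
theorem dist_bump_left_le (j : ι) (a b : Position ι) : (a.bump j).dist b ≤ a.dist b + 1 := by
  cases a <;> cases b <;> simp [bump, dist]; split_ifs <;> simp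

theorem dist_comm (a b : Position ι) : a.dist b = b.dist a := by
  cases a <;> cases b <;> grind [dist]

/-- This yields a strict decrease of the spread when all vertices are bumped. Two positions other
than `none` both become `many`, while `c` is not `many`; and if `none` occurs, the right side is 2.
-/
theorem dist_bump_lt (j : ι) {a b c : Position ι} (hc : c ≠ many) :
    (a.bump j).dist (b.bump j) <
      max (many.dist c) (max (many.dist a) (many.dist b)) := by
  cases a <;> cases b <;> cases c <;> simp_all [bump, dist]

/-- For a hyperedge with a vertex at position `many`, no pattern of bumps can increase the spread.
-/
theorem dist_bump_le_max (j : ι) (a b : Position ι) (p q : Prop) [Decidable p] [Decidable q] :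
    (if p then a.bump j else a).dist (if q then b.bump j else b) ≤
      max (a.dist b) (max (many.dist a) (many.dist b)) := by
  by_cases p <;> by_cases q <;> cases a <;> cases b <;> simp_all [bump, dist] <;> split_ifs <;> simp

end Position

section Uncrossing

variable {ι : Type*}

open Classical in
/-- The position of a vertex relative to the sets `A i` with `i` in a list. -/
noncomputable def position (A : ι → Finset V) : List ι → V → Position ι
  | [], _ => Position.none
  | j :: l, v => if v ∈ A j then (position A l v).bump j else position A l v

theorem position_eq_none {A : ι → Finset V} {l : List ι} {v : V} :
    position A l v = Position.none ↔ ∀ i ∈ l, v ∉ A i := by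
  induction l with
  | nil => simp [position]
  | cons j l ih =>
    by_cases h : v ∈ A j
    · cases h' : position A l v <;> simp [position, h, h', Position.bump]
    · simp [position, h, ih]

theorem mem_of_position_eq_one {A : ι → Finset V} {l : List ι} {v : V} {i : ι}
    (h : position A l v = Position.one i) : i ∈ l ∧ v ∈ A i ∧ ∀ j ∈ l, v ∈ A j → j = i := by
  induction l with
  | nil => simp [position] at h
  | cons j l ih =>
    by_cases hj : v ∈ A j
    · cases h' : position A l v <;> simp [position, hj, h', Position.bump] at h
      subst h
      rw [position_eq_none] at h'
      refine ⟨by simp, hj, fun i hi hv => ?_⟩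
      rcases List.mem_cons.mp hi with rfl | hi
      · rfl
      · exact absurd hv (h' i hi)
    · simp only [position, hj, if_false] at h
      obtain ⟨h₁, h₂, h₃⟩ := ih h
      refine ⟨by simp [h₁], h₂, fun i hi hv => ?_⟩
      rcases List.mem_cons.mp hi with rfl | hi
      · exact absurd hv hj
      · exact h₃ i hi hv

/-- A repeated index would be counted twice, hence `Nodup`. -/
theorem exists_of_position_eq_many {A : ι → Finset V} {l : List ι} (hl : l.Nodup) {v : V}
    (h : position A l v = Position.many) : ∃ i ∈ l, ∃ j ∈ l, i ≠ j ∧ v ∈ A i ∧ v ∈ A j := by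
  induction l with
  | nil => simp [position] at h
  | cons j l ih =>
    obtain ⟨hj', hl'⟩ := List.nodup_cons.mp hl
    by_cases hj : v ∈ A j
    · cases h' : position A l v with
      | none => simp [position, hj, h', Position.bump] at h
      | one i =>
        obtain ⟨h₁, h₂, -⟩ := mem_of_position_eq_one h'
        exact ⟨j, by simp, i, by simp [h₁], fun h => hj' (h ▸ h₁), hj, h₂⟩
      | many =>
        obtain ⟨a, ha, b, hb, hab⟩ := ih hl' h'
        exact ⟨a, by simp [ha], b, by simp [hb], hab⟩
    · simp only [position, hj, if_false] at h
      obtain ⟨a, ha, b, hb, hab⟩ := ih hl' h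
      exact ⟨a, by simp [ha], b, by simp [hb], hab⟩

theorem position_eq_many_of_forall_mem {A : ι → Finset V} {l : List ι} (hl : 2 ≤ l.length) {v : V}
    (h : ∀ i ∈ l, v ∈ A i) : position A l v = Position.many := by
  match l, hl with
  | [a, b], _ => simp [position, h a (by simp), h b (by simp), Position.bump]
  | a :: b :: c :: l, _ =>
    have := position_eq_many_of_forall_mem (A := A) (l := b :: c :: l) (by simp)
      fun i hi => h i (List.mem_cons_of_mem _ hi)
    rw [position, if_pos (h a (by simp)), this, Position.bump]

theorem position_eq_one {A : ι → Finset V} {l : List ι} (hl : l.Nodup) {v : V} {i : ι} (hi : i ∈ l)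
    (hv : v ∈ A i) (h : ∀ j ∈ l, v ∈ A j → j = i) : position A l v = Position.one i := by
  cases h' : position A l v with
  | none => exact absurd hv (position_eq_none.mp h' i hi)
  | one j => rw [h j (mem_of_position_eq_one h').1 (mem_of_position_eq_one h').2.1]
  | many =>
    obtain ⟨a, ha, b, hb, hab, hva, hvb⟩ := exists_of_position_eq_many hl h'
    exact absurd ((h a ha hva).trans (h b hb hvb).symm) hab

/-- The diameter of the set of positions of the vertices of a hyperedge. -/
noncomputable def spread (A : ι → Finset V) (l : List ι) (e : Finset V) : ℕ :=
  (e ×ˢ e).sup fun p => (position A l p.1).dist (position A l p.2)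

theorem dist_le_spread {A : ι → Finset V} {l : List ι} {e : Finset V} {u v : V} (hu : u ∈ e)
    (hv : v ∈ e) : (position A l u).dist (position A l v) ≤ spread A l e :=
  Finset.le_sup (f := fun p : V × V => (position A l p.1).dist (position A l p.2))
    (Finset.mk_mem_product hu hv)

theorem exists_dist_eq_spread (A : ι → Finset V) (l : List ι) {e : Finset V} (he : e.Nonempty) :
    ∃ u ∈ e, ∃ v ∈ e, (position A l u).dist (position A l v) = spread A l e := by
  obtain ⟨⟨u, v⟩, hp, h⟩ := Finset.exists_mem_eq_sup (e ×ˢ e) (he.product he)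
    fun p => (position A l p.1).dist (position A l p.2)
  obtain ⟨hu, hv⟩ := Finset.mem_product.mp hp
  exact ⟨u, hu, v, hv, h.symm⟩

-- This is a refined submodular inequality for one hyperedge. Adding `A j` raises the spread by at
-- most one, and only if the hyperedge crosses `A j`. If it also crosses the part of `A j` that was
-- covered twice before, one unit is saved.
open Classical in
theorem spread_cons_add_le [Fintype E] (G : MultiHypergraph V E) (A : ι → Finset V) (j : ι)
    (l : List ι) (e : E) :
    spread A (j :: l) (G.edge e) +
        (if e ∈ G.cut ((A j).filter fun v => position A l v = Position.many) then 1 else 0) ≤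
      spread A l (G.edge e) + (if e ∈ G.cut (A j) then 1 else 0) := by
  rcases (G.edge e).eq_empty_or_nonempty with he | he
  · simp [mem_cut, he, spread]
  obtain ⟨u, hu, v, hv, huv⟩ := exists_dist_eq_spread A (j :: l) he
  rw [← huv]
  have huv' := dist_le_spread (A := A) (l := l) hu hv
  have hcut : ∀ x ∈ G.edge e, ∀ y ∈ G.edge e, x ∈ A j → y ∉ A j → e ∈ G.cut (A j) :=
    fun x hx y hy h h' => mem_cut.mpr ⟨⟨x, hx, h⟩, y, hy, h'⟩
  by_cases hg : e ∈ G.cut ((A j).filter fun v => position A l v = Position.many)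
  · rw [if_pos hg]
    obtain ⟨⟨x, hx, hxg⟩, y, hy, hyg⟩ := mem_cut.mp hg
    rw [Finset.mem_filter] at hxg hyg
    -- The vertex `x` has position `many`, so the old spread dominates the distances from `many` to
    -- all positions in the hyperedge.
    have h₁ := dist_le_spread (A := A) (l := l) hx hu
    have h₂ := dist_le_spread (A := A) (l := l) hx hv
    have h₃ := dist_le_spread (A := A) (l := l) hx hy
    rw [hxg.2] at h₁ h₂ h₃
    by_cases hc : e ∈ G.cut (A j)
    · rw [if_pos hc]
      have := Position.dist_bump_le_max j (position A l u) (position A l v) (u ∈ A j) (v ∈ A j)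
      simp only [position]
      omega
    -- The hyperedge lies inside `A j`, so all its vertices are bumped, and `y` was not at `many`:
    -- the spread drops strictly.
    · have hA : ∀ z ∈ G.edge e, z ∈ A j := fun z hz => by
        by_contra h
        exact hc (hcut x hx z hz hxg.1 h)
      have := Position.dist_bump_lt j (a := position A l u) (b := position A l v)
        (c := position A l y) fun h => hyg ⟨hA y hy, h⟩
      simp only [position, if_pos (hA u hu), if_pos (hA v hv), if_neg hc]
      omega
  · rw [if_neg hg]
    have c₁ := hcut u hu v hv
    have c₂ := hcut v hv u hu
    simp only [position]
    by_cases au : u ∈ A j <;> by_cases av : v ∈ A j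
    · have := Position.dist_bump_le j (position A l u) (position A l v)
      simp only [if_pos au, if_pos av]
      omega
    · have := Position.dist_bump_left_le j (position A l u) (position A l v)
      simp only [if_pos au, if_neg av, if_pos (c₁ au av)]
      omega
    · have := Position.dist_bump_left_le j (position A l v) (position A l u)
      rw [Position.dist_comm, Position.dist_comm (position A l v)] at this
      simp only [if_neg au, if_pos av, if_pos (c₂ av au)]
      omega
    · simp only [if_neg au, if_neg av]
      omega

open Classical in
theorem sum_spread_cons_add_le [Fintype E] (G : MultiHypergraph V E) (A : ι → Finset V) (j : ι)
    (l : List ι) :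
    ∑ e, spread A (j :: l) (G.edge e) +
        (G.cut ((A j).filter fun v => position A l v = Position.many)).card ≤
      ∑ e, spread A l (G.edge e) + (G.cut (A j)).card := by
  have hcard : ∀ U, (G.cut U).card = ∑ e, if e ∈ G.cut U then 1 else 0 := by simp
  rw [hcard, hcard, ← Finset.sum_add_distrib, ← Finset.sum_add_distrib]
  exact Finset.sum_le_sum fun e _ => spread_cons_add_le G A j l e

/-- Each new set adds at most `D`. Once two sets are present, `C` lies at position `many`, so the
set whose cut is subtracted is one of the `Q` in `hQ` and gives back at least `D`. Only the first
two sets are therefore paid for. -/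
theorem sum_spread_le [Fintype E] (G : MultiHypergraph V E) (A : ι → Finset V) (C : Finset V) (D : ℕ)
    (l : List ι) (hl : l.Nodup) (hC : ∀ i ∈ l, C ⊆ A i) (hD : ∀ i ∈ l, (G.cut (A i)).card ≤ D)
    (hQ : ∀ Q : Finset V, C ⊆ Q → (∀ v ∈ Q, ∃ i ∈ l, ∃ j ∈ l, i ≠ j ∧ v ∈ A i ∧ v ∈ A j) →
      D ≤ (G.cut Q).card) :
    ∑ e, spread A l (G.edge e) ≤ min l.length 2 * D := by
  classical
  induction l with
  | nil =>
    have : ∀ e : E, spread A [] (G.edge e) = 0 := fun e => by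
      simp [spread, position, Position.dist]
    simp [this]
  | cons j l ih =>
    obtain ⟨hj, hl'⟩ := List.nodup_cons.mp hl
    have ih' := ih hl' (fun i hi => hC i (List.mem_cons_of_mem _ hi))
      (fun i hi => hD i (List.mem_cons_of_mem _ hi)) (fun Q hCQ h => hQ Q hCQ fun v hv => by
        obtain ⟨a, ha, b, hb, h⟩ := h v hv
        exact ⟨a, List.mem_cons_of_mem _ ha, b, List.mem_cons_of_mem _ hb, h⟩)
    have hstep := sum_spread_cons_add_le G A j l
    have hDj := hD j (by simp)
    by_cases h2 : 2 ≤ l.length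
    · have := hQ ((A j).filter fun v => position A l v = Position.many)
        (fun v hv => Finset.mem_filter.mpr ⟨hC j (by simp) hv,
          position_eq_many_of_forall_mem h2 fun i hi => hC i (List.mem_cons_of_mem _ hi) hv⟩)
        (fun v hv => by
          obtain ⟨a, ha, b, hb, h⟩ :=
            exists_of_position_eq_many hl' (Finset.mem_filter.mp hv).2
          exact ⟨a, List.mem_cons_of_mem _ ha, b, List.mem_cons_of_mem _ hb, h⟩)
      rw [min_eq_right h2] at ih'
      rw [min_eq_right (by simp; omega)]
      omega
    · have h3 : min (l.length + 1) 2 = l.length + 1 := by omega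
      rw [min_eq_left (by omega)] at ih'
      rw [List.length_cons, h3, add_mul]
      omega

end Uncrossing

end MultiHypergraph

namespace MultiHypergraph

variable {V E : Type*}

/-! ### Small terminal sets -/

section Halving

variable {ι : Type*}

open Classical in
/-- The part of a vertex in the partition into the sets of the vertices lying only in `A i`, for
`i ∈ I`, and the set of the remaining vertices. -/
noncomputable def part (A : ι → Finset V) (l : List ι) (I : Finset ι) (v : V) : Option ι :=
  match position A l v with
  | Position.one i => if i ∈ I then some i else none
  | _ => none

open Classical in
/-- The hyperedges that meet at least two of the parts given by `part`. -/
noncomputable def partCut [Fintype E] (G : MultiHypergraph V E) (A : ι → Finset V) (l : List ι)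
    (I : Finset ι) : Finset E :=
  Finset.univ.filter fun e => ∃ u ∈ G.edge e, ∃ v ∈ G.edge e, part A l I u ≠ part A l I v

theorem mem_partCut [Fintype E] {G : MultiHypergraph V E} {A : ι → Finset V} {l : List ι}
    {I : Finset ι} {e : E} :
    e ∈ G.partCut A l I ↔ ∃ u ∈ G.edge e, ∃ v ∈ G.edge e, part A l I u ≠ part A l I v := by
  simp [partCut]

theorem exists_position_of_part_ne {A : ι → Finset V} {l : List ι} {I : Finset ι} {u v : V}
    (h : part A l I u ≠ part A l I v) :
    ∃ i ∈ I, position A l u = Position.one i ∧ position A l v ≠ Position.one i ∨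
      position A l v = Position.one i ∧ position A l u ≠ Position.one i := by
  cases hu : position A l u <;> cases hv : position A l v <;> simp only [part, hu, hv] at h <;>
    grind

theorem Position.dist_pos_iff {a b : Position ι} : 0 < a.dist b ↔ a ≠ b := by
  cases a <;> cases b <;> grind [dist]

/-- The `k - 1` private regions count separately, and a vertex at `many` shows that the remaining
part is non-empty. -/
theorem isKCutSet_partCut [Finite V] [Fintype E] (G : MultiHypergraph V E) {A : ι → Finset V}
    {l : List ι} {I : Finset ι} {k : ℕ} (hI : k ≤ I.card + 1)
    (hone : ∀ i ∈ I, ∃ v, position A l v = Position.one i)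
    (hmany : ∃ v, position A l v = Position.many) : G.IsKCutSet k (G.partCut A l I) := by
  classical
  refine isKCutSet_of_labeling (part A l I) ?_ ?_
  · intro e he u hu v hv
    by_contra h
    exact he (mem_partCut.mpr ⟨u, hu, v, hv, h⟩)
  · have hsub : ((insert none (I.image some) : Finset (Option ι)) : Set (Option ι)) ⊆
        Set.range (part A l I) := by
      intro x hx
      rw [Finset.mem_coe, Finset.mem_insert, Finset.mem_image] at hx
      rcases hx with rfl | ⟨i, hi, rfl⟩
      · obtain ⟨v, hv⟩ := hmany
        exact ⟨v, by simp [part, hv]⟩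
      · obtain ⟨v, hv⟩ := hone i hi
        exact ⟨v, by simp [part, hv, hi]⟩
    have hc := Set.ncard_le_ncard hsub (Set.finite_range _)
    rw [Set.ncard_coe_finset, Finset.card_insert_of_notMem (by simp),
      Finset.card_image_of_injective _ (Option.some_injective _)] at hc
    omega

-- A hyperedge in one of the two cuts meets a private region and leaves it, so its spread is
-- positive. If it is in both, it meets private regions of two different indices, which are at
-- distance 2.
open Classical in
theorem partCut_add_le_spread [Fintype E] (G : MultiHypergraph V E) (A : ι → Finset V) (l : List ι)
    {I J : Finset ι} (hIJ : Disjoint I J) (e : E) :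
    (if e ∈ G.partCut A l I then 1 else 0) + (if e ∈ G.partCut A l J then 1 else 0) ≤
      spread A l (G.edge e) := by
  have hkey : ∀ K : Finset ι, e ∈ G.partCut A l K → ∃ i ∈ K, ∃ u ∈ G.edge e, ∃ v ∈ G.edge e,
      position A l u = Position.one i ∧ position A l v ≠ Position.one i := by
    intro K hK
    obtain ⟨u, hu, v, hv, huv⟩ := mem_partCut.mp hK
    obtain ⟨i, hi, h | h⟩ := exists_position_of_part_ne huv
    · exact ⟨i, hi, u, hu, v, hv, h⟩
    · exact ⟨i, hi, v, hv, u, hu, h⟩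
  have hpos : ∀ K : Finset ι, e ∈ G.partCut A l K → 1 ≤ spread A l (G.edge e) := by
    intro K hK
    obtain ⟨i, -, u, hu, v, hv, h₁, h₂⟩ := hkey K hK
    exact (Position.dist_pos_iff.mpr fun h => h₂ (h.symm.trans h₁)).trans_le (dist_le_spread hu hv)
  by_cases hI : e ∈ G.partCut A l I <;> by_cases hJ : e ∈ G.partCut A l J <;>
    simp only [hI, hJ, if_true, if_false]
  · obtain ⟨i, hi, u, hu, -, -, h₁, -⟩ := hkey I hI
    obtain ⟨j, hj, v, hv, -, -, h₂, -⟩ := hkey J hJ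
    have hij : i ≠ j := fun h => Finset.disjoint_left.mp hIJ hi (h ▸ hj)
    have := dist_le_spread (A := A) (l := l) hu hv
    simpa [h₁, h₂, Position.dist, hij] using this
  · exact hpos I hI
  · exact hpos J hJ
  · simp

-- The hyperedge `e₀` is kept apart so that its own slack in `partCut_add_le_spread` survives the
-- summation.
open Classical in
theorem card_partCut_add_le [Fintype E] (G : MultiHypergraph V E) (A : ι → Finset V) (l : List ι)
    {I J : Finset ι} (hIJ : Disjoint I J) (e₀ : E) :
    (G.partCut A l I).card + (G.partCut A l J).card + spread A l (G.edge e₀) ≤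
      ∑ e, spread A l (G.edge e) + ((if e₀ ∈ G.partCut A l I then 1 else 0) +
        (if e₀ ∈ G.partCut A l J then 1 else 0)) := by
  have hcard : ∀ U : Finset E, U.card = ∑ e, if e ∈ U then 1 else 0 := by simp
  rw [hcard, hcard (G.partCut A l J), ← Finset.sum_add_distrib,
    ← Finset.add_sum_erase _ _ (Finset.mem_univ e₀),
    ← Finset.add_sum_erase Finset.univ (fun e => spread A l (G.edge e)) (Finset.mem_univ e₀)]
  have := Finset.sum_le_sum (s := Finset.univ.erase e₀)
    fun e _ => partCut_add_le_spread G A l hIJ e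
  omega

end Halving

/-- If every `k`-cut-set has at least `D = |δ(U)|` elements, then there is a small set `S ⊆ U` such
that every set `Q ⊇ V \ U` avoiding `S` is cheap only if it is good. -/
theorem exists_small_source [Fintype V] [DecidableEq V] [Fintype E] (G : MultiHypergraph V E)
    {k : ℕ} (hk : 2 ≤ k) {U : Finset V} (hU : U.Nonempty) (hU' : Uᶜ.Nonempty)
    (hopt : ∀ F, G.IsKCutSet k F → (G.cut U).card ≤ F.card) (good : Finset V → Prop)
    (hgoodU : good Uᶜ) (hgood : ∀ Q, good Q → G.cut Q = G.cut U)
    (hcase : (∀ F, G.IsKCutSet k F → (G.cut U).card < F.card) ∨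
      ∀ Q, G.cut Q = G.cut U → good Q) :
    ∃ S : Finset V, S.Nonempty ∧ S ⊆ U ∧ S.card ≤ 2 * k - 1 ∧
      ∀ Q, Uᶜ ⊆ Q → Disjoint Q S → (G.cut Q).card ≤ (G.cut U).card → good Q := by
  classical
  obtain ⟨s, hs⟩ := hU
  -- Since `s` is put into the final set anyway, only sets avoiding `s` have to be hit.
  let bad : Finset V → Prop := fun Q =>
    Uᶜ ⊆ Q ∧ s ∉ Q ∧ (G.cut Q).card ≤ (G.cut U).card ∧ ¬ good Q
  let trans : Finset V → Prop := fun S => S ⊆ U ∧ ∀ Q, bad Q → ∃ v ∈ S, v ∈ Q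
  -- A bad set disjoint from `U` would be `Uᶜ`, which is good.
  have htU : trans U := by
    refine ⟨subset_rfl, fun Q hQ => ?_⟩
    by_contra! h
    have : Q = Uᶜ := Finset.Subset.antisymm
      (fun v hv => Finset.mem_compl.mpr fun hvU => h v hvU hv) hQ.1
    exact hQ.2.2.2 (this ▸ hgoodU)
  obtain ⟨S, -, hS⟩ := exists_minimal_le_of_wellFoundedLT trans U htU
  refine ⟨insert s S, by simp, Finset.insert_subset hs hS.1.1, ?_, fun Q h₁ h₂ h₃ => ?_⟩
  swap
  · by_contra hg
    rw [Finset.disjoint_insert_right] at h₂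
    obtain ⟨v, hv, hvQ⟩ := hS.1.2 Q ⟨h₁, h₂.1, h₃, hg⟩
    exact Finset.disjoint_left.mp h₂.2 hvQ hv
  by_contra hcard
  -- There is room for two disjoint groups of `k - 1` elements and one spare element.
  have hScard : 2 * k - 1 ≤ S.card := by
    have := Finset.card_insert_le s S
    omega
  -- each element of `S` is needed because of some bad set
  have hwit : ∀ u : V, ∃ Q, u ∈ S → bad Q ∧ u ∈ Q ∧ ∀ v ∈ S, v ∈ Q → v = u := by
    intro u
    by_cases hu : u ∈ S
    · by_contra! hno
      have : trans (S.erase u) := by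
        refine ⟨(Finset.erase_subset _ _).trans hS.1.1, fun Q hQ => ?_⟩
        obtain ⟨v, hv, hvQ⟩ := hS.1.2 Q hQ
        by_cases hvu : v = u
        · obtain ⟨-, h⟩ := hno Q
          obtain ⟨w, hw, hwQ, hwu⟩ := h hQ (hvu ▸ hvQ)
          exact ⟨w, Finset.mem_erase.mpr ⟨hwu, hw⟩, hwQ⟩
        · exact ⟨v, Finset.mem_erase.mpr ⟨hvu, hv⟩, hvQ⟩
      exact Finset.notMem_erase u S (hS.2 this (Finset.erase_subset _ _) hu)
    · exact ⟨∅, fun h => absurd h hu⟩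
  choose A hA using hwit
  set l := S.toList with hl
  have hlS : ∀ i, i ∈ l ↔ i ∈ S := fun i => by simp [hl]
  have hnd : l.Nodup := S.nodup_toList
  have hlen : l.length = S.card := by simp [hl]
  have hCA : ∀ i ∈ l, Uᶜ ⊆ A i := fun i hi => (hA i ((hlS i).mp hi)).1.1
  -- A bad set of doubly covered vertices would be hit by `S` in an element covered twice, but each
  -- element of `S` lies in its own witness only.
  have havoid : ∀ Q : Finset V, Uᶜ ⊆ Q →
      (∀ v ∈ Q, ∃ i ∈ l, ∃ j ∈ l, i ≠ j ∧ v ∈ A i ∧ v ∈ A j) →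
      (G.cut Q).card ≤ (G.cut U).card → good Q := by
    intro Q h₁ h₂ h₃
    by_contra hg
    have hbad : bad Q := by
      refine ⟨h₁, fun h => ?_, h₃, hg⟩
      obtain ⟨i, hi, -, -, -, h, -⟩ := h₂ s h
      exact (hA i ((hlS i).mp hi)).1.2.1 h
    obtain ⟨v, hv, hvQ⟩ := hS.1.2 Q hbad
    obtain ⟨i, hi, j, hj, hij, hvi, hvj⟩ := h₂ v hvQ
    exact hij (((hA i ((hlS i).mp hi)).2.2 v hv hvi).symm.trans
      ((hA j ((hlS j).mp hj)).2.2 v hv hvj))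
  -- A doubly covered `Q` is more expensive than `U`, or good and then of equal cost. So its cut has
  -- at least `D` elements, as the uncrossing requires.
  have hspread : ∑ e, spread A l (G.edge e) ≤ 2 * (G.cut U).card := by
    have := sum_spread_le G A Uᶜ (G.cut U).card l hnd hCA
      (fun i hi => (hA i ((hlS i).mp hi)).1.2.2.1) fun Q h₁ h₂ => by
        by_contra! h
        exact h.ne (by rw [hgood Q (havoid Q h₁ h₂ h.le)])
    rwa [min_eq_right (by omega)] at this
  have hone : ∀ i ∈ S, position A l i = Position.one i := fun i hi =>
    position_eq_one hnd ((hlS i).mpr hi) (hA i hi).2.1 fun j hj hij =>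
      ((hA j ((hlS j).mp hj)).2.2 i hi hij).symm
  have hmany : ∀ v ∈ Uᶜ, position A l v = Position.many := fun v hv =>
    position_eq_many_of_forall_mem (by omega) fun i hi => hCA i hi hv
  have hcut : ∀ I ⊆ S, I.card = k - 1 → G.IsKCutSet k (G.partCut A l I) := fun I hI hc =>
    isKCutSet_partCut G (by omega) (fun i hi => ⟨i, hone i (hI hi)⟩)
      (hU'.imp fun v hv => hmany v hv)
  -- The spare element permits any prescribed `i₀` to be avoided by both halves.
  have hhalves : ∀ i₀ : V, ∃ I J : Finset V, I ⊆ S ∧ J ⊆ S ∧ I.card = k - 1 ∧ J.card = k - 1 ∧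
      Disjoint I J ∧ i₀ ∉ I ∧ i₀ ∉ J := by
    intro i₀
    have h₀ : S.card - 1 ≤ (S.erase i₀).card := Finset.pred_card_le_card_erase
    obtain ⟨I, hI, hIc⟩ := Finset.exists_subset_card_eq (s := S.erase i₀) (n := k - 1) (by omega)
    have h₁ := Finset.card_sdiff_add_card_eq_card hI
    obtain ⟨J, hJ, hJc⟩ :=
      Finset.exists_subset_card_eq (s := S.erase i₀ \ I) (n := k - 1) (by omega)
    refine ⟨I, J, hI.trans (Finset.erase_subset _ _),
      (hJ.trans Finset.sdiff_subset).trans (Finset.erase_subset _ _), hIc, hJc, ?_, ?_, ?_⟩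
    · exact (Finset.disjoint_sdiff).mono_right hJ
    · exact fun h => Finset.notMem_erase i₀ S (hI h)
    · exact fun h => Finset.notMem_erase i₀ S (Finset.sdiff_subset (hJ h))
  obtain ⟨u₀, hu₀⟩ : S.Nonempty := Finset.card_pos.mp (by omega)
  -- a hyperedge separated by the positions meets a vertex of any position `one i` but one
  have hedge : ∀ e, 0 < spread A l (G.edge e) → ∀ i₀, ∃ v ∈ G.edge e, ∃ i ∈ S, i ≠ i₀ ∧
      position A l v = Position.one i := by
    intro e he i₀
    by_contra! hno
    obtain ⟨I, J, hI, hJ, hIc, hJc, hIJ, hI₀, hJ₀⟩ := hhalves i₀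
    have hout : ∀ K ⊆ S, i₀ ∉ K → e ∉ G.partCut A l K := by
      intro K hK hK₀ h
      obtain ⟨u, hu, v, hv, huv⟩ := mem_partCut.mp h
      obtain ⟨i, hi, ⟨h, -⟩ | ⟨h, -⟩⟩ := exists_position_of_part_ne huv
      · exact hno u hu i (hK hi) (fun h => hK₀ (h ▸ hi)) h
      · exact hno v hv i (hK hi) (fun h => hK₀ (h ▸ hi)) h
    -- Here `e` lies in neither cut, so its positive spread is wasted and the two cuts together have
    -- fewer than `2D` elements.
    have := card_partCut_add_le G A l hIJ e
    rw [if_neg (hout I hI hI₀), if_neg (hout J hJ hJ₀)] at this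
    have h₁ := hopt _ (hcut I hI hIc)
    have h₂ := hopt _ (hcut J hJ hJc)
    omega
  rcases hcase with hlt | hall
  · obtain ⟨I, J, hI, hJ, hIc, hJc, hIJ, -, -⟩ := hhalves u₀
    have h₁ := hlt _ (hcut I hI hIc)
    have h₂ := hlt _ (hcut J hJ hJc)
    have h₃ := Finset.sum_le_sum (s := Finset.univ) fun e _ => partCut_add_le_spread G A l hIJ e
    rw [Finset.sum_add_distrib] at h₃
    simp only [Finset.sum_ite_mem, Finset.univ_inter, Finset.sum_const, smul_eq_mul, mul_one] at h₃
    omega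
  -- Applying `hedge` twice produces vertices in two different private regions, so positive spread
  -- means spread 2.
  · have htwo : ∀ e, 0 < spread A l (G.edge e) → 2 ≤ spread A l (G.edge e) := by
      intro e he
      obtain ⟨v, hv, i, -, -, hvi⟩ := hedge e he u₀
      obtain ⟨w, hw, j, -, hji, hwj⟩ := hedge e he i
      have := dist_le_spread (A := A) (l := l) hw hv
      simpa [hvi, hwj, Position.dist, hji] using this
    set W := Finset.univ.filter fun v => position A l v = Position.many with hW
    have hWpos : ∀ e ∈ G.cut W, 0 < spread A l (G.edge e) := by
      intro e he
      obtain ⟨⟨u, hu, huW⟩, v, hv, hvW⟩ := mem_cut.mp he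
      simp only [hW, Finset.mem_filter, Finset.mem_univ, true_and] at huW hvW
      exact (Position.dist_pos_iff.mpr fun h => hvW (h.symm.trans huW)).trans_le (dist_le_spread hu hv)
    have hWcard : (G.cut W).card ≤ (G.cut U).card := by
      have h₁ : ∑ _e ∈ G.cut W, 2 ≤ ∑ e ∈ G.cut W, spread A l (G.edge e) :=
        Finset.sum_le_sum fun e he => htwo e (hWpos e he)
      have h₂ : ∑ e ∈ G.cut W, spread A l (G.edge e) ≤ ∑ e, spread A l (G.edge e) :=
        Finset.sum_le_sum_of_subset (Finset.subset_univ _)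
      simp only [Finset.sum_const, smul_eq_mul] at h₁
      omega
    -- Hyperedges of `δ(W)` have spread at least 2 and the total is at most `2D`. So `W` is cheap,
    -- and being doubly covered it is good.
    have hWU : G.cut W = G.cut U := by
      refine hgood W (havoid W (fun v hv => by simpa [hW] using hmany v hv) (fun v hv => ?_) hWcard)
      exact exists_of_position_eq_many hnd (Finset.mem_filter.mp hv).2
    obtain ⟨hbad, -, -⟩ := hA u₀ hu₀
    -- Such an `e` exists because the bad set `A u₀` is no more expensive than `U` and has a
    -- different cut. But `e` meets `Uᶜ ⊆ A u₀`, and by `hedge` it meets a private region other than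
    -- that of `u₀`, so it crosses `A u₀` after all.
    obtain ⟨e, heU, heA⟩ : ∃ e ∈ G.cut U, e ∉ G.cut (A u₀) := by
      by_contra! h
      exact hbad.2.2.2 (hall _ (Finset.eq_of_subset_of_card_le h hbad.2.2.1).symm)
    obtain ⟨v, hv, i, hi, hi₀, hvi⟩ := hedge e (hWpos e (hWU ▸ heU)) u₀
    obtain ⟨-, hvA, honly⟩ := mem_of_position_eq_one hvi
    obtain ⟨-, w, hw, hwU⟩ := mem_cut.mp heU
    refine heA (mem_cut.mpr ⟨⟨w, hw, hbad.1 (Finset.mem_compl.mpr hwU)⟩, v, hv, fun h => ?_⟩)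
    exact hi₀ (honly u₀ ((hlS u₀).mpr hu₀) h).symm

/-- Apply `exists_small_source` to `U` and to `Uᶜ`, where only the complement itself counts as good.
For a competitor `X`, submodularity makes `X ∩ U` or `X ∪ U` no more expensive than `U`, hence equal
to `U`. Equality in one case transfers to the other, so `X = U`. -/
theorem exists_terminals_of_lt [Fintype V] [DecidableEq V] [Fintype E] (G : MultiHypergraph V E)
    {k : ℕ} (hk : 2 ≤ k) {U : Finset V} (hU : U.Nonempty) (hU' : Uᶜ.Nonempty)
    (hopt : ∀ F, G.IsKCutSet k F → (G.cut U).card < F.card) :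
    ∃ S T, IsTerminalPair k S T ∧ G.IsSourceMinimalCut S T U := by
  obtain ⟨S, hSne, hSU, hSc, hS⟩ := exists_small_source G hk hU hU' (fun F h => (hopt F h).le)
    (fun Q => Q = Uᶜ) rfl (fun Q h => by rw [h, cut_compl]) (Or.inl hopt)
  obtain ⟨T, hTne, hTU, hTc, hT⟩ := exists_small_source G hk hU' (by simpa using hU)
    (fun F h => by rw [cut_compl]; exact (hopt F h).le)
    (fun Q => Q = Uᶜᶜ) rfl (fun Q h => by rw [h, cut_compl])
    (Or.inl fun F h => by rw [cut_compl]; exact hopt F h)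
  simp only [compl_compl, cut_compl] at hT
  have hUT : Disjoint U T := Finset.disjoint_left.mpr fun v hv hvT =>
    Finset.mem_compl.mp (hTU hvT) hv
  have hterm : IsTerminalCut S T U := ⟨hSU, hUT⟩
  have hlow : ∀ X, S ⊆ X → X ⊆ U → (G.cut X).card ≤ (G.cut U).card → X = U := by
    intro X hSX hXU hX
    have := hS Xᶜ (Finset.compl_subset_compl.mpr hXU) ?_ (by rwa [cut_compl])
    · simpa using this
    · exact Finset.disjoint_left.mpr fun v hv hvS => Finset.mem_compl.mp hv (hSX hvS)
  have hkey : ∀ X, IsTerminalCut S T X → (G.cut X).card ≤ (G.cut U).card → X = U := by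
    intro X hX hc
    have hsub := G.card_cut_inter_add_card_cut_union_le X U
    have hi := hlow (X ∩ U) (Finset.subset_inter hX.1 hSU) Finset.inter_subset_right
    have hu := hT (X ∪ U) Finset.subset_union_right (Finset.disjoint_union_left.mpr ⟨hX.2, hUT⟩)
    have hu' : X ∪ U = U := by
      refine hu ?_
      by_contra! h
      have := hi (by omega)
      rw [this] at hsub
      omega
    have hi' : X ∩ U = U := by
      refine hi ?_
      rw [hu'] at hsub
      omega
    exact (Finset.union_eq_right.mp hu').antisymm (Finset.inter_eq_right.mp hi')
  refine ⟨S, T, ⟨hSne, hTne, hUT.mono_left hSU, hSc, hTc⟩, ⟨⟨hterm, fun X hX => ?_⟩, ?_⟩⟩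
  · by_contra! h
    rw [hkey X hX h.le] at h
    exact h.false
  · intro X hX _
    rw [hkey X hX.1 (hX.2 U hterm)]

/-- Now good means having the same cut as `U`, so uncrossing only shows that `δ(X ∩ U)` and `δ(X ∪
U)` equal `δ(U)`. That is enough: a hyperedge of `δ(U)` then meets `X ∩ U` and leaves `X ∪ U`, hence
crosses `X`. -/
theorem exists_terminals_of_cut_mem [Fintype V] [DecidableEq V] [Fintype E]
    (G : MultiHypergraph V E) {k : ℕ} (hk : 2 ≤ k) {U : Finset V} (hU : U.Nonempty)
    (hU' : Uᶜ.Nonempty) (hopt : ∀ F, G.IsKCutSet k F → (G.cut U).card ≤ F.card) :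
    ∃ S T X, IsTerminalPair k S T ∧ G.IsSourceMinimalCut S T X ∧ G.cut X = G.cut U := by
  obtain ⟨S, hSne, hSU, hSc, hS⟩ := exists_small_source G hk hU hU' hopt
    (fun Q => G.cut Q = G.cut U) (G.cut_compl U) (fun Q h => h) (Or.inr fun Q h => h)
  obtain ⟨T, hTne, hTU, hTc, hT⟩ := exists_small_source G hk hU' (by simpa using hU)
    (fun F h => by rw [cut_compl]; exact hopt F h)
    (fun Q => G.cut Q = G.cut U) (by rw [compl_compl]) (fun Q h => by rw [h, cut_compl])
    (Or.inr fun Q h => by rw [h, cut_compl])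
  simp only [compl_compl, cut_compl] at hT
  have hUT : Disjoint U T := Finset.disjoint_left.mpr fun v hv hvT =>
    Finset.mem_compl.mp (hTU hvT) hv
  have hterm : IsTerminalCut S T U := ⟨hSU, hUT⟩
  have hlow : ∀ X, S ⊆ X → X ⊆ U → (G.cut X).card ≤ (G.cut U).card → G.cut X = G.cut U := by
    intro X hSX hXU hX
    have := hS Xᶜ (Finset.compl_subset_compl.mpr hXU) ?_ (by rwa [cut_compl])
    · simpa [cut_compl] using this
    · exact Finset.disjoint_left.mpr fun v hv hvS => Finset.mem_compl.mp hv (hSX hvS)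
  obtain ⟨X, hX⟩ := G.exists_isSourceMinimalCut (hUT.mono_left hSU)
  refine ⟨S, T, X, ⟨hSne, hTne, hUT.mono_left hSU, hSc, hTc⟩, hX, ?_⟩
  have hsub := G.card_cut_inter_add_card_cut_union_le X U
  have hXc := hX.1.2 U hterm
  have hi := hlow (X ∩ U) (Finset.subset_inter hX.1.1.1 hSU) Finset.inter_subset_right
  have hu := hT (X ∪ U) Finset.subset_union_right
    (Finset.disjoint_union_left.mpr ⟨hX.1.1.2, hUT⟩)
  have hu' : G.cut (X ∪ U) = G.cut U := by
    refine hu ?_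
    by_contra! h
    have := hi (by omega)
    rw [this] at hsub
    omega
  have hi' : G.cut (X ∩ U) = G.cut U := by
    refine hi ?_
    rw [hu'] at hsub
    omega
  refine (Finset.eq_of_subset_of_card_le (fun e he => ?_) hXc).symm
  obtain ⟨⟨a, ha, haX⟩, -⟩ := mem_cut.mp (hi'.symm ▸ he)
  obtain ⟨-, b, hb, hbX⟩ := mem_cut.mp (hu'.symm ▸ he)
  exact mem_cut.mpr ⟨⟨a, ha, (Finset.mem_inter.mp haX).1⟩, b, hb,
    fun h => hbX (Finset.mem_union_left _ h)⟩

/-! ### Correctness of the algorithm -/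

/-- If some part has the whole of `F` as its cut, the first loop finds `F`. Otherwise every part has
a cut smaller than all `k`-cut-sets; the parts are then computed sources, and their cuts, being too
small for `k`-cut-sets, place them in `𝒞`. -/
theorem minKCutSets_subset_candidates [Fintype V] [Fintype E] (G : MultiHypergraph V E) {k : ℕ}
    (hk : 2 ≤ k) : G.minKCutSets k ⊆ G.candidates k := by
  classical
  intro F hF
  obtain ⟨P, hP, rfl⟩ := exists_isKPartition_of_mem_minKCutSets (by omega) hF
  have hne : ∀ i, (P i)ᶜ.Nonempty := by
    intro i
    have : Nontrivial (Fin k) := Fin.nontrivial_iff_two_le.mpr hk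
    obtain ⟨j, hj⟩ := exists_ne i
    obtain ⟨v, hv⟩ := hP.1 j
    exact ⟨v, Finset.mem_compl.mpr fun h => hj (hP.unique hv h)⟩
  have hle : ∀ i F', G.IsKCutSet k F' → (G.cut (P i)).card ≤ F'.card := fun i F' hF' =>
    (Finset.card_le_card (hP.cut_subset_crossing i)).trans (hF.2 F' hF')
  by_cases hex : ∃ i, G.cut (P i) = G.crossing P
  · obtain ⟨i, hi⟩ := hex
    obtain ⟨S, T, X, hST, hX, hXc⟩ :=
      G.exists_terminals_of_cut_mem hk (hP.1 i) (hne i) (hle i)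
    refine Or.inl ⟨X, ⟨S, T, hST, hX⟩, ?_, ?_⟩
    · rw [hXc, hi]
      exact hF.1
    · rw [hXc, hi]
  · push Not at hex
    have hlt : ∀ i F', G.IsKCutSet k F' → (G.cut (P i)).card < F'.card := fun i F' hF' =>
      (Finset.card_lt_card ((hP.cut_subset_crossing i).ssubset_of_ne (hex i))).trans_le
        (hF.2 F' hF')
    refine Or.inr ⟨P, hP, fun i => ⟨?_, fun h => (hlt i _ h).false⟩, rfl⟩
    exact G.exists_terminals_of_lt hk (hP.1 i) (hne i) (hlt i)

theorem enumCuts_eq_minKCutSets [Fintype V] [Fintype E] (G : MultiHypergraph V E) {k : ℕ}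
    (hk : 2 ≤ k) : G.enumCuts k = G.minKCutSets k := by
  classical
  have hsub := G.minKCutSets_subset_candidates hk
  ext F
  constructor
  · rintro ⟨-, hF, hmin⟩
    refine ⟨hF, fun F' hF' => ?_⟩
    obtain ⟨M, hM, hMmin⟩ := Finset.exists_min_image
      ((Finset.univ : Finset (Finset E)).filter fun F => G.IsKCutSet k F) Finset.card
      ⟨F, by simpa using hF⟩
    simp only [Finset.mem_filter, Finset.mem_univ, true_and] at hM hMmin
    exact (hmin M (hsub ⟨hM, hMmin⟩) hM).trans (hMmin F' hF')
  · exact fun hF => ⟨hsub hF, hF.1, fun F' _ hF' => hF.2 F' hF'⟩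

/-! ### The number of minimum cut-sets -/

/-- A tuple with repetitions lists any non-empty set of at most `2k - 1` vertices, and a pair of
terminal sets determines its source minimal cut. -/
theorem ncard_computedSources_le [Fintype V] [Fintype E] (G : MultiHypergraph V E) {k : ℕ}
    (hk : 0 < k) : (G.computedSources k).ncard ≤ Fintype.card V ^ (4 * k - 2) := by
  classical
  let src : (Fin (2 * k - 1) → V) × (Fin (2 * k - 1) → V) → Finset V := fun p =>
    if h : ∃ U, G.IsSourceMinimalCut (Finset.univ.image p.1) (Finset.univ.image p.2) U
    then h.choose else ∅
  have htuple : ∀ S : Finset V, S.Nonempty → S.card ≤ 2 * k - 1 →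
      ∃ f : Fin (2 * k - 1) → V, Finset.univ.image f = S := by
    intro S hS hc
    have : Nonempty S := hS.to_subtype
    obtain ⟨g⟩ := Function.Embedding.nonempty_of_card_le
      (α := S) (β := Fin (2 * k - 1)) (by simpa using hc)
    refine ⟨fun i => (Function.invFun g i : S), ?_⟩
    ext v
    simp only [Finset.mem_image, Finset.mem_univ, true_and]
    constructor
    · rintro ⟨i, rfl⟩
      exact Subtype.property _
    · exact fun hv => ⟨g ⟨v, hv⟩, by rw [Function.leftInverse_invFun g.injective]⟩
  have hsub : G.computedSources k ⊆ Set.range src := by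
    rintro U ⟨S, T, ⟨hS, hT, -, hSc, hTc⟩, hU⟩
    obtain ⟨f, rfl⟩ := htuple S hS hSc
    obtain ⟨g, rfl⟩ := htuple T hT hTc
    have h : ∃ U, G.IsSourceMinimalCut (Finset.univ.image f) (Finset.univ.image g) U := ⟨U, hU⟩
    exact ⟨(f, g), (dif_pos h).trans (h.choose_spec.unique hU)⟩
  refine (Set.ncard_le_ncard hsub (Set.finite_range _)).trans ?_
  rw [← Set.image_univ]
  refine (Set.ncard_image_le Set.finite_univ).trans (le_of_eq ?_)
  rw [Set.ncard_univ, Nat.card_eq_fintype_card, Fintype.card_prod, Fintype.card_fun,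
    Fintype.card_fin, ← pow_add]
  congr 1
  omega

/-- The factor 2 accounts for the two kinds of candidates: cuts of one source, and crossing sets of
`k`-tuples of sources. -/
theorem ncard_enumCuts_le [Fintype V] [Fintype E] (G : MultiHypergraph V E) {k : ℕ}
    (hk : 2 ≤ k) :
    (G.enumCuts k).ncard ≤ 2 * Fintype.card V ^ (2 * k * (2 * k - 1)) := by
  classical
  have hexp : (4 * k - 2) * k = 2 * k * (2 * k - 1) := by
    have : 4 * k - 2 = 2 * (2 * k - 1) := by omega
    rw [this]
    ring
  have hc := G.ncard_computedSources_le (k := k) (by omega)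
  have hfin : (G.computedSources k).Finite := Set.toFinite _
  have hsub : G.enumCuts k ⊆ G.cut '' G.computedSources k ∪
      G.crossing '' (Set.univ.pi fun _ : Fin k => G.computedSources k) := by
    rintro F ⟨⟨U, hU, -, rfl⟩ | ⟨P, -, hP, rfl⟩, -⟩
    · exact Or.inl ⟨U, hU, rfl⟩
    · exact Or.inr ⟨P, fun i _ => (hP i).1, rfl⟩
  have hpi : (Set.univ.pi fun _ : Fin k => G.computedSources k).ncard =
      (G.computedSources k).ncard ^ k := by
    rw [← Nat.card_coe_set_eq, Nat.card_congr (Equiv.Set.univPi _), Nat.card_pi]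
    simp only [Nat.card_coe_set_eq, Finset.prod_const, Finset.card_univ, Fintype.card_fin]
  have h₁ := Set.ncard_le_ncard hsub (Set.toFinite _)
  have h₂ := Set.ncard_union_le (G.cut '' G.computedSources k)
    (G.crossing '' (Set.univ.pi fun _ : Fin k => G.computedSources k))
  have h₃ := Set.ncard_image_le (f := G.cut) hfin
  have h₄ := Set.ncard_image_le (f := G.crossing (k := k))
    (Set.toFinite (Set.univ.pi fun _ : Fin k => G.computedSources k))
  rw [hpi] at h₄
  have h₅ := Nat.pow_le_pow_left hc k
  rw [← pow_mul, hexp] at h₅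
  have h₆ : (G.computedSources k).ncard ≤ (G.computedSources k).ncard ^ k :=
    Nat.le_self_pow (by omega) _
  omega

end MultiHypergraph

/-! ### Implementation on the random access machine -/

namespace Ram

/-! ### Reasoning about programs -/

infixr:60 " ;; " => Prog.seq

/-- Set register `x` to `v`. -/
def State.setReg (s : State) (x v : ℕ) : State := ⟨Function.update s.reg x v, s.mem⟩

/-- Set cell `i` of array `a` to `v`. -/
def State.setMem (s : State) (a i v : ℕ) : State :=
  ⟨s.reg, Function.update s.mem a (Function.update (s.mem a) i v)⟩

/-- Append `v` to the list in array `a`. -/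
def State.append (s : State) (a v : ℕ) : State :=
  (s.setMem a (s.mem a 0 + 1) v).setMem a 0 (s.mem a 0 + 1)

section State

variable (s : State) (x v a i b y j : ℕ)

@[simp] theorem State.setReg_reg : (s.setReg x v).reg y = if y = x then v else s.reg y := by
  simp [State.setReg, Function.update_apply]

@[simp] theorem State.setReg_mem : (s.setReg x v).mem = s.mem := rfl

@[simp] theorem State.setMem_reg : (s.setMem a i v).reg = s.reg := rfl

@[simp] theorem State.setMem_mem :
    (s.setMem a i v).mem b j = if b = a ∧ j = i then v else s.mem b j := by
  by_cases h : b = a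
  · subst h
    simp [State.setMem, Function.update_apply]
  · simp [State.setMem, h]

@[simp] theorem State.append_reg : (s.append a v).reg = s.reg := rfl

theorem State.append_mem : (s.append a v).mem b j =
    if b = a then if j = 0 then s.mem a 0 + 1 else if j = s.mem a 0 + 1 then v else s.mem a j
    else s.mem b j := by
  by_cases h : b = a <;> by_cases h' : j = 0 <;> simp [State.append, h, h']

@[simp] theorem State.append_mem_of_ne (h : b ≠ a) : (s.append a v).mem b j = s.mem b j := by
  simp [State.append_mem, h]

theorem State.readList_congr {s s' : State} {a : ℕ} (h : s'.mem a = s.mem a) :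
    s'.readList a = s.readList a := by
  simp [State.readList, h]

@[simp] theorem State.setReg_readList : (s.setReg x v).readList a = s.readList a := rfl

@[simp] theorem State.append_readList : (s.append a v).readList a = s.readList a ++ [v] := by
  simp only [State.readList, State.append_mem, if_true, List.range_succ, List.map_append,
    List.map_cons, List.map_nil]
  congr 1
  · refine List.map_congr_left fun i hi => ?_
    have : i ≠ s.mem a 0 := (List.mem_range.mp hi).ne
    simp [this]

@[simp] theorem State.readList_length : (s.readList a).length = s.mem a 0 := by
  simp [State.readList]

theorem State.readList_getElem? (h : i < s.mem a 0) : (s.readList a)[i]? = some (s.mem a (i + 1)) := by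
  simp [State.readList, h]

theorem State.readList_getD (h : i < s.mem a 0) : (s.readList a).getD i 0 = s.mem a (i + 1) := by
  simp [List.getD, State.readList_getElem? _ _ _ h]

theorem State.readList_eq_nil (h : s.mem a 0 = 0) : s.readList a = [] := by
  simp [State.readList, h]

variable (l : List ℕ)

@[simp] theorem State.writeList_reg : (s.writeList a l).reg = s.reg := rfl

theorem State.writeList_mem_zero : (s.writeList a l).mem a 0 = l.length := by
  simp [State.writeList]

theorem State.writeList_mem_succ (h : i < l.length) :
    (s.writeList a l).mem a (i + 1) = l.getD i 0 := by
  simp [State.writeList, h]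

@[simp] theorem State.writeList_mem_of_ne (h : b ≠ a) : (s.writeList a l).mem b = s.mem b := by
  simp [State.writeList, h]

@[simp] theorem State.writeList_readList : (s.writeList a l).readList a = l := by
  refine List.ext_getElem? fun i => ?_
  by_cases h : i < l.length
  · rw [State.readList_getElem? _ _ _ (by rwa [State.writeList_mem_zero]),
      State.writeList_mem_succ _ _ _ _ h]
    simp [h]
  · refine (List.getElem?_eq_none ?_).trans (List.getElem?_eq_none (by omega)).symm
    rw [State.readList_length, State.writeList_mem_zero]
    omega

@[simp] theorem State.ofInput_reg : (State.ofInput l).reg x = 0 := rfl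

@[simp] theorem State.ofInput_mem_succ : (State.ofInput l).mem 0 (i + 1) = l.getD i 0 := by
  by_cases h : i < l.length
  · exact State.writeList_mem_succ _ _ _ _ h
  · simp [State.ofInput, State.writeList, h, List.getD]

@[simp] theorem State.ofInput_mem_of_ne (h : b ≠ 0) : (State.ofInput l).mem b j = 0 := by
  simp [State.ofInput, h]

end State

/-- Does the program assign to register `x`? -/
def Prog.writesReg : Prog → ℕ → Bool
  | skip, _ => false
  | set x _, y => x == y
  | put _ _ _, _ => false
  | seq P Q, y => P.writesReg y || Q.writesReg y
  | ite _ P Q, y => P.writesReg y || Q.writesReg y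
  | loop _ P, y => P.writesReg y
  | call _ _ _, _ => false

/-- Does the program assign to array `a`? -/
def Prog.writesMem : Prog → ℕ → Bool
  | skip, _ => false
  | set _ _, _ => false
  | put a _ _, b => a == b
  | seq P Q, b => P.writesMem b || Q.writesMem b
  | ite _ P Q, b => P.writesMem b || Q.writesMem b
  | loop _ P, b => P.writesMem b
  | call _ dst _, b => dst == b

/-- The two states differ only in what `P` may write. -/
structure Frame (P : Prog) (s s' : State) : Prop where
  reg : ∀ x, P.writesReg x = false → s'.reg x = s.reg x
  mem : ∀ a, P.writesMem a = false → s'.mem a = s.mem a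

theorem Frame.readList {P : Prog} {s s' : State} (h : Frame P s s') (a : ℕ)
    (ha : P.writesMem a = false) : s'.readList a = s.readList a :=
  State.readList_congr (h.mem a ha)

theorem Frame.refl (P : Prog) (s : State) : Frame P s s := ⟨fun _ _ => rfl, fun _ _ => rfl⟩

theorem Frame.trans {P : Prog} {s s₁ s₂ : State} (h : Frame P s s₁) (h' : Frame P s₁ s₂) :
    Frame P s s₂ :=
  ⟨fun x hx => (h'.reg x hx).trans (h.reg x hx), fun a ha => (h'.mem a ha).trans (h.mem a ha)⟩

theorem Frame.weaken {P Q : Prog} {s s' : State} (h : Frame P s s')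
    (hr : ∀ x, Q.writesReg x = false → P.writesReg x = false)
    (hm : ∀ a, Q.writesMem a = false → P.writesMem a = false) : Frame Q s s' :=
  ⟨fun x hx => h.reg x (hr x hx), fun a ha => h.mem a (hm a ha)⟩

/-- This keeps invariants short: whatever a program does not syntactically write is preserved, and
`decide` or `rfl` checks that. -/
theorem Exec.frame {P : Prog} {s s' : State} {t : ℕ} (h : Exec P s t s') : Frame P s s' := by
  induction h with
  | skip s => exact Frame.refl _ _
  | set s x e =>
    refine ⟨fun y hy => ?_, fun _ _ => rfl⟩
    have : y ≠ x := by
      rintro rfl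
      simp [Prog.writesReg] at hy
    simp [this]
  | put s a i e =>
    refine ⟨fun _ _ => rfl, fun b hb => ?_⟩
    have : b ≠ a := by
      rintro rfl
      simp [Prog.writesMem] at hb
    simp [this]
  | seq _ _ ih₁ ih₂ =>
    exact (ih₁.weaken (by simp +contextual [Prog.writesReg])
      (by simp +contextual [Prog.writesMem])).trans
      (ih₂.weaken (by simp +contextual [Prog.writesReg]) (by simp +contextual [Prog.writesMem]))
  | ite_true _ _ ih =>
    exact ih.weaken (by simp +contextual [Prog.writesReg]) (by simp +contextual [Prog.writesMem])
  | ite_false _ _ ih =>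
    exact ih.weaken (by simp +contextual [Prog.writesReg]) (by simp +contextual [Prog.writesMem])
  | loop_true _ _ _ ih₁ ih₂ =>
    exact (ih₁.weaken (by simp [Prog.writesReg]) (by simp [Prog.writesMem])).trans ih₂
  | loop_false _ => exact Frame.refl _ _
  | call _ _ =>
    rename_i dst _ _ _ _ _ _
    refine ⟨fun _ _ => rfl, fun b hb => ?_⟩
    have : b ≠ dst := by
      rintro rfl
      simp [Prog.writesMem] at hb
    simp [this]

/-- Started in state `s`, the program halts within `B` steps in a state satisfying `Post`. -/
def Runs (P : Prog) (s : State) (B : ℕ) (Post : State → Prop) : Prop :=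
  ∃ t s', Exec P s t s' ∧ t ≤ B ∧ Post s'

theorem Runs.mono {P : Prog} {s : State} {B B' : ℕ} {Post : State → Prop} (h : Runs P s B Post)
    (hB : B ≤ B') : Runs P s B' Post := by
  obtain ⟨t, s', he, ht, hp⟩ := h
  exact ⟨t, s', he, ht.trans hB, hp⟩

theorem Runs.imp {P : Prog} {s : State} {B : ℕ} {Post Post' : State → Prop} (h : Runs P s B Post)
    (hP : ∀ s', Frame P s s' → Post s' → Post' s') : Runs P s B Post' := by
  obtain ⟨t, s', he, ht, hp⟩ := h
  exact ⟨t, s', he, ht, hP s' he.frame hp⟩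

theorem Runs.seq {P Q : Prog} {s : State} {B₁ B₂ : ℕ} {Mid Post : State → Prop}
    (h₁ : Runs P s B₁ Mid) (h₂ : ∀ s', Frame P s s' → Mid s' → Runs Q s' B₂ Post) :
    Runs (P ;; Q) s (B₁ + B₂) Post := by
  obtain ⟨t₁, s₁, he₁, ht₁, hp₁⟩ := h₁
  obtain ⟨t₂, s₂, he₂, ht₂, hp₂⟩ := h₂ s₁ he₁.frame hp₁
  exact ⟨_, s₂, he₁.seq he₂, Nat.add_le_add ht₁ ht₂, hp₂⟩

theorem Runs.ite {b : Expr} {P Q : Prog} {s : State} {B : ℕ} {Post : State → Prop}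
    (h₁ : b.eval s ≠ 0 → Runs P s B Post) (h₂ : b.eval s = 0 → Runs Q s B Post) :
    Runs (Prog.ite b P Q) s (b.cost + 1 + B) Post := by
  by_cases hb : b.eval s = 0
  · obtain ⟨t, s', he, ht, hp⟩ := h₂ hb
    exact ⟨_, s', Exec.ite_false hb he, Nat.add_le_add_left ht _, hp⟩
  · obtain ⟨t, s', he, ht, hp⟩ := h₁ hb
    exact ⟨_, s', Exec.ite_true hb he, Nat.add_le_add_left ht _, hp⟩

/-- The subroutine's output is known only through `Spec`, which also has to bound its length because
copying it is charged. -/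
theorem Runs.call {Q : Prog} {dst src : ℕ} {s : State} {B L : ℕ} {Post : State → Prop}
    {Spec : List ℕ → Prop} {l : List ℕ} (hl : s.readList src = l)
    (h : Runs Q (State.ofInput l) B fun s₁ => Spec s₁.output)
    (hL : ∀ o, Spec o → o.length ≤ L) (hp : ∀ o, Spec o → Post (s.writeList dst o)) :
    Runs (Prog.call Q dst src) s (B + l.length + L + 1) Post := by
  subst hl
  obtain ⟨t, s₁, he, ht, hs⟩ := h
  refine ⟨_, _, Exec.call he, ?_, hp _ hs⟩
  have := hL _ hs
  omega

theorem Runs.exists_runsTo {P : Prog} {w : List ℕ} {B : ℕ} {Spec : List ℕ → Prop}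
    (h : Runs P (State.ofInput w) B fun s => Spec s.output) :
    ∃ t out, t ≤ B ∧ P.RunsTo w t out ∧ Spec out := by
  obtain ⟨t, s, he, ht, hs⟩ := h
  exact ⟨t, _, ht, ⟨s, he, rfl⟩, hs⟩

theorem Prog.RunsTo.runs {P : Prog} {w : List ℕ} {t B : ℕ} {out : List ℕ} (h : P.RunsTo w t out)
    (ht : t ≤ B) : Runs P (State.ofInput w) B fun s => s.output = out := by
  obtain ⟨s, he, hs⟩ := h
  exact ⟨t, s, he, ht, hs⟩

/-- Is the program free of loops and calls? -/
def Prog.simple : Prog → Bool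
  | skip => true
  | set _ _ => true
  | put _ _ _ => true
  | seq P Q => P.simple && Q.simple
  | ite _ P Q => P.simple && Q.simple
  | loop _ _ => false
  | call _ _ _ => false

/-- The final state of a program without loops and calls. -/
def Prog.eval : Prog → State → State
  | skip, s => s
  | set x e, s => s.setReg x (e.eval s)
  | put a i e, s => s.setMem a (i.eval s) (e.eval s)
  | seq P Q, s => Q.eval (P.eval s)
  | ite b P Q, s => if b.eval s = 0 then Q.eval s else P.eval s
  | loop _ _, s => s
  | call _ _ _, s => s

/-- A bound on the running time of a program without loops and calls. -/
def Prog.cost : Prog → ℕ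
  | skip => 1
  | set _ e => e.cost + 1
  | put _ i e => i.cost + e.cost + 1
  | seq P Q => P.cost + Q.cost
  | ite b P Q => b.cost + 1 + (P.cost + Q.cost)
  | loop _ _ => 0
  | call _ _ _ => 0

/-- `Prog.cost` adds both branches of a conditional, which gives a bound independent of the state.
-/
theorem Runs.of_simple {P : Prog} {s : State} {Post : State → Prop} (h : P.simple = true)
    (hp : Post (P.eval s)) : Runs P s P.cost Post := by
  suffices ∃ t, Exec P s t (P.eval s) ∧ t ≤ P.cost by
    obtain ⟨t, he, ht⟩ := this
    exact ⟨t, _, he, ht, hp⟩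
  clear hp
  induction P generalizing s with
  | skip => exact ⟨_, Exec.skip s, le_rfl⟩
  | set x e => exact ⟨_, Exec.set s x e, le_rfl⟩
  | put a i e => exact ⟨_, Exec.put s a i e, le_rfl⟩
  | seq P Q ihP ihQ =>
    simp only [Prog.simple, Bool.and_eq_true] at h
    obtain ⟨t₁, h₁, ht₁⟩ := ihP (s := s) h.1
    obtain ⟨t₂, h₂, ht₂⟩ := ihQ (s := P.eval s) h.2
    exact ⟨_, h₁.seq h₂, Nat.add_le_add ht₁ ht₂⟩
  | ite b P Q ihP ihQ =>
    simp only [Prog.simple, Bool.and_eq_true] at h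
    obtain ⟨t₁, h₁, ht₁⟩ := ihP (s := s) h.1
    obtain ⟨t₂, h₂, ht₂⟩ := ihQ (s := s) h.2
    by_cases hb : b.eval s = 0
    · simp only [Prog.eval, hb, if_true, Prog.cost]
      exact ⟨_, Exec.ite_false hb h₂, by omega⟩
    · simp only [Prog.eval, hb, if_false, Prog.cost]
      exact ⟨_, Exec.ite_true hb h₁, by omega⟩
  | loop => simp [Prog.simple] at h
  | call => simp [Prog.simple] at h

/-- Append the value of `e` to the list in array `a`. -/
def Prog.push (a : ℕ) (e : Expr) : Prog :=
  Prog.put a (Expr.add (Expr.get a (Expr.lit 0)) (Expr.lit 1)) e ;;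
    Prog.put a (Expr.lit 0) (Expr.add (Expr.get a (Expr.lit 0)) (Expr.lit 1))

theorem Prog.push_eval (a : ℕ) (e : Expr) (s : State) :
    (Prog.push a e).eval s = s.append a (e.eval s) := by
  simp [Prog.push, Prog.eval, State.append, Expr.eval]

theorem Prog.push_cost (a : ℕ) (e : Expr) : (Prog.push a e).cost = e.cost + 11 := by
  simp only [Prog.push, Prog.cost, Expr.cost]
  omega

/-- Run `body` for the values `0, 1, …, e - 1` of register `x`. -/
def Prog.forLoop (x : ℕ) (e : Expr) (body : Prog) : Prog :=
  Prog.set x (Expr.lit 0) ;;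
    Prog.loop (Expr.lt (Expr.reg x) e)
      (body ;; Prog.set x (Expr.add (Expr.reg x) (Expr.lit 1)))

/-- The bound `e` is evaluated anew in every round, so its value must remain `N`. The frame relative
to the initial state is available in every round, so the invariant need not mention unchanged data.
-/
theorem Runs.forLoop {x : ℕ} {e : Expr} {body : Prog} {s : State} {B : ℕ} (N : ℕ)
    (I : ℕ → State → Prop) (hx : body.writesReg x = false) (h0 : I 0 (s.setReg x 0))
    (he : ∀ i s', Frame (Prog.forLoop x e body) s s' → I i s' → e.eval s' = N)
    (hs : ∀ i s', i < N → s'.reg x = i → Frame (Prog.forLoop x e body) s s' → I i s' →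
      Runs body s' B fun s'' => I (i + 1) (s''.setReg x (i + 1))) :
    Runs (Prog.forLoop x e body) s (N * (B + e.cost + 7) + e.cost + 5) (I N) := by
  have hloop : ∀ d i s', i + d = N → s'.reg x = i → Frame (Prog.forLoop x e body) s s' → I i s' →
      Runs (Prog.loop (Expr.lt (Expr.reg x) e)
        (body ;; Prog.set x (Expr.add (Expr.reg x) (Expr.lit 1)))) s'
        (d * (B + e.cost + 7) + e.cost + 3) (I N) := by
    intro d
    induction d with
    | zero =>
      intro i s' hi hxi hf hI
      have hb : (Expr.lt (Expr.reg x) e).eval s' = 0 := by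
        simp only [Expr.eval, he i s' hf hI, hxi]
        rw [if_neg (by omega)]
      refine ⟨_, s', Exec.loop_false hb, ?_, ?_⟩
      · simp only [Expr.cost]
        omega
      · rwa [show N = i by omega]
    | succ d ih =>
      intro i s' hi hxi hf hI
      have hb : (Expr.lt (Expr.reg x) e).eval s' ≠ 0 := by
        simp only [Expr.eval, he i s' hf hI, hxi]
        rw [if_pos (by omega)]
        exact one_ne_zero
      obtain ⟨t₁, s₁, he₁, ht₁, hI₁⟩ := hs i s' (by omega) hxi hf hI
      have hx₁ : s₁.reg x = i := (he₁.frame.reg x hx).trans hxi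
      have he₂ := Exec.set s₁ x (Expr.add (Expr.reg x) (Expr.lit 1))
      have hs₁ : (⟨Function.update s₁.reg x ((Expr.add (Expr.reg x) (Expr.lit 1)).eval s₁), s₁.mem⟩ :
          State) = s₁.setReg x (i + 1) := by
        simp [Expr.eval, State.setReg, hx₁]
      rw [hs₁] at he₂
      obtain ⟨t₂, s₂, he₃, ht₂, hI₂⟩ := ih (i + 1) (s₁.setReg x (i + 1)) (by omega) (by simp)
        (hf.trans ((he₁.seq he₂).frame.weaken (by simp +contextual [Prog.forLoop, Prog.writesReg])
          (by simp +contextual [Prog.forLoop, Prog.writesMem]))) hI₁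
      refine ⟨_, s₂, Exec.loop_true hb (he₁.seq he₂) he₃, ?_, hI₂⟩
      simp only [Expr.cost, add_mul]
      omega
  have h₁ := Exec.set s x (Expr.lit 0)
  obtain ⟨t, s', he', ht, hI⟩ := hloop N 0 (s.setReg x 0) (by omega) (by simp)
    (h₁.frame.weaken (by simp +contextual [Prog.forLoop, Prog.writesReg])
      (by simp +contextual [Prog.forLoop, Prog.writesMem])) h0
  refine ⟨_, s', h₁.seq he', ?_, hI⟩
  simp only [Expr.cost]
  omega

end Ram

namespace Ram

open Ram.Expr Ram.Prog

/-! ### Enumerating all sums of tuples of rows -/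

/-- The number of nodes of depth less than `j` in the infinite `M`-ary tree. -/
def treeSize (M : ℕ) : ℕ → ℕ
  | 0 => 0
  | j + 1 => 1 + treeSize M j * M

theorem one_le_treeSize_succ (M j : ℕ) : 1 ≤ treeSize M (j + 1) := by
  simp [treeSize]

theorem le_treeSize {M : ℕ} (hM : 1 ≤ M) (j : ℕ) : j ≤ treeSize M j := by
  induction j with
  | zero => simp
  | succ j ih =>
    have := Nat.mul_le_mul_left (treeSize M j) hM
    simp only [treeSize]
    omega

/-- There are `j + 1` levels with at most `M ^ j` nodes each. -/
theorem treeSize_succ_le {M : ℕ} (hM : 1 ≤ M) (j : ℕ) : treeSize M (j + 1) ≤ (j + 1) * M ^ j := by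
  induction j with
  | zero => simp [treeSize]
  | succ j ih =>
    rw [treeSize]
    have h₁ := Nat.mul_le_mul_right M ih
    have h₂ : 1 ≤ M ^ (j + 1) := Nat.one_le_pow _ _ hM
    calc 1 + treeSize M (j + 1) * M ≤ M ^ (j + 1) + (j + 1) * M ^ j * M := Nat.add_le_add h₂ h₁
      _ = (j + 1 + 1) * M ^ (j + 1) := by ring

/-- Division with remainder: a cell of a row-major table determines its row and column. -/
theorem mul_add_inj {n a b v w : ℕ} (hv : v < n) (hw : w < n) (h : a * n + v = b * n + w) :
    a = b ∧ v = w := by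
  have hab : a = b := by
    have h₁ : (a * n + v) / n = a := by
      rw [add_comm, Nat.add_mul_div_right _ _ (by omega), Nat.div_eq_of_lt hv, zero_add]
    have h₂ : (b * n + w) / n = b := by
      rw [add_comm, Nat.add_mul_div_right _ _ (by omega), Nat.div_eq_of_lt hw, zero_add]
    rw [← h₁, h, h₂]
  subst hab
  exact ⟨rfl, by omega⟩

theorem mul_add_lt {n a b v : ℕ} (hv : v < n) (h : a < b) : a * n + v < b * n := by
  have := Nat.mul_le_mul_right n (Nat.succ_le_of_lt h)
  rw [Nat.succ_mul] at this
  omega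

/-- The input consists of `n`, `M`, `r` and `M` rows of length `n`. The output consists of the number
of nodes of depth at most `r` in an `M`-ary tree and a row of length `n` for each of these nodes: zero
at the root, and twice the row at the parent plus the `i`-th input row at an `i`-th child. -/
def rowSums : Prog :=
  (set 0 (get 0 (lit 1)) ;; set 1 (get 0 (lit 2)) ;; set 2 (get 0 (lit 3)) ;; set 7 (lit 1)) ;;
  forLoop 3 (reg 2)
    ((set 6 (reg 7) ;; set 7 (lit 1)) ;; forLoop 4 (reg 1) (set 7 (add (reg 7) (reg 6)))) ;;
  push 1 (reg 7) ;;
  forLoop 5 (reg 0) (push 1 (lit 0)) ;;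
  (set 8 (lit 2)) ;;
  forLoop 3 (reg 6)
    (set 9 (lit 4) ;;
    forLoop 4 (reg 1)
      (forLoop 5 (reg 0)
        (push 1 (add (add (get 1 (add (reg 8) (reg 5))) (get 1 (add (reg 8) (reg 5))))
          (get 0 (reg 9))) ;;
        set 9 (add (reg 9) (lit 1)))) ;;
    set 8 (add (reg 8) (reg 0)))

/-- The list consists of a number `R` and of `R = treeSize M (r + 1)` rows, as computed by `rowSums`
for the input rows `X`. -/
structure IsRowSums (n M r : ℕ) (X : ℕ → ℕ → ℕ) (o : List ℕ) : Prop where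
  length : o.length = 1 + treeSize M (r + 1) * n
  head : o.getD 0 0 = treeSize M (r + 1)
  root : ∀ v < n, o.getD (1 + v) 0 = 0
  child : ∀ a < treeSize M r, ∀ i < M, ∀ v < n, o.getD (1 + ((1 + a * M + i) * n + v)) 0 =
    o.getD (1 + (a * n + v)) 0 + o.getD (1 + (a * n + v)) 0 + X i v

/-- The cells from `1` on of an array hold the number of rows and the first `c` entries of the rows
computed by `rowSums`. -/
structure RowSumsPrefix (n M r : ℕ) (X : ℕ → ℕ → ℕ) (c : ℕ) (f : ℕ → ℕ) : Prop where
  zero : f 0 = 1 + c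
  one : f 1 = treeSize M (r + 1)
  root : ∀ v < n, f (2 + v) = 0
  child : ∀ a < treeSize M r, ∀ i < M, ∀ v < n, (1 + a * M + i) * n + v < c →
    f (2 + ((1 + a * M + i) * n + v)) = f (2 + (a * n + v)) + f (2 + (a * n + v)) + X i v

/-- The tree is listed level by level: child `i` of node `a` has number `1 + a * M + i > a`, so the
parent's row is already final, and appending changes no earlier entry. -/
theorem RowSumsPrefix.append {n M r a i v : ℕ} {X : ℕ → ℕ → ℕ} {s : State} (hM : 1 ≤ M)
    (hi : i < M) (hv : v < n) (h : RowSumsPrefix n M r X ((1 + a * M + i) * n + v) (s.mem 1)) :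
    RowSumsPrefix n M r X ((1 + a * M + i) * n + (v + 1))
      ((s.append 1 (s.mem 1 (2 + (a * n + v)) + s.mem 1 (2 + (a * n + v)) + X i v)).mem 1) := by
  have hself : ∀ b, b ≤ b * M := fun b => Nat.le_mul_of_pos_right b hM
  have hlt : ∀ a' v', v' < n → a' ≤ a → a' * n + v' < (1 + a * M + i) * n + v := by
    intro a' v' hv' ha'
    have h₁ : a' * n + v' < (1 + a * M + i) * n := mul_add_lt hv' (by have := hself a; omega)
    omega
  have hne : ∀ q, q < (1 + a * M + i) * n + v →
      (s.append 1 (s.mem 1 (2 + (a * n + v)) + s.mem 1 (2 + (a * n + v)) + X i v)).mem 1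
        (2 + q) = s.mem 1 (2 + q) := by
    intro q hq
    rw [State.append_mem, h.zero, if_pos rfl, if_neg (by omega), if_neg (by omega)]
  refine ⟨?_, ?_, fun v' hv' => ?_, fun a' ha' i' hi' v' hv' hlt' => ?_⟩
  · rw [State.append_mem, h.zero, if_pos rfl, if_pos rfl]
    omega
  · have := hlt 0 0 (by omega) (by omega)
    rw [State.append_mem, h.zero, if_pos rfl, if_neg (by omega), if_neg (by omega), h.one]
  · have h₁ := hlt 0 v' hv' (by omega)
    rw [hne _ (by omega), h.root v' hv']
  · have hpar : a' * n + v' < (1 + a' * M + i') * n :=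
      mul_add_lt hv' (by have := hself a'; omega)
    rw [hne (a' * n + v') (by omega)]
    by_cases hc : (1 + a' * M + i') * n + v' < (1 + a * M + i) * n + v
    · rw [hne _ hc]
      exact h.child a' ha' i' hi' v' hv' hc
    · obtain ⟨he, rfl⟩ := mul_add_inj hv' hv
        (show (1 + a' * M + i') * n + v' = (1 + a * M + i) * n + v by omega)
      obtain ⟨rfl, rfl⟩ := mul_add_inj hi' hi (show a' * M + i' = a * M + i by omega)
      rw [State.append_mem, h.zero, if_pos rfl, if_neg (by omega), if_pos (by omega)]

theorem RowSumsPrefix.isRowSums {n M r : ℕ} {X : ℕ → ℕ → ℕ} {s : State} (hM : 1 ≤ M)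
    (h : RowSumsPrefix n M r X ((1 + treeSize M r * M) * n) (s.mem 1)) :
    IsRowSums n M r X s.output := by
  have hlen : s.output.length = 1 + treeSize M (r + 1) * n := by
    rw [State.output, State.readList_length, h.zero, treeSize]
  have hget : ∀ j, j < 1 + treeSize M (r + 1) * n → s.output.getD j 0 = s.mem 1 (j + 1) :=
    fun j hj => State.readList_getD _ _ _ (by rw [h.zero]; exact hj)
  refine ⟨hlen, ?_, fun v hv => ?_, fun a ha i hi v hv => ?_⟩
  · rw [hget _ (by omega), h.one]
  · have := mul_add_lt hv (show 0 < treeSize M (r + 1) by simp [treeSize])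
    rw [hget _ (by omega), ← h.root v hv]
    congr 1
    omega
  · have h₁ : a * M + i < treeSize M r * M := mul_add_lt hi ha
    have h₂ : (1 + a * M + i) * n + v < treeSize M (r + 1) * n :=
      mul_add_lt hv (by rw [treeSize]; omega)
    have h₃ : a * n + v < treeSize M (r + 1) * n := by
      have := Nat.le_mul_of_pos_right a hM
      exact mul_add_lt hv (by rw [treeSize]; omega)
    rw [hget _ (by omega), hget _ (by omega)]
    have := h.child a ha i hi v hv (by rw [treeSize] at h₂; omega)
    rw [show 1 + ((1 + a * M + i) * n + v) + 1 = 2 + ((1 + a * M + i) * n + v) by omega, this,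
      show 1 + (a * n + v) + 1 = 2 + (a * n + v) by omega]

set_option maxHeartbeats 1000000 in
theorem rowSums_runs {w : List ℕ} {n M r : ℕ} {X : ℕ → ℕ → ℕ} (hM : 1 ≤ M) (hr : 1 ≤ r)
    (hwn : w.getD 0 0 = n) (hwM : w.getD 1 0 = M) (hwr : w.getD 2 0 = r)
    (hX : ∀ i < M, ∀ v < n, w.getD (3 + (i * n + v)) 0 = X i v) :
    Runs rowSums (State.ofInput w) (1000 * (treeSize M (r + 1) * (n + 1))) fun s =>
      IsRowSums n M r X s.output := by
  set s₀ := State.ofInput w with hs₀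
  have hX₀ : ∀ i < M, ∀ v < n, s₀.mem 0 (4 + (i * n + v)) = X i v := fun i hi v hv => by
    rw [show 4 + (i * n + v) = 3 + (i * n + v) + 1 by omega, hs₀, State.ofInput_mem_succ, hX i hi v hv]
  have hn₀ : s₀.mem 0 1 = n := by simp [hs₀, ← hwn]
  have hM₀ : s₀.mem 0 2 = M := by simp [hs₀, ← hwM]
  have hr₀ : s₀.mem 0 3 = r := by simp [hs₀, ← hwr]
  have h₁ : ∀ j, s₀.mem 1 j = 0 := fun j => by simp [hs₀]
  clear_value s₀
  apply Runs.mono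
  · unfold rowSums
    apply Runs.seq (Mid := fun s => s.reg 0 = n ∧ s.reg 1 = M ∧ s.reg 2 = r ∧ s.reg 7 = 1)
    · apply Runs.of_simple (by decide)
      simp [Prog.eval, Expr.eval, hn₀, hM₀, hr₀]
    rintro s₁ f₁ ⟨hn₁, hM₁, hr₁, h7₁⟩
    -- Register 6 receives the number of parents and register 7 the number of all rows. The product
    -- in `treeSize` is formed by repeated addition, as the machine cannot multiply.
    apply Runs.seq (Mid := fun s => s.reg 6 = treeSize M r ∧ s.reg 7 = treeSize M (r + 1))
    · apply Runs.imp
      · apply Runs.forLoop r (fun j s => s.reg 7 = treeSize M (j + 1) ∧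
          (1 ≤ j → s.reg 6 = treeSize M j)) (by decide)
        · simp [h7₁, treeSize]
        · intro j s f _
          simp [Expr.eval, f.reg 2 (by decide), hr₁]
        · rintro j s hj hsj f ⟨h7, -⟩
          apply Runs.seq (Mid := fun s => s.reg 6 = treeSize M (j + 1) ∧ s.reg 7 = 1)
          · apply Runs.of_simple (by decide)
            simp [Prog.eval, Expr.eval, h7]
          rintro s' f' ⟨h6', h7'⟩
          apply Runs.imp
          · apply Runs.forLoop M (fun i s => s.reg 7 = 1 + i * treeSize M (j + 1)) (by decide)
            · simp [h7']
            · intro i t g _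
              simp [Expr.eval, g.reg 1 (by decide), f'.reg 1 (by decide), f.reg 1 (by decide), hM₁]
            · intro i t hi hti g h
              apply Runs.of_simple (by decide)
              simp [Prog.eval, Expr.eval, h, g.reg 6 (by decide), h6']
              ring
          · intro t g h
            simp only [State.setReg_reg]
            refine ⟨?_, fun _ => ?_⟩
            · simp [h, treeSize, mul_comm]
            · simp [g.reg 6 (by decide), h6']
      · rintro s f ⟨h7, h6⟩
        exact ⟨h6 hr, h7⟩
    rintro s₂ f₂ ⟨h6₂, h7₂⟩
    apply Runs.seq (Mid := fun s => s = s₂.append 1 (s₂.reg 7))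
    · apply Runs.of_simple (by decide)
      simp [Prog.push_eval, Expr.eval]
    rintro s₃ f₃ hs₃
    have h1₃ : s₃.mem 1 0 = 1 ∧ s₃.mem 1 1 = treeSize M (r + 1) := by
      simp [hs₃, State.append_mem, f₂.mem 1 (by decide), f₁.mem 1 (by decide), h₁, h7₂]
    apply Runs.seq (Mid := fun s => s.mem 1 0 = 1 + n ∧ s.mem 1 1 = treeSize M (r + 1) ∧
      ∀ v < n, s.mem 1 (2 + v) = 0)
    · apply Runs.forLoop n (fun j s => s.mem 1 0 = 1 + j ∧ s.mem 1 1 = treeSize M (r + 1) ∧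
        ∀ v < j, s.mem 1 (2 + v) = 0) (by decide)
      · simpa using h1₃
      · intro j s f _
        simp [Expr.eval, f.reg 0 (by decide), hs₃, f₂.reg 0 (by decide), hn₁]
      · rintro j s hj hsj f ⟨h, h', h''⟩
        apply Runs.of_simple (by decide)
        simp only [Prog.push_eval, Expr.eval, State.setReg_mem, State.append_mem, h]
        refine ⟨by simp; omega, by simp [h'], fun v hv => ?_⟩
        have := h'' v
        simp
        omega
    rintro s₄ f₄ ⟨h0₄, h1₄, hz₄⟩
    apply Runs.seq (Mid := fun s => s = s₄.setReg 8 2)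
    · apply Runs.of_simple (by decide)
      simp [Prog.eval, Expr.eval]
    rintro s₅ f₅ hs₅
    have hmem₅ : s₅.mem = s₄.mem := by simp [hs₅]
    have hreg₅ : s₅.reg 0 = n ∧ s₅.reg 1 = M ∧ s₅.reg 6 = treeSize M r := by
      simp [hs₅, f₄.reg 0 (by decide), f₄.reg 1 (by decide), f₄.reg 6 (by decide), hs₃,
        f₂.reg 0 (by decide), f₂.reg 1 (by decide), hn₁, hM₁, h6₂]
    have hmem0 : s₅.mem 0 = s₀.mem 0 := by
      rw [f₅.mem 0 (by decide), f₄.mem 0 (by decide), f₃.mem 0 (by decide), f₂.mem 0 (by decide),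
        f₁.mem 0 (by decide)]
    apply Runs.imp
    -- Register 8 points to the parent's row, and register 9 runs through the input rows. The
    -- offsets 2 and 4 skip the length cell and the header.
    · apply Runs.forLoop (treeSize M r) (fun a s => s.reg 8 = 2 + a * n ∧
        RowSumsPrefix n M r X ((1 + a * M) * n) (s.mem 1)) (by decide)
      · simp only [State.setReg_reg, State.setReg_mem, hmem₅]
        refine ⟨by simp [hs₅], by simpa using h0₄, h1₄, hz₄, fun a _ i _ v _ h => ?_⟩
        have := Nat.le_mul_of_pos_left n (show 0 < 1 + a * M + i by omega)
        rw [zero_mul, add_zero, one_mul] at h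
        omega
      · intro j s f _
        rw [Expr.eval, f.reg 6 (by decide), hreg₅.2.2]
      · rintro a s ha hsa f ⟨h8, hP⟩
        have hs0 : s.mem 0 = s₀.mem 0 := by rw [f.mem 0 (by decide), hmem0]
        have hsr : s.reg 0 = n ∧ s.reg 1 = M := by
          rw [f.reg 0 (by decide), f.reg 1 (by decide)]
          exact ⟨hreg₅.1, hreg₅.2.1⟩
        apply Runs.seq (Mid := fun s' => s' = s.setReg 9 4)
        · apply Runs.of_simple (by decide)
          simp [Prog.eval, Expr.eval]
        rintro t g ht
        apply Runs.seq (Mid := fun s' => RowSumsPrefix n M r X ((1 + a * M + M) * n) (s'.mem 1))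
        · apply Runs.imp
          · apply Runs.forLoop M (fun i s => s.reg 9 = 4 + i * n ∧
              RowSumsPrefix n M r X ((1 + a * M + i) * n) (s.mem 1)) (by decide)
            · simp only [State.setReg_reg, State.setReg_mem, ht]
              exact ⟨by simp, hP⟩
            · intro i s' f' _
              rw [Expr.eval, f'.reg 1 (by decide), g.reg 1 (by decide), hsr.2]
            · rintro i t₁ hi hti g₁ ⟨h9₁, hP₁⟩
              apply Runs.imp
              · apply Runs.forLoop n (fun v s => s.reg 9 = 4 + (i * n + v) ∧
                  RowSumsPrefix n M r X ((1 + a * M + i) * n + v) (s.mem 1)) (by decide)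
                · simp only [State.setReg_reg, State.setReg_mem]
                  exact ⟨by simp [h9₁], hP₁⟩
                · intro v s' f' _
                  rw [Expr.eval, f'.reg 0 (by decide), g₁.reg 0 (by decide), g.reg 0 (by decide),
                    hsr.1]
                · rintro v t₂ hv htv g₂ ⟨h9₂, hP₂⟩
                  have h8₂ : t₂.reg 8 = 2 + a * n := by
                    rw [g₂.reg 8 (by decide), g₁.reg 8 (by decide), g.reg 8 (by decide), h8]
                  have hm₂ : t₂.mem 0 = s₀.mem 0 := by
                    rw [g₂.mem 0 (by decide), g₁.mem 0 (by decide), g.mem 0 (by decide), hs0]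
                  apply Runs.of_simple (by decide)
                  simp only [Prog.push_eval, Prog.eval, Expr.eval, State.setReg_mem,
                    State.setReg_reg, State.append_reg, h9₂, h8₂, htv, hm₂, hX₀ i hi v hv,
                    add_assoc 2]
                  exact ⟨by simp [add_assoc], hP₂.append hM hi hv⟩
              · rintro t₂ g₂ ⟨h9₂, hP₂⟩
                rw [State.setReg_reg, if_neg (by decide), h9₂, State.setReg_mem, add_one_mul,
                  ← add_assoc (1 + a * M), add_one_mul]
                exact ⟨rfl, hP₂⟩
          · exact fun t₁ g₁ h => h.2
        rintro t₁ g₁ hP₁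
        apply Runs.of_simple (by decide)
        simp only [Prog.eval, Expr.eval, State.setReg_reg, State.setReg_mem]
        refine ⟨?_, ?_⟩
        · rw [if_neg (by decide), if_true, g₁.reg 8 (by decide), g.reg 8 (by decide), h8,
            g₁.reg 0 (by decide), g.reg 0 (by decide), hsr.1]
          ring
        · rw [show 1 + (a + 1) * M = 1 + a * M + M by ring]
          exact hP₁
    · rintro s f ⟨-, hP⟩
      exact hP.isRowSums hM
  · simp only [Prog.cost, Expr.cost, Prog.push_cost]
    -- The loops that count the nodes take about `r * M` rounds, which the number of rows absorbs.
    have h₁ := le_treeSize hM r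
    have h₂ : treeSize M (r + 1) = 1 + treeSize M r * M := rfl
    have h₃ := Nat.mul_le_mul_right M h₁
    have h₄ := Nat.mul_le_mul_left (treeSize M r) hM
    rw [h₂]
    generalize treeSize M r = K at *
    ring_nf
    ring_nf at h₃ h₄
    omega

end Ram

/-! ### Loops with a bounded number of rounds, and supports as lists -/

namespace Ram

open Ram.Expr Ram.Prog

theorem Runs.forLoop_le {x : ℕ} {e : Expr} {body : Prog} {s : State} {B N : ℕ} (N' : ℕ)
    (I : ℕ → State → Prop) (hN : N ≤ N') (hx : body.writesReg x = false) (h0 : I 0 (s.setReg x 0))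
    (he : ∀ i s', Frame (Prog.forLoop x e body) s s' → I i s' → e.eval s' = N)
    (hs : ∀ i s', i < N → s'.reg x = i → Frame (Prog.forLoop x e body) s s' → I i s' →
      Runs body s' B fun s'' => I (i + 1) (s''.setReg x (i + 1))) :
    Runs (Prog.forLoop x e body) s (N' * (B + e.cost + 7) + e.cost + 5) (I N) :=
  (Runs.forLoop N I hx h0 he hs).mono
    (Nat.add_le_add_right (Nat.add_le_add_right (Nat.mul_le_mul_right _ hN) _) _)

theorem State.setMem_readList (s : State) (a i v : ℕ) :
    (s.setMem a (i + 1) v).readList a = (s.readList a).set i v := by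
  refine List.ext_getElem (by simp) fun j hj hj' => ?_
  simp [State.readList, List.getElem_set, eq_comm]

/-- The indices below `n` at which `f` is non-zero, in increasing order. -/
def support (n : ℕ) (f : ℕ → ℕ) : List ℕ := (List.range n).filter fun v => f v ≠ 0

theorem support_succ (n : ℕ) (f : ℕ → ℕ) :
    support (n + 1) f = support n f ++ if f n = 0 then [] else [n] := by
  by_cases h : f n = 0 <;> simp [support, List.range_succ, h]

theorem mem_support {n : ℕ} {f : ℕ → ℕ} {v : ℕ} : v ∈ support n f ↔ v < n ∧ f v ≠ 0 := by
  simp [support]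

theorem support_nodup (n : ℕ) (f : ℕ → ℕ) : (support n f).Nodup := List.nodup_range.filter _

theorem support_length_le (n : ℕ) (f : ℕ → ℕ) : (support n f).length ≤ n := by
  simpa [support] using List.length_filter_le (fun v => decide (f v ≠ 0)) (List.range n)

/-! ### The incidence matrix -/

/-- The input consists of a number and of a hypergraph with `n` vertices, the output is the incidence
matrix, one row of length `n` for each hyperedge. -/
def incidence : Prog :=
  (set 0 (get 0 (lit 2)) ;; set 1 (get 0 (lit 3)) ;; set 2 (lit 4) ;; set 3 (lit 0)) ;;
  forLoop 4 (reg 1)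
    ((set 6 (get 0 (reg 2)) ;; set 2 (add (reg 2) (lit 1))) ;;
    forLoop 5 (reg 6)
      (put 1 (add (add (reg 3) (get 0 (reg 2))) (lit 1)) (lit 1) ;; set 2 (add (reg 2) (lit 1))) ;;
    set 3 (add (reg 3) (reg 0))) ;;
  put 1 (lit 0) (reg 3)

/-- The list of the rows of an `m × n` matrix. -/
structure IsMatrix (n m : ℕ) (X : ℕ → ℕ → ℕ) (o : List ℕ) : Prop where
  length : o.length = m * n
  entry : ∀ e < m, ∀ v < n, o.getD (e * n + v) 0 = X e v

/-- Here `off e` is the offset of the record of hyperedge `e` in the input. The program writes only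
the ones; the zeros come from the initial memory. -/
theorem incidence_runs {w : List ℕ} {n m : ℕ} {L : ℕ → List ℕ} {off : ℕ → ℕ}
    (hn : w.getD 1 0 = n) (hm : w.getD 2 0 = m) (hoff : off 0 = 0)
    (hoff' : ∀ e < m, off (e + 1) = off e + 1 + (L e).length)
    (hlen : ∀ e < m, w.getD (3 + off e) 0 = (L e).length)
    (helt : ∀ e < m, ∀ j < (L e).length, w.getD (3 + (off e + 1 + j)) 0 = (L e).getD j 0)
    (hle : ∀ e < m, (L e).length ≤ n) (hlt : ∀ e < m, ∀ v ∈ L e, v < n) :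
    Runs incidence (State.ofInput w) (1000 * ((n + 1) * (m + 1))) fun s =>
      IsMatrix n m (fun e v => if v ∈ L e then 1 else 0) s.output := by
  set s₀ := State.ofInput w with hs₀
  have hn₀ : s₀.mem 0 2 = n := by simp [hs₀, ← hn]
  have hm₀ : s₀.mem 0 3 = m := by simp [hs₀, ← hm]
  have hlen₀ : ∀ e < m, s₀.mem 0 (4 + off e) = (L e).length := fun e he => by
    rw [show 4 + off e = 3 + off e + 1 by omega, hs₀, State.ofInput_mem_succ, hlen e he]
  have helt₀ : ∀ e < m, ∀ j < (L e).length, s₀.mem 0 (4 + off e + 1 + j) = (L e).getD j 0 :=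
    fun e he j hj => by
      rw [show 4 + off e + 1 + j = 3 + (off e + 1 + j) + 1 by omega, hs₀, State.ofInput_mem_succ,
        helt e he j hj]
  have h₁ : ∀ j, s₀.mem 1 j = 0 := fun j => by simp [hs₀]
  clear_value s₀
  apply Runs.mono
  · unfold incidence
    apply Runs.seq (Mid := fun s => s.reg 0 = n ∧ s.reg 1 = m ∧ s.reg 2 = 4 ∧ s.reg 3 = 0)
    · apply Runs.of_simple (by decide)
      simp [Prog.eval, Expr.eval, hn₀, hm₀]
    rintro s₁ f₁ ⟨hn₁, hm₁, h2₁, h3₁⟩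
    apply Runs.seq (Mid := fun s => s.reg 3 = m * n ∧ ∀ e < m, ∀ v < n,
      s.mem 1 (e * n + v + 1) = if v ∈ L e then 1 else 0)
    · apply Runs.imp
      · apply Runs.forLoop m (fun e s => s.reg 2 = 4 + off e ∧ s.reg 3 = e * n ∧ ∀ e', ∀ v < n,
          s.mem 1 (e' * n + v + 1) = if e' < e ∧ v ∈ L e' then 1 else 0) (by decide)
        · simp [h2₁, h3₁, hoff, f₁.mem 1 (by decide), h₁]
        · intro i s f _
          rw [Expr.eval, f.reg 1 (by decide), hm₁]
        · rintro e s he hse f ⟨h2, h3, h⟩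
          have hs0 : s.mem 0 = s₀.mem 0 := by rw [f.mem 0 (by decide), f₁.mem 0 (by decide)]
          have hsn : s.reg 0 = n := by rw [f.reg 0 (by decide), hn₁]
          apply Runs.seq (Mid := fun s' => s' = (s.setReg 6 (L e).length).setReg 2 (4 + off e + 1))
          · apply Runs.of_simple (by decide)
            simp [Prog.eval, Expr.eval, h2, hs0, hlen₀ e he]
          rintro t g ht
          apply Runs.seq (Mid := fun s => s.reg 2 = 4 + off e + 1 + (L e).length ∧ ∀ e', ∀ v < n,
            s.mem 1 (e' * n + v + 1) = if e' < e + 1 ∧ v ∈ L e' then 1 else 0)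
          · apply Runs.imp
            · apply Runs.forLoop_le n (N := (L e).length) (fun j s => s.reg 2 = 4 + off e + 1 + j ∧
                ∀ e', ∀ v < n, s.mem 1 (e' * n + v + 1) =
                  if e' < e ∧ v ∈ L e' ∨ e' = e ∧ v ∈ (L e).take j then 1 else 0) (hle e he)
                (by decide)
              · simpa [ht] using h
              · intro j s' f' _
                simp [Expr.eval, f'.reg 6 (by decide), ht]
              · rintro j t₁ hj htj g₁ ⟨h2₁, h₁⟩
                have hx : (L e).getD j 0 ∈ L e := by
                  rw [List.getD_eq_getElem _ _ hj]
                  exact List.getElem_mem hj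
                have h3₁ : t₁.reg 3 = e * n := by rw [g₁.reg 3 (by decide), g.reg 3 (by decide), h3]
                apply Runs.of_simple (by decide)
                simp only [Prog.eval, Expr.eval, State.setReg_reg, State.setReg_mem,
                  State.setMem_reg, State.setMem_mem, h2₁, h3₁, g₁.mem 0 (by decide),
                  g.mem 0 (by decide), hs0, helt₀ e he j hj]
                refine ⟨by simp; omega, fun e' v hv => ?_⟩
                rw [h₁ e' v hv]
                have hiff : v ∈ (L e).take (j + 1) ↔ v ∈ (L e).take j ∨ v = (L e).getD j 0 := by
                  rw [List.take_add_one, List.mem_append]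
                  simp [hj]
                have hpos : e' * n + v + 1 = e * n + (L e).getD j 0 + 1 ↔
                    e' = e ∧ v = (L e).getD j 0 := by
                  constructor
                  · intro h
                    exact mul_add_inj hv (hlt e he _ hx) (by omega)
                  · rintro ⟨rfl, rfl⟩
                    rfl
                simp only [hiff, hpos, true_and]
                split_ifs <;> first | rfl | (exfalso; tauto)
            · rintro t₁ g₁ ⟨h2₁, h₁⟩
              refine ⟨h2₁, fun e' v hv => ?_⟩
              rw [h₁ e' v hv, List.take_length]
              have : e' < e + 1 ∧ v ∈ L e' ↔ e' < e ∧ v ∈ L e' ∨ e' = e ∧ v ∈ L e := by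
                constructor
                · rintro ⟨h, h'⟩
                  rcases Nat.lt_succ_iff_lt_or_eq.mp h with h | rfl
                  · exact Or.inl ⟨h, h'⟩
                  · exact Or.inr ⟨rfl, h'⟩
                · rintro (⟨h, h'⟩ | ⟨rfl, h'⟩)
                  · exact ⟨by omega, h'⟩
                  · exact ⟨by omega, h'⟩
              simp only [this]
          rintro t₁ g₁ ⟨h2₁, h₁⟩
          apply Runs.of_simple (by decide)
          simp only [Prog.eval, Expr.eval, State.setReg_reg, State.setReg_mem]
          refine ⟨?_, ?_, h₁⟩
          · rw [hoff' e he]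
            simp [h2₁]
            omega
          · simp [g₁.reg 3 (by decide), g₁.reg 0 (by decide), ht, h3, hsn, add_mul]
      · rintro s f ⟨-, h3, h⟩
        refine ⟨h3, fun e he v hv => ?_⟩
        rw [h e v hv]
        simp [he]
    rintro s₂ f₂ ⟨h3, h⟩
    apply Runs.of_simple (by decide)
    simp only [Prog.eval, Expr.eval, h3]
    have hz : (s₂.setMem 1 0 (m * n)).mem 1 0 = m * n := by simp
    refine ⟨by rw [State.output, State.readList_length, hz], fun e he v hv => ?_⟩
    rw [State.output, State.readList_getD _ _ _ (by rw [hz]; exact mul_add_lt hv he),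
      State.setMem_mem, if_neg (by omega), h e he v hv]
  · simp only [Prog.cost, Expr.cost]
    ring_nf
    omega

end Ram

namespace Ram

open Ram.Expr Ram.Prog

/-- The input of `contract` and of `evaluate`: the numbers `n`, `m` and `thr`, a row of `n` labels and
an `m × n` matrix. -/
structure IsLabeledMatrix (n m thr : ℕ) (row : ℕ → ℕ) (X : ℕ → ℕ → ℕ) (w : List ℕ) : Prop where
  length : w.length = 3 + n + m * n
  n_eq : w.getD 0 0 = n
  m_eq : w.getD 1 0 = m
  thr_eq : w.getD 2 0 = thr
  row_eq : ∀ v < n, w.getD (3 + v) 0 = row v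
  entry : ∀ e < m, ∀ v < n, w.getD (3 + n + (e * n + v)) 0 = X e v

/-! ### Contracting the terminals -/

open Classical in
/-- The indicator function of the image under `g` of the support of `f`. -/
noncomputable def imageIndicator (n : ℕ) (f g : ℕ → ℕ) (v : ℕ) : ℕ :=
  if ∃ u < n, f u ≠ 0 ∧ g u = v then 1 else 0

theorem imageIndicator_ne_zero {n : ℕ} {f g : ℕ → ℕ} {v : ℕ} :
    imageIndicator n f g v ≠ 0 ↔ ∃ u < n, f u ≠ 0 ∧ g u = v := by
  simp [imageIndicator]

/-- It makes the truncated subtraction of sizes in `contractEdge` exact. -/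
theorem support_imageIndicator_length_le (n : ℕ) (f g : ℕ → ℕ) :
    (support n (imageIndicator n f g)).length ≤ (support n f).length := by
  have : support n (imageIndicator n f g) ⊆ (support n f).map g := by
    intro v hv
    obtain ⟨u, hu, hfu, rfl⟩ := imageIndicator_ne_zero.mp (mem_support.mp hv).2
    exact List.mem_map.mpr ⟨u, mem_support.mpr ⟨hu, hfu⟩, rfl⟩
  simpa using (List.subperm_of_subset (support_nodup _ _) this).length_le

theorem imageIndicator_succ (i : ℕ) (f g : ℕ → ℕ) (v : ℕ) :
    imageIndicator (i + 1) f g v = if f i ≠ 0 ∧ v = g i then 1 else imageIndicator i f g v := by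
  simp only [imageIndicator]
  by_cases h : f i ≠ 0 ∧ v = g i
  · rw [if_pos h, if_pos ⟨i, by omega, h.1, h.2.symm⟩]
  · rw [if_neg h]
    congr 1
    refine propext ⟨?_, ?_⟩
    · rintro ⟨u, hu, h₁, h₂⟩
      rcases Nat.lt_succ_iff_lt_or_eq.mp hu with hu | rfl
      · exact ⟨u, hu, h₁, h₂⟩
      · exact absurd ⟨h₁, h₂.symm⟩ h
    · rintro ⟨u, hu, h⟩
      exact ⟨u, by omega, h⟩

/-- A list with its length in front of it. -/
def withLength (l : List ℕ) : List ℕ := l.length :: l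

/-- Append the image of a row of the matrix, as a list of vertices with its length. -/
def contractEdge : Prog :=
  forLoop 5 (reg 0) (put 3 (reg 5) (lit 0)) ;;
  forLoop 5 (reg 0)
    (ite (get 0 (reg 6)) (put 3 (get 2 (reg 5)) (lit 1) ;; set 7 (add (reg 7) (lit 1))) skip ;;
    set 6 (add (reg 6) (lit 1))) ;;
  (set 9 (lit 0)) ;;
  forLoop 5 (reg 0) (set 9 (add (reg 9) (get 3 (reg 5)))) ;;
  (set 7 (sub (reg 7) (reg 9)) ;; push 1 (reg 9)) ;;
  forLoop 5 (reg 0) (ite (get 3 (reg 5)) (push 1 (reg 5)) skip)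

/-- Register 7 accumulates the size lost by contraction, which later becomes the number of padding
singletons. -/
theorem contractEdge_runs {s : State} {n q : ℕ} {f g : ℕ → ℕ} (hn : s.reg 0 = n) (hq : s.reg 6 = q)
    (hf : ∀ v < n, s.mem 0 (q + v) = f v) (hg : ∀ v < n, s.mem 2 v = g v) :
    Runs contractEdge s (1000 * (n + 1)) fun s' =>
      s'.readList 1 = s.readList 1 ++ withLength (support n (imageIndicator n f g)) ∧
      s'.reg 6 = q + n ∧
      s'.reg 7 + (support n (imageIndicator n f g)).length = s.reg 7 + (support n f).length := by
  apply Runs.mono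
  · unfold contractEdge
    apply Runs.seq (Mid := fun s' => ∀ v < n, s'.mem 3 v = 0)
    · apply Runs.forLoop n (fun j s' => ∀ v < j, s'.mem 3 v = 0) (by decide)
      · simp
      · intro i s' f' _
        rw [Expr.eval, f'.reg 0 (by decide), hn]
      · intro j s' hj hsj f' h
        apply Runs.of_simple (by decide)
        simp only [Prog.eval, Expr.eval, State.setReg_mem, State.setMem_mem, hsj, true_and]
        intro v hv
        have := h v
        split_ifs <;> omega
    intro s₁ f₁ h₁
    apply Runs.seq (Mid := fun s' => s'.reg 6 = q + n ∧
      s'.reg 7 = s.reg 7 + (support n f).length ∧ ∀ v < n, s'.mem 3 v = imageIndicator n f g v)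
    · apply Runs.forLoop n (fun j s' => s'.reg 6 = q + j ∧
        s'.reg 7 = s.reg 7 + (support j f).length ∧ ∀ v < n, s'.mem 3 v = imageIndicator j f g v)
        (by decide)
      · simp [f₁.reg 6 (by decide), f₁.reg 7 (by decide), hq, support, imageIndicator]
        exact h₁
      · intro i s' f' _
        rw [Expr.eval, f'.reg 0 (by decide), f₁.reg 0 (by decide), hn]
      · rintro j s' hj hsj f' ⟨h6, h7, h3⟩
        have e₀ : s'.mem 0 (q + j) = f j := by
          rw [f'.mem 0 (by decide), f₁.mem 0 (by decide), hf j hj]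
        have e₂ : s'.mem 2 j = g j := by
          rw [f'.mem 2 (by decide), f₁.mem 2 (by decide), hg j hj]
        apply Runs.of_simple (by decide)
        simp only [Prog.eval, Expr.eval, h6, e₀, hsj, e₂]
        by_cases hz : f j = 0
        · simp only [hz, if_true, State.setReg_reg, State.setReg_mem, h6, support_succ]
          refine ⟨by simp; omega, by simp [h7], fun v hv => ?_⟩
          rw [h3 v hv, imageIndicator_succ, if_neg (by simp [hz])]
        · simp only [hz, if_false, State.setReg_reg, State.setReg_mem, State.setMem_reg,
            State.setMem_mem, h6, support_succ]
          refine ⟨by simp; omega, by simp [h7]; omega, fun v hv => ?_⟩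
          rw [imageIndicator_succ, h3 v hv]
          simp [hz]
    rintro s₂ f₂ ⟨h6₂, h7₂, h3₂⟩
    set l := support n (imageIndicator n f g) with hl
    apply Runs.seq (Mid := fun s' => s' = s₂.setReg 9 0)
    · apply Runs.of_simple (by decide)
      simp [Prog.eval, Expr.eval]
    intro s₃ f₃ hs₃
    apply Runs.seq (Mid := fun s' => s'.reg 9 = l.length)
    · apply Runs.forLoop n
        (fun j s' => s'.reg 9 = (support j (imageIndicator n f g)).length) (by decide)
      · simp [hs₃, support]
      · intro i s' f' _
        rw [Expr.eval, f'.reg 0 (by decide), f₃.reg 0 (by decide), f₂.reg 0 (by decide),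
          f₁.reg 0 (by decide), hn]
      · intro j s' hj hsj f' h
        apply Runs.of_simple (by decide)
        have : s'.mem 3 j = imageIndicator n f g j := by
          rw [f'.mem 3 (by decide), f₃.mem 3 (by decide), h3₂ j hj]
        simp only [Prog.eval, Expr.eval, State.setReg_reg, hsj, this, h, support_succ]
        by_cases hc : ∃ u < n, f u ≠ 0 ∧ g u = j <;> simp [imageIndicator, hc]
    intro s₄ f₄ h9₄
    apply Runs.seq (Mid := fun s' => s' = (s₄.setReg 7 (s₄.reg 7 - l.length)).append 1 l.length)
    · apply Runs.of_simple (by decide)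
      simp [Prog.eval, Prog.push_eval, Expr.eval, h9₄]
    intro s₅ f₅ hs₅
    apply Runs.imp
    · apply Runs.forLoop n (fun j s' => s'.readList 1 = s.readList 1 ++
        (l.length :: support j (imageIndicator n f g))) (by decide)
      · simp [hs₅, support, f₄.readList 1 (by decide), f₃.readList 1 (by decide),
          f₂.readList 1 (by decide), f₁.readList 1 (by decide)]
      · intro i s' f' _
        rw [Expr.eval, f'.reg 0 (by decide), f₅.reg 0 (by decide), f₄.reg 0 (by decide),
          f₃.reg 0 (by decide), f₂.reg 0 (by decide), f₁.reg 0 (by decide), hn]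
      · intro j s' hj hsj f' h
        apply Runs.of_simple (by decide)
        have : s'.mem 3 j = imageIndicator n f g j := by
          rw [f'.mem 3 (by decide), f₅.mem 3 (by decide), f₄.mem 3 (by decide),
            f₃.mem 3 (by decide), h3₂ j hj]
        simp only [Prog.eval, Prog.push_eval, Expr.eval, hsj, this, support_succ]
        by_cases hc : imageIndicator n f g j = 0 <;> simp [hc, h]
    · intro s₆ f₆ h₆
      refine ⟨h₆, ?_, ?_⟩
      · rw [f₆.reg 6 (by decide), f₅.reg 6 (by decide), f₄.reg 6 (by decide), f₃.reg 6 (by decide),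
          h6₂]
      · have e₄ : s₄.reg 7 = s.reg 7 + (support n f).length := by
          rw [f₄.reg 7 (by decide), f₃.reg 7 (by decide), h7₂]
        have e₅ : s₆.reg 7 = s₄.reg 7 - l.length := by
          rw [f₆.reg 7 (by decide), hs₅]
          simp
        have := support_imageIndicator_length_le n f g
        rw [← hl] at this
        omega
  · simp only [Prog.cost, Expr.cost, Prog.push_cost]
    ring_nf
    omega

/-- Where `contract` maps the vertices. -/
def contraction (thr : ℕ) (row : ℕ → ℕ) (s t v : ℕ) : ℕ :=
  if row v < thr then if 0 < row v then t else v else s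

/-- The hypergraph whose terminals are contracted: the vertices with a label at least `thr` to one of
them, and the vertices with any other non-zero label to one of them. The contracted hyperedges are
followed by singletons, so that the size does not change. -/
def contract : Prog :=
  (set 0 (get 0 (lit 1)) ;; set 1 (get 0 (lit 2)) ;; set 2 (get 0 (lit 3)) ;; set 3 (reg 0) ;;
    set 4 (reg 0)) ;;
  forLoop 5 (reg 0)
    (ite (lt (get 0 (add (lit 4) (reg 5))) (reg 2))
      (ite (lt (lit 0) (get 0 (add (lit 4) (reg 5)))) (set 4 (reg 5)) skip) (set 3 (reg 5))) ;;
  ite (lt (reg 3) (reg 0))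
    (ite (lt (reg 4) (reg 0))
      (forLoop 5 (reg 0)
        (ite (lt (get 0 (add (lit 4) (reg 5))) (reg 2))
          (ite (lt (lit 0) (get 0 (add (lit 4) (reg 5)))) (put 2 (reg 5) (reg 4))
            (put 2 (reg 5) (reg 5)))
          (put 2 (reg 5) (reg 3))) ;;
      (push 1 (reg 3) ;; push 1 (reg 4) ;; push 1 (reg 0) ;; push 1 (lit 0) ;;
        set 6 (add (lit 4) (reg 0)) ;; set 7 (lit 0)) ;;
      forLoop 8 (reg 1) contractEdge ;;
      forLoop 8 (reg 7) (push 1 (lit 1) ;; push 1 (reg 3)) ;;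
      put 1 (lit 4) (add (reg 1) (reg 7)))
      skip)
    skip

/-- The output of `contract`. -/
structure IsContraction (n m thr : ℕ) (row : ℕ → ℕ) (X : ℕ → ℕ → ℕ) (o : List ℕ) : Prop where
  eq_nil : ((∀ v < n, row v < thr) ∨ ∀ v < n, row v = 0 ∨ thr ≤ row v) → o = []
  eq_contraction : (∃ v < n, thr ≤ row v) → (∃ v < n, 0 < row v ∧ row v < thr) →
    ∃ s < n, ∃ t < n, ∃ pad, thr ≤ row s ∧ 0 < row t ∧ row t < thr ∧
      pad + ((List.range m).map fun e =>
        (support n (imageIndicator n (X e) (contraction thr row s t))).length).sum =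
        ((List.range m).map fun e => (support n (X e)).length).sum ∧
      o = s :: t :: n :: (m + pad) ::
        ((List.range m).flatMap fun e =>
          withLength (support n (imageIndicator n (X e) (contraction thr row s t)))) ++
        (List.replicate pad [1, s]).flatten

set_option maxHeartbeats 1000000 in
theorem contract_runs {w : List ℕ} {n m thr : ℕ} {row : ℕ → ℕ} {X : ℕ → ℕ → ℕ}
    (hw : IsLabeledMatrix n m thr row X w) :
    Runs contract (State.ofInput w) (10000 * ((n + 1) * (m + 1))) fun s =>
      IsContraction n m thr row X s.output := by
  set s₀ := State.ofInput w with hs₀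
  have hn₀ : s₀.mem 0 1 = n := by simp [hs₀, ← hw.n_eq]
  have hm₀ : s₀.mem 0 2 = m := by simp [hs₀, ← hw.m_eq]
  have ht₀ : s₀.mem 0 3 = thr := by simp [hs₀, ← hw.thr_eq]
  have hrow₀ : ∀ v < n, s₀.mem 0 (4 + v) = row v := fun v hv => by
    rw [show 4 + v = 3 + v + 1 by omega, hs₀, State.ofInput_mem_succ, hw.row_eq v hv]
  have hX₀ : ∀ e < m, ∀ v < n, s₀.mem 0 (4 + n + e * n + v) = X e v := fun e he v hv => by
    rw [show 4 + n + e * n + v = 3 + n + (e * n + v) + 1 by omega, hs₀, State.ofInput_mem_succ,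
      hw.entry e he v hv]
  have h₁ : s₀.readList 1 = [] := State.readList_eq_nil _ _ (by simp [hs₀])
  clear_value s₀
  apply Runs.mono
  · unfold contract
    apply Runs.seq (Mid := fun s => s.reg 0 = n ∧ s.reg 1 = m ∧ s.reg 2 = thr ∧ s.reg 3 = n ∧
      s.reg 4 = n)
    · apply Runs.of_simple (by decide)
      simp [Prog.eval, Expr.eval, hn₀, hm₀, ht₀]
    rintro s₁ f₁ ⟨hn₁, hm₁, ht₁, h3₁, h4₁⟩
    -- The value `n` in register 3 or 4 means that no source or no sink has been found.
    apply Runs.seq (Mid := fun s =>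
      (s.reg 3 = n ∧ (∀ v < n, row v < thr) ∨ s.reg 3 < n ∧ thr ≤ row (s.reg 3)) ∧
      (s.reg 4 = n ∧ (∀ v < n, row v = 0 ∨ thr ≤ row v) ∨
        s.reg 4 < n ∧ 0 < row (s.reg 4) ∧ row (s.reg 4) < thr))
    · apply Runs.forLoop n (fun j s =>
        (s.reg 3 = n ∧ (∀ v < j, row v < thr) ∨ s.reg 3 < n ∧ thr ≤ row (s.reg 3)) ∧
        (s.reg 4 = n ∧ (∀ v < j, row v = 0 ∨ thr ≤ row v) ∨
          s.reg 4 < n ∧ 0 < row (s.reg 4) ∧ row (s.reg 4) < thr)) (by decide)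
      · simp [h3₁, h4₁]
      · intro i s f _
        rw [Expr.eval, f.reg 0 (by decide), hn₁]
      · rintro j s hj hsj f ⟨h3, h4⟩
        have e₀ : s.mem 0 (4 + j) = row j := by
          rw [f.mem 0 (by decide), f₁.mem 0 (by decide), hrow₀ j hj]
        have e₂ : s.reg 2 = thr := by rw [f.reg 2 (by decide), ht₁]
        have hsucc : ∀ p : ℕ → Prop, (∀ v < j, p v) → p j → ∀ v < j + 1, p v := by
          intro p hp hpj v hv
          rcases Nat.lt_succ_iff_lt_or_eq.mp hv with hv | rfl
          · exact hp v hv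
          · exact hpj
        apply Runs.of_simple (by decide)
        simp only [Prog.eval, Expr.eval, hsj, e₀, e₂]
        by_cases c₁ : row j < thr
        · have g₃ : s.reg 3 = n ∧ (∀ v < j + 1, row v < thr) ∨ s.reg 3 < n ∧ thr ≤ row (s.reg 3) :=
            h3.imp_left fun h => ⟨h.1, hsucc _ h.2 c₁⟩
          by_cases c₂ : 0 < row j
          · simp only [c₁, c₂, if_true, one_ne_zero, if_false, State.setReg_reg]
            exact ⟨by simpa using g₃, Or.inr (by simp [hj, c₁, c₂])⟩
          · simp only [c₁, c₂, if_true, one_ne_zero, if_false, State.setReg_reg]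
            have g₄ := h4.imp_left fun h => And.intro h.1 (hsucc _ h.2 (by omega))
            exact ⟨by simpa using g₃, by simpa using g₄⟩
        · simp only [c₁, if_true, if_false, State.setReg_reg]
          have g₄ := h4.imp_left fun h => And.intro h.1 (hsucc _ h.2 (by omega))
          exact ⟨Or.inr (by simp [hj]; omega), by simpa using g₄⟩
    rintro s₂ f₂ ⟨h3₂, h4₂⟩
    have hl₂ : s₂.readList 1 = [] := by
      rw [f₂.readList 1 (by decide), f₁.readList 1 (by decide), h₁]
    have hn₂ : s₂.reg 0 = n := by rw [f₂.reg 0 (by decide), hn₁]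
    have hskip : ∀ {B : ℕ}, ((∀ v < n, row v < thr) ∨ ∀ v < n, row v = 0 ∨ thr ≤ row v) → 1 ≤ B →
        Runs skip s₂ B fun s => IsContraction n m thr row X s.output := by
      intro B hcase hB
      refine Runs.mono (B := Prog.cost skip) (Runs.of_simple (by decide) ?_) hB
      refine ⟨fun _ => hl₂, fun ⟨v, hv, h⟩ ⟨u, hu, h'⟩ => ?_⟩
      rcases hcase with hc | hc
      · have := hc v hv
        omega
      · have := hc u hu
        omega
    apply Runs.ite (B := (n + 1) * (m + 1) * 8000)
    swap
    · intro hb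
      have : s₂.reg 3 = n ∧ ∀ v < n, row v < thr := by
        refine h3₂.resolve_right fun h => ?_
        simp [Expr.eval, hn₂, h.1] at hb
      exact hskip (Or.inl this.2) (by ring_nf; omega)
    intro hb
    obtain ⟨hsn, hs⟩ : s₂.reg 3 < n ∧ thr ≤ row (s₂.reg 3) := by
      refine h3₂.resolve_left fun h => ?_
      simp [Expr.eval, hn₂, h.1] at hb
    clear hb h3₂
    apply Runs.mono
    · apply Runs.ite (B := (n + 1) * (m + 1) * 7000)
      swap
      · intro hb
        have : s₂.reg 4 = n ∧ ∀ v < n, row v = 0 ∨ thr ≤ row v := by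
          refine h4₂.resolve_right fun h => ?_
          simp [Expr.eval, hn₂, h.1] at hb
        exact hskip (Or.inr this.2) (by ring_nf; omega)
      intro hb
      obtain ⟨htn, ht, ht'⟩ : s₂.reg 4 < n ∧ 0 < row (s₂.reg 4) ∧ row (s₂.reg 4) < thr := by
        refine h4₂.resolve_left fun h => ?_
        simp [Expr.eval, hn₂, h.1] at hb
      clear hb h4₂ hskip
      have hm₂ : s₂.reg 1 = m := by rw [f₂.reg 1 (by decide), hm₁]
      have ht₂ : s₂.reg 2 = thr := by rw [f₂.reg 2 (by decide), ht₁]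
      have hm0₂ : s₂.mem 0 = s₀.mem 0 := by rw [f₂.mem 0 (by decide), f₁.mem 0 (by decide)]
      set x := s₂.reg 3 with hx
      set y := s₂.reg 4 with hy
      set π := contraction thr row x y with hπ
      apply Runs.mono
      · apply Runs.seq (Mid := fun s => ∀ v < n, s.mem 2 v = π v)
        · apply Runs.forLoop n (fun j s => ∀ v < j, s.mem 2 v = π v) (by decide)
          · simp
          · intro i s f _
            rw [Expr.eval, f.reg 0 (by decide), hn₂]
          · intro j s hj hsj f h
            have e₀ : s.mem 0 (4 + j) = row j := by
              rw [f.mem 0 (by decide), hm0₂, hrow₀ j hj]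
            have e₂ : s.reg 2 = thr := by rw [f.reg 2 (by decide), ht₂]
            have e₃ : s.reg 3 = x := by rw [f.reg 3 (by decide)]
            have e₄ : s.reg 4 = y := by rw [f.reg 4 (by decide)]
            have hgoal : ∀ s' : State, s' = s.setMem 2 j (π j) →
                ∀ v < j + 1, (s'.setReg 5 (j + 1)).mem 2 v = π v := by
              rintro s' rfl v hv
              simp only [State.setReg_mem, State.setMem_mem, true_and]
              split_ifs with hvj
              · rw [hvj]
              · exact h v (by omega)
            apply Runs.of_simple (by decide)
            apply hgoal
            simp only [Prog.eval, Expr.eval, hsj, e₀, e₂, e₃, e₄, hπ, contraction]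
            by_cases c₁ : row j < thr <;> by_cases c₂ : 0 < row j <;> simp [c₁, c₂]
        intro s₃ f₃ h2₃
        apply Runs.seq (Mid := fun s => s.readList 1 = [x, y, n, 0] ∧ s.reg 6 = 4 + n ∧ s.reg 7 = 0)
        · apply Runs.of_simple (by decide)
          simp [Prog.eval, Prog.push_eval, Expr.eval, f₃.reg 0 (by decide), f₃.reg 3 (by decide),
            f₃.reg 4 (by decide), hn₂, f₃.readList 1 (by decide), hl₂, hx, hy]
        rintro s₄ f₄ ⟨hl₄, h6₄, h7₄⟩
        apply Runs.seq (Mid := fun s => s.readList 1 = [x, y, n, 0] ++ ((List.range m).flatMap fun e =>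
            withLength (support n (imageIndicator n (X e) π))) ∧
          s.reg 7 + ((List.range m).map fun e =>
            (support n (imageIndicator n (X e) π)).length).sum =
            ((List.range m).map fun e => (support n (X e)).length).sum)
        · apply Runs.imp
          · apply Runs.forLoop m (fun j s => s.reg 6 = 4 + n + j * n ∧
              s.readList 1 = [x, y, n, 0] ++ ((List.range j).flatMap fun e =>
                withLength (support n (imageIndicator n (X e) π))) ∧
              s.reg 7 + ((List.range j).map fun e =>
                (support n (imageIndicator n (X e) π)).length).sum =
                ((List.range j).map fun e => (support n (X e)).length).sum) (by decide)
            · simp [h6₄, h7₄, hl₄]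
            · intro i s f _
              rw [Expr.eval, f.reg 1 (by decide), f₄.reg 1 (by decide), f₃.reg 1 (by decide), hm₂]
            · rintro e s he hse f ⟨h6, hl, h7⟩
              apply Runs.imp
              · apply contractEdge_runs (n := n) (q := 4 + n + e * n) (f := X e) (g := π)
                · rw [f.reg 0 (by decide), f₄.reg 0 (by decide), f₃.reg 0 (by decide), hn₂]
                · exact h6
                · intro v hv
                  rw [f.mem 0 (by decide), f₄.mem 0 (by decide), f₃.mem 0 (by decide), hm0₂,
                    hX₀ e he v hv]
                · intro v hv
                  rw [f.mem 2 (by decide), f₄.mem 2 (by decide), h2₃ v hv]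
              · rintro s' f' ⟨hl', h6', h7'⟩
                simp only [State.setReg_reg, State.setReg_readList, h6', hl', hl]
                refine ⟨by simp; ring, ?_, ?_⟩
                · simp [List.range_succ]
                · simp only [List.range_succ, List.map_append, List.sum_append, List.map_cons,
                    List.map_nil, List.sum_cons, List.sum_nil]
                  simp
                  omega
          · rintro s f ⟨-, h⟩
            exact h
        rintro s₅ f₅ ⟨hl₅, h7₅⟩
        -- The padding restores lost incidences only, so the padding loop stays within the time
        -- bound.
        have hpad : s₅.reg 7 ≤ m * n := by
          refine (Nat.le_add_right _ _).trans (h7₅.le.trans ?_)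
          have := List.sum_le_card_nsmul
            ((List.range m).map fun e => (support n (X e)).length) n (by
              intro x hx
              obtain ⟨e, -, rfl⟩ := List.mem_map.mp hx
              exact support_length_le _ _)
          simpa using this
        have hn₅ : s₅.reg 1 = m ∧ s₅.reg 3 = x := by
          rw [f₅.reg 1 (by decide), f₄.reg 1 (by decide), f₃.reg 1 (by decide),
            f₅.reg 3 (by decide), f₄.reg 3 (by decide), f₃.reg 3 (by decide)]
          exact ⟨hm₂, rfl⟩
        apply Runs.seq (Mid := fun s =>
          s.readList 1 = s₅.readList 1 ++ (List.replicate (s₅.reg 7) [1, x]).flatten)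
        · apply Runs.forLoop_le (m * n) (N := s₅.reg 7) (fun j s =>
            s.readList 1 = s₅.readList 1 ++ (List.replicate j [1, x]).flatten) hpad (by decide)
          · simp
          · intro i s f _
            rw [Expr.eval, f.reg 7 (by decide)]
          · intro j s hj hsj f h
            apply Runs.of_simple (by decide)
            simp [Prog.eval, Prog.push_eval, Expr.eval, h, f.reg 3 (by decide), hn₅,
              List.replicate_succ']
        intro s₆ f₆ h₆
        -- The number of hyperedges was written as 0 and is filled in now that the padding is known.
        apply Runs.of_simple (by decide)
        simp only [Prog.eval, Expr.eval]
        refine ⟨fun hcase => ?_, fun _ _ => ⟨x, hsn, y, htn, s₅.reg 7, hs, ht, ht', h7₅, ?_⟩⟩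
        · rcases hcase with hc | hc
          · have := hc x hsn
            omega
          · have := hc y htn
            omega
        · rw [State.output, State.setMem_readList, h₆, hl₅, f₆.reg 1 (by decide),
            f₆.reg 7 (by decide), hn₅.1]
          simp [hπ]
      · simp only [Prog.cost, Expr.cost, Prog.push_cost]
        ring_nf
        omega
    · simp only [Expr.cost]
      ring_nf
      omega
  · simp only [Prog.cost, Expr.cost]
    ring_nf
    omega

end Ram

/-! ### Copying lists between arrays -/

namespace Ram

open Ram.Expr Ram.Prog

/-- Append the list in array `b`, without its first `k` elements, to the list in array `a`. -/
def Prog.appendDrop (x a b k : ℕ) : Prog :=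
  forLoop x (sub (get b (lit 0)) (lit k)) (push a (get b (add (reg x) (lit (k + 1)))))

theorem Prog.appendDrop_runs {x a b k N : ℕ} (hab : a ≠ b) (s : State)
    (hN : (s.readList b).length ≤ N) :
    Runs (Prog.appendDrop x a b k) s (N * 26 + 9) fun s' =>
      s'.readList a = s.readList a ++ (s.readList b).drop k := by
  have hw : (Prog.appendDrop x a b k).writesMem b = false := by
    simp [Prog.appendDrop, Prog.forLoop, Prog.push, Prog.writesMem, hab]
  rw [State.readList_length] at hN
  apply Runs.mono
  · apply Runs.imp
    · apply Runs.forLoop_le N (N := s.mem b 0 - k)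
        (fun j s' => s'.readList a = s.readList a ++ ((s.readList b).drop k).take j) (by omega) rfl
      · simp
      · intro i s' f _
        simp [Expr.eval, f.mem b hw]
      · intro j s' hj hsj f h
        apply Runs.of_simple rfl
        have hlen : j < ((s.readList b).drop k).length := by simpa using hj
        have hget : ((s.readList b).drop k)[j] = s.mem b (j + (k + 1)) := by
          rw [List.getElem_drop, ← List.getD_eq_getElem _ 0, State.readList_getD _ _ _ (by omega)]
          congr 1
          omega
        simp only [Prog.push_eval, Expr.eval, State.setReg_readList, State.append_readList, hsj,
          f.mem b hw, h, List.append_assoc]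
        rw [← hget, List.take_add_one, List.getElem?_eq_getElem hlen]
        rfl
    · intro s' f h
      rw [h, List.take_of_length_le (by simp)]
  · simp only [Prog.push_cost, Expr.cost]
    omega

/-! ### Evaluating a labeling -/

/-- `lab` maps each index below `n` to a representative of a class, and each `good` function is
constant on the classes. -/
structure IsRepresentative (n : ℕ) (good : (ℕ → ℕ) → Prop) (lab : ℕ → ℕ) : Prop where
  lt : ∀ v < n, lab v < n
  idem : ∀ v < n, lab (lab v) = lab v
  apply_eq : ∀ φ, good φ → ∀ v < n, φ (lab v) = φ v

/-- Relabel the class of `v` by the representative of `r`. Since every `good` function agrees at `v`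
and `r`, classes never become coarser than `good` functions can see. -/
theorem IsRepresentative.merge {n : ℕ} {good : (ℕ → ℕ) → Prop} {lab lab' : ℕ → ℕ}
    (h : IsRepresentative n good lab) {v r : ℕ} (hv : v < n) (hr : r < n)
    (hvr : ∀ φ, good φ → φ v = φ r)
    (h' : ∀ w < n, lab' w = if lab w = lab v then lab r else lab w) :
    IsRepresentative n good lab' := by
  refine ⟨fun w hw => ?_, fun w hw => ?_, fun φ hφ w hw => ?_⟩
  · rw [h' w hw]
    split_ifs
    · exact h.lt r hr
    · exact h.lt w hw
  · rw [h' w hw]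
    split_ifs with hc
    · rw [h' _ (h.lt r hr), h.idem r hr]
      split_ifs <;> rfl
    · rw [h' _ (h.lt w hw), h.idem w hw, if_neg hc]
  · rw [h' w hw]
    split_ifs with hc
    · rw [h.apply_eq φ hφ r hr, ← hvr φ hφ, ← h.apply_eq φ hφ v hv, ← hc, h.apply_eq φ hφ w hw]
    · exact h.apply_eq φ hφ w hw

open Classical in
/-- Is `row` not constant on the support of `f`? -/
noncomputable def nonconst (n : ℕ) (row f : ℕ → ℕ) : ℕ :=
  if ∃ u < n, ∃ v < n, f u ≠ 0 ∧ f v ≠ 0 ∧ row u ≠ row v then 1 else 0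

theorem nonconst_eq_zero {n : ℕ} {row f : ℕ → ℕ} :
    nonconst n row f = 0 ↔ ∀ u < n, ∀ v < n, f u ≠ 0 → f v ≠ 0 → row u = row v := by
  simp only [nonconst, ite_eq_right_iff, one_ne_zero, imp_false]
  push Not
  rfl

theorem nonconst_le_one (n : ℕ) (row f : ℕ → ℕ) : nonconst n row f ≤ 1 := by
  unfold nonconst
  split_ifs <;> simp

/-- Determine whether the labels are constant on a row of the matrix. -/
def scanEdge : Prog :=
  (set 3 (reg 0) ;; set 4 (lit 0)) ;;
  forLoop 5 (reg 0)
    (ite (get 0 (add (reg 6) (reg 5)))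
      (ite (lt (reg 3) (reg 0))
        (ite (eq (get 0 (add (lit 4) (reg 3))) (get 0 (add (lit 4) (reg 5)))) skip (set 4 (lit 1)))
        skip ;;
      set 3 (reg 5))
      skip)

/-- Comparing each vertex of the row with the previous one suffices. Register 3 ends at a vertex of
the row, which `mergeEdge` uses as its centre. -/
theorem scanEdge_runs {s : State} {n q : ℕ} {row f : ℕ → ℕ} (hn : s.reg 0 = n) (hq : s.reg 6 = q)
    (hrow : ∀ v < n, s.mem 0 (4 + v) = row v) (hf : ∀ v < n, s.mem 0 (q + v) = f v) :
    Runs scanEdge s (100 * (n + 1)) fun s' =>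
      s'.reg 4 = nonconst n row f ∧ ((∃ v < n, f v ≠ 0) → s'.reg 3 < n ∧ f (s'.reg 3) ≠ 0) := by
  apply Runs.mono
  · unfold scanEdge
    apply Runs.seq (Mid := fun s' => s' = (s.setReg 3 n).setReg 4 0)
    · apply Runs.of_simple (by decide)
      simp [Prog.eval, Expr.eval, hn]
    intro s₁ f₁ hs₁
    apply Runs.imp
    · apply Runs.forLoop n (fun j s' =>
        s'.reg 3 = n ∧ s'.reg 4 = 0 ∧ (∀ v < j, f v = 0) ∨
        s'.reg 3 < j ∧ f (s'.reg 3) ≠ 0 ∧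
          (s'.reg 4 = 0 ∧ (∀ v < j, f v ≠ 0 → row v = row (s'.reg 3)) ∨
            s'.reg 4 = 1 ∧ ∃ u < j, ∃ v < j, f u ≠ 0 ∧ f v ≠ 0 ∧ row u ≠ row v)) (by decide)
      · simp [hs₁]
      · intro i s' f' _
        rw [Expr.eval, f'.reg 0 (by decide), f₁.reg 0 (by decide), hn]
      · intro j s' hj hsj f' h
        have e₀ : s'.reg 0 = n := by rw [f'.reg 0 (by decide), f₁.reg 0 (by decide), hn]
        have e₆ : s'.reg 6 = q := by rw [f'.reg 6 (by decide), f₁.reg 6 (by decide), hq]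
        have em : s'.mem 0 = s.mem 0 := by rw [f'.mem 0 (by decide), f₁.mem 0 (by decide)]
        apply Runs.of_simple (by decide)
        simp only [Prog.eval, Expr.eval, em, e₆, hsj, hf j hj, e₀, hrow j hj]
        by_cases c₁ : f j = 0
        · simp only [c₁, if_true, State.setReg_reg]
          rcases h with ⟨h₁, h₂, h₃⟩ | ⟨h₁, h₂, h₃⟩
          · refine Or.inl ⟨by simpa using h₁, by simpa using h₂, fun v hv => ?_⟩
            rcases Nat.lt_succ_iff_lt_or_eq.mp hv with hv | rfl
            exacts [h₃ v hv, c₁]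
          · refine Or.inr ⟨by simp; omega, by simpa using h₂, ?_⟩
            rcases h₃ with ⟨h₃, h₄⟩ | ⟨h₃, u, hu, v, hv, huv⟩
            · refine Or.inl ⟨by simpa using h₃, fun v hv hfv => ?_⟩
              rcases Nat.lt_succ_iff_lt_or_eq.mp hv with hv | rfl
              exacts [by simpa using h₄ v hv hfv, absurd c₁ hfv]
            · exact Or.inr ⟨by simpa using h₃, u, by omega, v, by omega, huv⟩
        · rcases h with ⟨h₁, h₂, h₃⟩ | ⟨h₁, h₂, h₃⟩
          · simp only [c₁, h₁, if_false, lt_irrefl, if_true, State.setReg_reg]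
            refine Or.inr ⟨by simp [hsj], by simpa [hsj] using c₁,
              Or.inl ⟨by simpa using h₂, fun v hv hfv => ?_⟩⟩
            rcases Nat.lt_succ_iff_lt_or_eq.mp hv with hv | rfl
            exacts [absurd (h₃ v hv) hfv, by simp [hsj]]
          · have h₁' : s'.reg 3 < n := by omega
            simp only [c₁, h₁', hrow _ h₁', if_false, if_true, one_ne_zero]
            by_cases c₂ : row (s'.reg 3) = row j
            · simp only [c₂, if_true, if_false, one_ne_zero, State.setReg_reg]
              refine Or.inr ⟨by simp [hsj], by simpa [hsj] using c₁, ?_⟩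
              rcases h₃ with ⟨h₃, h₄⟩ | ⟨h₃, u, hu, v, hv, huv⟩
              · refine Or.inl ⟨by simpa using h₃, fun v hv hfv => ?_⟩
                rcases Nat.lt_succ_iff_lt_or_eq.mp hv with hv | rfl
                exacts [by simpa [c₂, hsj] using h₄ v hv hfv, by simp [hsj]]
              · exact Or.inr ⟨by simpa using h₃, u, by omega, v, by omega, huv⟩
            · simp only [c₂, if_true, if_false, State.setReg_reg]
              exact Or.inr ⟨by simp [hsj], by simpa [hsj] using c₁,
                Or.inr ⟨by simp, s'.reg 3, by omega, j, by omega, h₂, c₁, c₂⟩⟩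
    · intro s' f' h
      rcases h with ⟨h₁, h₂, h₃⟩ | ⟨h₁, h₂, h₃⟩
      · refine ⟨?_, fun ⟨v, hv, hfv⟩ => absurd (h₃ v hv) hfv⟩
        rw [h₂, eq_comm, nonconst_eq_zero]
        exact fun u hu v hv hfu => absurd (h₃ u hu) hfu
      · refine ⟨?_, fun _ => ⟨h₁, h₂⟩⟩
        rcases h₃ with ⟨h₃, h₄⟩ | ⟨h₃, h₄⟩
        · rw [h₃, eq_comm, nonconst_eq_zero]
          exact fun u hu v hv hfu hfv => (h₄ u hu hfu).trans (h₄ v hv hfv).symm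
        · rw [h₃, nonconst, if_pos h₄]
  · simp only [Prog.cost, Expr.cost]
    ring_nf
    omega

/-- Merge the classes of all vertices in a row of the matrix. -/
def mergeEdge : Prog :=
  forLoop 5 (reg 0)
    (ite (get 0 (add (reg 6) (reg 5)))
      ((set 9 (get 2 (reg 5)) ;; set 10 (get 2 (reg 3))) ;;
      forLoop 11 (reg 0)
        (ite (eq (get 2 (reg 11)) (reg 9)) (put 2 (reg 11) (reg 10)) skip))
      skip)

theorem mergeEdge_runs {s : State} {n q : ℕ} {f : ℕ → ℕ} {good : (ℕ → ℕ) → Prop}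
    (hn : s.reg 0 = n) (hq : s.reg 6 = q) (hf : ∀ v < n, s.mem 0 (q + v) = f v)
    (hr : (∃ v < n, f v ≠ 0) → s.reg 3 < n ∧ f (s.reg 3) ≠ 0)
    (hgood : ∀ φ, good φ → ∀ u < n, ∀ v < n, f u ≠ 0 → f v ≠ 0 → φ u = φ v)
    (hlab : IsRepresentative n good (s.mem 2)) :
    Runs mergeEdge s (100 * ((n + 1) * (n + 1))) fun s' =>
      IsRepresentative n good (s'.mem 2) ∧
      (∀ u < n, ∀ v < n, s.mem 2 u = s.mem 2 v → s'.mem 2 u = s'.mem 2 v) ∧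
      ∀ u < n, ∀ v < n, f u ≠ 0 → f v ≠ 0 → s'.mem 2 u = s'.mem 2 v := by
  apply Runs.mono
  · unfold mergeEdge
    apply Runs.imp
    · apply Runs.forLoop n (fun j s' => IsRepresentative n good (s'.mem 2) ∧
        (∀ u < n, ∀ v < n, s.mem 2 u = s.mem 2 v → s'.mem 2 u = s'.mem 2 v) ∧
        ∀ u < j, f u ≠ 0 → s'.mem 2 u = s'.mem 2 (s.reg 3)) (by decide)
      · exact ⟨hlab, by simp, by simp⟩
      · intro i s' f' _
        rw [Expr.eval, f'.reg 0 (by decide), hn]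
      · rintro j s' hj hsj f' ⟨h₁, h₂, h₃⟩
        have e₀ : s'.reg 0 = n := by rw [f'.reg 0 (by decide), hn]
        have hb : (get 0 (add (reg 6) (reg 5))).eval s' = f j := by
          rw [Expr.eval, f'.mem 0 (by decide)]
          simp only [Expr.eval, hsj, f'.reg 6 (by decide), hq, hf j hj]
        apply Runs.ite (B := n * 100 + 100)
        · intro hfj
          rw [hb] at hfj
          obtain ⟨hr₁, hr₂⟩ := hr ⟨j, hj, hfj⟩
          apply Runs.mono
          · apply Runs.seq
              (Mid := fun t => t = (s'.setReg 9 (s'.mem 2 j)).setReg 10 (s'.mem 2 (s.reg 3)))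
            · apply Runs.of_simple (by decide)
              simp [Prog.eval, Expr.eval, hsj, f'.reg 3 (by decide)]
            intro t g ht
            apply Runs.imp
            -- The old and the new label are held in registers 9 and 10, because the pass overwrites
            -- the array from which they were read.
            · apply Runs.forLoop n (fun i t' => ∀ w, t'.mem 2 w =
                if w < i ∧ s'.mem 2 w = s'.mem 2 j then s'.mem 2 (s.reg 3) else s'.mem 2 w)
                (by decide)
              · simp [ht]
              · intro i s' f' _
                rw [Expr.eval, f'.reg 0 (by decide), g.reg 0 (by decide), e₀]
              · intro i t' hi hti g' h
                have e₉ : t'.reg 9 = s'.mem 2 j := by rw [g'.reg 9 (by decide), ht]; simp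
                have e₁₀ : t'.reg 10 = s'.mem 2 (s.reg 3) := by
                  rw [g'.reg 10 (by decide), ht]; simp
                have ei : t'.mem 2 i = s'.mem 2 i := by rw [h, if_neg (by omega)]
                apply Runs.of_simple (by decide)
                simp only [Prog.eval, Expr.eval, hti, e₉, e₁₀, ei, State.setReg_mem]
                intro w
                by_cases c : s'.mem 2 i = s'.mem 2 j
                · simp only [c, if_true, one_ne_zero, if_false, State.setMem_mem, true_and]
                  by_cases hw : w = i
                  · subst hw
                    simp [c]
                  · rw [if_neg hw, h]
                    have : w < i ↔ w < i + 1 := by omega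
                    simp only [this]
                · simp only [c, if_true, if_false]
                  rw [h]
                  by_cases hw : w = i
                  · subst hw
                    simp [c]
                  · have : w < i ↔ w < i + 1 := by omega
                    simp only [this]
            · intro t' g' h
              have h' : ∀ w < n, t'.mem 2 w =
                  if s'.mem 2 w = s'.mem 2 j then s'.mem 2 (s.reg 3) else s'.mem 2 w :=
                fun w hw => by
                  rw [h w]
                  simp [hw]
              have hmono : ∀ u < n, ∀ v < n, s'.mem 2 u = s'.mem 2 v → t'.mem 2 u = t'.mem 2 v :=
                fun u hu v hv huv => by rw [h' u hu, h' v hv, huv]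
              refine ⟨h₁.merge hj hr₁ (fun φ hφ => hgood φ hφ j hj _ hr₁ hfj hr₂) h',
                fun u hu v hv huv => hmono u hu v hv (h₂ u hu v hv huv), fun u hu hfu => ?_⟩
              rcases Nat.lt_succ_iff_lt_or_eq.mp hu with hu | rfl
              · exact hmono u (by omega) _ hr₁ (h₃ u hu hfu)
              · rw [State.setReg_mem, h' u hj, h' _ hr₁, if_pos rfl]
                split_ifs <;> rfl
          · simp only [Prog.cost, Expr.cost]
            ring_nf
            omega
        · intro hfj
          rw [hb] at hfj
          refine Runs.mono (B := Prog.cost skip) (Runs.of_simple (by decide) ?_)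
            (by simp [Prog.cost])
          refine ⟨h₁, h₂, fun u hu hfu => ?_⟩
          rcases Nat.lt_succ_iff_lt_or_eq.mp hu with hu | rfl
          exacts [h₃ u hu hfu, absurd hfj hfu]
    · rintro s' f' ⟨h₁, h₂, h₃⟩
      exact ⟨h₁, h₂, fun u hu v hv hfu hfv => (h₃ u hu hfu).trans (h₃ v hv hfv).symm⟩
  · simp only [Expr.cost]
    ring_nf
    omega

/-- The number with the given binary digits, the last one being the least significant. -/
def binary (f : ℕ → ℕ) : ℕ → ℕ
  | 0 => 0
  | e + 1 => binary f e + binary f e + f e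

/-- Input as for `contract`. The output consists of the number of classes of the vertices if the
vertices of a row of the matrix are equivalent whenever the labels are constant on the row, of the
binary code of the set of the other rows, and of this set. -/
def evaluate : Prog :=
  (set 0 (get 0 (lit 1)) ;; set 1 (get 0 (lit 2))) ;;
  forLoop 5 (reg 0) (put 2 (reg 5) (reg 5)) ;;
  (set 6 (add (lit 4) (reg 0)) ;; set 7 (lit 0)) ;;
  forLoop 8 (reg 1)
    (scanEdge ;;
    (set 7 (add (add (reg 7) (reg 7)) (reg 4))) ;;
    ite (reg 4) (push 3 (reg 8)) mergeEdge ;;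
    set 6 (add (reg 6) (reg 0))) ;;
  (set 9 (lit 0)) ;;
  forLoop 5 (reg 0)
    (ite (eq (get 2 (reg 5)) (reg 5)) (set 9 (add (reg 9) (lit 1))) skip) ;;
  (push 1 (reg 9) ;; push 1 (reg 7) ;; push 1 (get 3 (lit 0))) ;;
  appendDrop 5 1 3 0

/-- A function that is constant on all rows of the matrix on which the labels are constant. -/
def IsCompatible (n m : ℕ) (row : ℕ → ℕ) (X : ℕ → ℕ → ℕ) (φ : ℕ → ℕ) : Prop :=
  ∀ e < m, nonconst n row (X e) = 0 → ∀ u < n, ∀ v < n, X e u ≠ 0 → X e v ≠ 0 → φ u = φ v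

/-- The output of `evaluate`. -/
def IsEvaluation (n m : ℕ) (row : ℕ → ℕ) (X : ℕ → ℕ → ℕ) (o : List ℕ) : Prop :=
  ∃ lab, IsRepresentative n (IsCompatible n m row X) lab ∧ IsCompatible n m row X lab ∧
    o = (support n fun v => if lab v = v then 1 else 0).length ::
      binary (fun e => nonconst n row (X e)) m ::
      withLength (support m fun e => nonconst n row (X e))

-- The quadratic factor comes from relabeling: a hyperedge causes at most `n` merges, and each is a
-- pass over all vertices.
set_option maxHeartbeats 1000000 in
theorem evaluate_runs {w : List ℕ} {n m thr : ℕ} {row : ℕ → ℕ} {X : ℕ → ℕ → ℕ}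
    (hw : IsLabeledMatrix n m thr row X w) :
    Runs evaluate (State.ofInput w) (10000 * ((n + 1) * (n + 1) * (m + 1))) fun s =>
      IsEvaluation n m row X s.output := by
  set s₀ := State.ofInput w with hs₀
  have hn₀ : s₀.mem 0 1 = n := by simp [hs₀, ← hw.n_eq]
  have hm₀ : s₀.mem 0 2 = m := by simp [hs₀, ← hw.m_eq]
  have hrow₀ : ∀ v < n, s₀.mem 0 (4 + v) = row v := fun v hv => by
    rw [show 4 + v = 3 + v + 1 by omega, hs₀, State.ofInput_mem_succ, hw.row_eq v hv]
  have hX₀ : ∀ e < m, ∀ v < n, s₀.mem 0 (4 + n + e * n + v) = X e v := fun e he v hv => by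
    rw [show 4 + n + e * n + v = 3 + n + (e * n + v) + 1 by omega, hs₀, State.ofInput_mem_succ,
      hw.entry e he v hv]
  have h₁ : s₀.readList 1 = [] := State.readList_eq_nil _ _ (by simp [hs₀])
  have h₃ : s₀.readList 3 = [] := State.readList_eq_nil _ _ (by simp [hs₀])
  clear_value s₀
  set fl := fun e => nonconst n row (X e) with hfl
  set good := IsCompatible n m row X with hgood
  apply Runs.mono
  · unfold evaluate
    apply Runs.seq (Mid := fun s => s.reg 0 = n ∧ s.reg 1 = m)
    · apply Runs.of_simple (by decide)
      simp [Prog.eval, Expr.eval, hn₀, hm₀]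
    rintro s₁ f₁ ⟨hn₁, hm₁⟩
    apply Runs.seq (Mid := fun s => ∀ v < n, s.mem 2 v = v)
    · apply Runs.forLoop n (fun j s => ∀ v < j, s.mem 2 v = v) (by decide)
      · simp
      · intro i s f _
        rw [Expr.eval, f.reg 0 (by decide), hn₁]
      · intro j s hj hsj f h
        apply Runs.of_simple (by decide)
        simp only [Prog.eval, Expr.eval, State.setReg_mem, State.setMem_mem, hsj, true_and]
        intro v hv
        split_ifs with hvj
        exacts [hvj.symm, h v (by omega)]
    intro s₂ f₂ h₂
    apply Runs.seq (Mid := fun s => s = (s₂.setReg 6 (4 + n)).setReg 7 0)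
    · apply Runs.of_simple (by decide)
      simp [Prog.eval, Expr.eval, f₂.reg 0 (by decide), hn₁]
    intro s₃ f₃ hs₃
    have hn₃ : s₃.reg 0 = n ∧ s₃.reg 1 = m := by
      rw [f₃.reg 0 (by decide), f₃.reg 1 (by decide), f₂.reg 0 (by decide), f₂.reg 1 (by decide)]
      exact ⟨hn₁, hm₁⟩
    have hm₃ : s₃.mem 0 = s₀.mem 0 := by
      rw [f₃.mem 0 (by decide), f₂.mem 0 (by decide), f₁.mem 0 (by decide)]
    apply Runs.seq (Mid := fun s => s.reg 7 = binary fl m ∧ s.readList 3 = support m fl ∧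
      IsRepresentative n good (s.mem 2) ∧ good (s.mem 2))
    · apply Runs.imp
      · apply Runs.forLoop m (fun j s => s.reg 6 = 4 + n + j * n ∧ s.reg 7 = binary fl j ∧
          s.readList 3 = support j fl ∧ IsRepresentative n good (s.mem 2) ∧
          ∀ e < j, fl e = 0 → ∀ u < n, ∀ v < n, X e u ≠ 0 → X e v ≠ 0 → s.mem 2 u = s.mem 2 v)
          (by decide)
        · refine ⟨by simp [hs₃], by simp [hs₃, binary], ?_, ?_, by simp⟩
          · simp [f₃.readList 3 (by decide), f₂.readList 3 (by decide), f₁.readList 3 (by decide),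
              h₃, support]
          · rw [State.setReg_mem, f₃.mem 2 (by decide)]
            refine ⟨fun v hv => by rwa [h₂ v hv], fun v hv => by rw [h₂ v hv, h₂ v hv],
              fun φ _ v hv => by rw [h₂ v hv]⟩
        · intro i s f _
          rw [Expr.eval, f.reg 1 (by decide), hn₃.2]
        · rintro e s he hse f ⟨h6, h7, hl, hrep, hcomp⟩
          have hns : s.reg 0 = n := by rw [f.reg 0 (by decide), hn₃.1]
          have hms : s.mem 0 = s₀.mem 0 := by rw [f.mem 0 (by decide), hm₃]
          apply Runs.seq
          · apply scanEdge_runs (n := n) (q := 4 + n + e * n) (row := row) (f := X e) hns h6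
            · exact fun v hv => by rw [hms, hrow₀ v hv]
            · exact fun v hv => by rw [hms, hX₀ e he v hv]
          rintro t g ⟨h4t, h3t⟩
          apply Runs.seq (Mid := fun s' => s' = t.setReg 7 (binary fl (e + 1)))
          · apply Runs.of_simple (by decide)
            simp [Prog.eval, Expr.eval, h4t, g.reg 7 (by decide), h7, binary, hfl]
          intro t' g' ht'
          have h4t' : (reg 4).eval t' = fl e := by rw [Expr.eval, g'.reg 4 (by decide), h4t]
          apply Runs.seq (Mid := fun s' => s'.readList 3 = support (e + 1) fl ∧
            IsRepresentative n good (s'.mem 2) ∧ ∀ e' < e + 1, fl e' = 0 →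
              ∀ u < n, ∀ v < n, X e' u ≠ 0 → X e' v ≠ 0 → s'.mem 2 u = s'.mem 2 v)
          · have hl' : t'.readList 3 = support e fl := by
              rw [g'.readList 3 (by decide), g.readList 3 (by decide), hl]
            have hm' : t'.mem 2 = s.mem 2 := by rw [g'.mem 2 (by decide), g.mem 2 (by decide)]
            apply Runs.ite (B := 100 * ((n + 1) * (n + 1)))
            · intro hb
              rw [h4t'] at hb
              have h8 : t'.reg 8 = e := by rw [g'.reg 8 (by decide), g.reg 8 (by decide), hse]
              refine Runs.mono (B := Prog.cost (push 3 (reg 8)))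
                (Runs.of_simple (by decide) ?_) (by
                  simp only [Prog.push_cost, Expr.cost]
                  ring_nf
                  omega)
              rw [Prog.push_eval]
              simp only [State.append_readList, hl', support_succ, if_neg hb, Expr.eval, h8,
                true_and]
              have hm'' : (t'.append 3 e).mem 2 = s.mem 2 := by
                rw [← hm']
                ext j
                simp
              rw [hm'']
              refine ⟨hrep, fun e' he' hfe' => ?_⟩
              rcases Nat.lt_succ_iff_lt_or_eq.mp he' with he' | rfl
              exacts [hcomp e' he' hfe', absurd hfe' hb]
            · intro hb
              rw [h4t'] at hb
              apply Runs.imp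
              · apply mergeEdge_runs (n := n) (q := 4 + n + e * n) (f := X e) (good := good)
                · rw [g'.reg 0 (by decide), g.reg 0 (by decide), hns]
                · rw [g'.reg 6 (by decide), g.reg 6 (by decide), h6]
                · exact fun v hv => by
                    rw [g'.mem 0 (by decide), g.mem 0 (by decide), hms, hX₀ e he v hv]
                · rwa [g'.reg 3 (by decide)]
                · exact fun φ hφ => hφ e he hb
                · rwa [hm']
              · rintro r hr ⟨hrep', hmono, hnew⟩
                refine ⟨?_, hrep', fun e' he' hfe' => ?_⟩
                · rw [hr.readList 3 (by decide), hl', support_succ, if_pos hb, List.append_nil]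
                · rcases Nat.lt_succ_iff_lt_or_eq.mp he' with he' | rfl
                  · intro u hu v hv h h'
                    refine hmono u hu v hv ?_
                    rw [hm']
                    exact hcomp e' he' hfe' u hu v hv h h'
                  · exact hnew
          rintro r hr ⟨hlr, hrepr, hcompr⟩
          apply Runs.of_simple (by decide)
          simp only [Prog.eval, Expr.eval, State.setReg_reg, State.setReg_mem,
            State.setReg_readList]
          refine ⟨?_, ?_, hlr, hrepr, hcompr⟩
          · simp [hr.reg 6 (by decide), hr.reg 0 (by decide), ht', g.reg 6 (by decide),
              g.reg 0 (by decide), h6, hns]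
            ring
          · simp [hr.reg 7 (by decide), ht']
      · rintro s f ⟨-, h⟩
        exact h
    rintro s₄ f₄ ⟨h7₄, hl₄, hrep₄, hcomp₄⟩
    apply Runs.seq (Mid := fun s => s = s₄.setReg 9 0)
    · apply Runs.of_simple (by decide)
      simp [Prog.eval, Expr.eval]
    intro s₅ f₅ hs₅
    -- The representatives are the fixed points of the labeling, so counting these counts classes.
    apply Runs.seq (Mid := fun s =>
      s.reg 9 = (support n fun v => if s₄.mem 2 v = v then 1 else 0).length)
    · apply Runs.forLoop n (fun j s =>
        s.reg 9 = (support j fun v => if s₄.mem 2 v = v then 1 else 0).length) (by decide)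
      · simp [hs₅, support]
      · intro i s f _
        rw [Expr.eval, f.reg 0 (by decide), f₅.reg 0 (by decide), f₄.reg 0 (by decide), hn₃.1]
      · intro j s hj hsj f h
        apply Runs.of_simple (by decide)
        simp only [Prog.eval, Expr.eval, f.mem 2 (by decide), f₅.mem 2 (by decide), hsj, h,
          support_succ]
        by_cases hc : s₄.mem 2 j = j <;> simp [hc, h]
    intro s₆ f₆ h9₆
    have hl₆ : s₆.readList 3 = support m fl := by
      rw [f₆.readList 3 (by decide), f₅.readList 3 (by decide), hl₄]
    have hc₆ : s₆.mem 3 0 = (support m fl).length := by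
      rw [← hl₆, State.readList_length]
    apply Runs.seq (Mid := fun s => s.readList 1 = [s₆.reg 9, binary fl m, (support m fl).length])
    · apply Runs.of_simple (by decide)
      simp [Prog.eval, Prog.push_eval, Expr.eval, hc₆, f₆.readList 1 (by decide),
        f₅.readList 1 (by decide), f₄.readList 1 (by decide), f₃.readList 1 (by decide),
        f₂.readList 1 (by decide), f₁.readList 1 (by decide), h₁, f₆.reg 7 (by decide),
        f₅.reg 7 (by decide), h7₄]
    intro s₇ f₇ h₇
    have hl₇ : s₇.readList 3 = support m fl := by rw [f₇.readList 3 (by decide), hl₆]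
    apply Runs.imp
    · apply Prog.appendDrop_runs (N := m) (by decide)
      rw [hl₇]
      exact support_length_le _ _
    · intro s f h
      refine ⟨s₄.mem 2, hrep₄, hcomp₄, ?_⟩
      rw [State.output, h, h₇, hl₇, h9₆]
      rfl
  · simp only [Prog.cost, Expr.cost, Prog.push_cost]
    ring_nf
    omega

end Ram

/-! ### Lists and hypergraphs -/

theorem List.map_val_finRange' (n : ℕ) : (List.finRange n).map Fin.val = List.range n := by
  simp

section Encode

variable {n : ℕ}

theorem encodeFinset_eq_support {A : Finset (Fin n)} {f : ℕ → ℕ}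
    (hf : ∀ v : Fin n, f v ≠ 0 ↔ v ∈ A) : encodeFinset A = Ram.support n f := by
  rw [Ram.support, ← List.map_val_finRange', List.filter_map, encodeFinset]
  congr 1
  refine List.filter_congr fun v _ => ?_
  simp only [Function.comp, hf v]

theorem mem_encodeFinset {A : Finset (Fin n)} {v : Fin n} : v.val ∈ encodeFinset A ↔ v ∈ A := by
  simp [encodeFinset, Fin.val_inj]

theorem lt_of_mem_encodeFinset {A : Finset (Fin n)} {v : ℕ} (h : v ∈ encodeFinset A) : v < n := by
  simp only [encodeFinset, List.mem_map] at h
  obtain ⟨u, -, rfl⟩ := h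
  exact u.2

theorem encodeFinset_length (A : Finset (Fin n)) : (encodeFinset A).length = A.card := by
  rw [encodeFinset, List.length_map,
    ← List.toFinset_card_of_nodup ((List.nodup_finRange n).filter _)]
  congr 1
  ext v
  simp

theorem encodeFinset_singleton (v : Fin n) : encodeFinset {v} = [v.val] := by
  have h : (List.finRange n).filter (fun u => u ∈ ({v} : Finset (Fin n))) = [v] := by
    rw [← List.perm_singleton]
    refine (List.perm_ext_iff_of_nodup ((List.nodup_finRange n).filter _)
      (List.nodup_singleton v)).mpr fun u => ?_
    simp
  rw [encodeFinset, h, List.map_singleton]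

end Encode

namespace MultiHypergraph

variable {n m : ℕ}

/-- The hypergraph with the given list of hyperedges. -/
def ofList (L : List (Finset (Fin n))) : MultiHypergraph (Fin n) (Fin L.length) where
  edge i := L[i]

theorem encode_ofList (L : List (Finset (Fin n))) : (ofList L).encode = n :: encodeSetList L := by
  have : (List.finRange L.length).map (ofList L).edge = L := by
    refine List.ext_getElem (by simp) fun i h₁ h₂ => ?_
    simp [ofList]
  rw [encode, this]

theorem size_ofList (L : List (Finset (Fin n))) : (ofList L).size = (L.map Finset.card).sum :=
  Fin.sum_univ_fun_getElem L Finset.card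

open Classical in
/-- One if the hyperedge meets both `U` and its complement, zero otherwise. -/
noncomputable def crosses (U e : Finset (Fin n)) : ℕ :=
  if (∃ u ∈ e, u ∈ U) ∧ ∃ v ∈ e, v ∉ U then 1 else 0

theorem card_cut_eq_sum (G : MultiHypergraph (Fin n) (Fin m)) (U : Finset (Fin n)) :
    (G.cut U).card = ((List.finRange m).map fun e => crosses U (G.edge e)).sum := by
  rw [← List.ofFn_eq_map, List.sum_ofFn, cut, Finset.card_filter]
  refine Finset.sum_congr rfl fun e _ => ?_
  rw [crosses]
  congr 1

theorem card_cut_ofList (L : List (Finset (Fin n))) (U : Finset (Fin n)) :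
    ((ofList L).cut U).card = (L.map (crosses U)).sum := by
  rw [cut, Finset.card_filter, ← Fin.sum_univ_fun_getElem]
  refine Finset.sum_congr rfl fun e _ => ?_
  rw [crosses]
  congr 1

/-! ### Contracting terminals -/

/-- Contract `S` to `s` and `T` to `t`. -/
def contractMap (S T : Finset (Fin n)) (s t v : Fin n) : Fin n :=
  if v ∈ S then s else if v ∈ T then t else v

/-- The hyperedges after the contraction, and some further singletons. -/
def contractEdges (G : MultiHypergraph (Fin n) (Fin m)) (S T : Finset (Fin n)) (s t : Fin n)
    (pad : ℕ) : List (Finset (Fin n)) :=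
  ((List.finRange m).map fun e => (G.edge e).image (contractMap S T s t)) ++
    List.replicate pad {s}

theorem crosses_image (π : Fin n → Fin n) (U e : Finset (Fin n)) :
    crosses U (e.image π) = crosses (Finset.univ.filter fun v => π v ∈ U) e := by
  simp [crosses]

theorem card_cut_contractEdges (G : MultiHypergraph (Fin n) (Fin m)) (S T : Finset (Fin n))
    (s t : Fin n) (pad : ℕ) (U : Finset (Fin n)) :
    ((ofList (G.contractEdges S T s t pad)).cut U).card =
      (G.cut (Finset.univ.filter fun v => contractMap S T s t v ∈ U)).card := by
  have h0 : crosses U {s} = 0 := by simp [crosses]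
  rw [card_cut_ofList, card_cut_eq_sum, contractEdges, List.map_append, List.sum_append,
    List.map_replicate, h0, List.map_map]
  simp only [List.sum_replicate, smul_zero, add_zero]
  congr 1
  refine List.map_congr_left fun e _ => ?_
  exact crosses_image _ _ _

/-- A set separating `S` from `T` is its own preimage under the contraction, and preimages preserve
cut sizes. So minimum cuts correspond in both directions. -/
theorem isSourceMinimalCut_of_contractEdges {G : MultiHypergraph (Fin n) (Fin m)}
    {S T U : Finset (Fin n)} {s t : Fin n} {pad : ℕ} (hST : Disjoint S T) (hs : s ∈ S) (ht : t ∈ T)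
    (hU : (ofList (G.contractEdges S T s t pad)).IsSourceMinimalCut {s} {t} U) :
    G.IsSourceMinimalCut S T (Finset.univ.filter fun v => contractMap S T s t v ∈ U) := by
  set π := contractMap S T s t with hπ
  have hcard := G.card_cut_contractEdges S T s t pad
  rw [← hπ] at hcard
  have hTS : ∀ v ∈ T, v ∉ S := fun v hv hvS => Finset.disjoint_left.mp hST hvS hv
  have hterm : ∀ X, IsTerminalCut S T X →
      IsTerminalCut {s} {t} X ∧ (Finset.univ.filter fun v => π v ∈ X) = X := by
    intro X hX
    have htX : ∀ v ∈ T, v ∉ X := fun v hv hvX => Finset.disjoint_left.mp hX.2 hvX hv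
    refine ⟨⟨by simpa using hX.1 hs, by simpa using htX t ht⟩, ?_⟩
    ext v
    simp only [Finset.mem_filter, Finset.mem_univ, true_and, hπ, contractMap]
    split_ifs with h₁ h₂
    · exact ⟨fun _ => hX.1 h₁, fun _ => hX.1 hs⟩
    · exact ⟨fun h => absurd h (htX t ht), fun h => absurd h (htX v h₂)⟩
    · rfl
  have hsU : s ∈ U := by simpa using hU.1.1.1
  have htU : t ∉ U := by simpa using hU.1.1.2
  refine ⟨⟨⟨fun v hv => ?_, ?_⟩, fun X hX => ?_⟩, ?_⟩
  · simpa [hπ, contractMap, hv] using hsU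
  · rw [Finset.disjoint_left]
    intro v hv hvT
    simp [hπ, contractMap, hvT, hTS v hvT, htU] at hv
  · rw [← hcard]
    refine (hU.1.2 X (hterm X hX).1).trans_eq ?_
    rw [hcard, (hterm X hX).2]
  · intro Y hY hYU
    obtain ⟨hY₁, hY₂⟩ := hterm Y hY.1
    -- The set `Y` contains all of `S`, but `U` need only contain `s`. Passing to `Y ∩ U` makes the
    -- minimality of `U` applicable and does not change the preimage.
    have hpre : (Finset.univ.filter fun v => π v ∈ Y ∩ U) = Y := by
      ext v
      have h₁ := Finset.ext_iff.mp hY₂ v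
      have h₂ := @hYU v
      simp only [Finset.mem_filter, Finset.mem_univ, true_and, Finset.mem_inter] at h₁ h₂ ⊢
      constructor
      · exact fun h => h₁.mp h.1
      · exact fun h => ⟨h₁.mpr h, by simpa using h₂ h⟩
    have hmin : (ofList (G.contractEdges S T s t pad)).IsMinTerminalCut {s} {t} (Y ∩ U) := by
      refine ⟨⟨by simpa [hsU] using hY₁.1, by simp [htU]⟩, fun X hX => ?_⟩
      rw [hcard, hpre]
      refine (hY.2 _ ⟨fun v hv => ?_, ?_⟩).trans_eq (hcard X).symm
      · simpa [hπ, contractMap, hv] using hX.1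
      · rw [Finset.disjoint_left]
        intro v hv hvT
        have : t ∉ X := by simpa using hX.2
        simp [hπ, contractMap, hvT, hTS v hvT, this] at hv
    have hle : U ⊆ Y ∩ U := hU.2 hmin Finset.inter_subset_right
    intro v hv
    rw [← hY₂]
    simp only [Finset.mem_filter, Finset.mem_univ, true_and] at hv ⊢
    exact (Finset.mem_inter.mp (hle hv)).1

/-- The entry of the incidence matrix for the hyperedge `e` and the vertex `v`. -/
def incidenceEntry (G : MultiHypergraph (Fin n) (Fin m)) (e v : ℕ) : ℕ :=
  if h : e < m ∧ v < n then if ⟨v, h.2⟩ ∈ G.edge ⟨e, h.1⟩ then 1 else 0 else 0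

theorem incidenceEntry_ne_zero {G : MultiHypergraph (Fin n) (Fin m)} {e : Fin m} {v : Fin n} :
    G.incidenceEntry e v ≠ 0 ↔ v ∈ G.edge e := by
  simp [incidenceEntry]

theorem support_incidenceEntry_length (G : MultiHypergraph (Fin n) (Fin m)) (e : Fin m) :
    (Ram.support n (G.incidenceEntry e)).length = (G.edge e).card := by
  rw [← encodeFinset_eq_support (A := G.edge e) fun v => incidenceEntry_ne_zero,
    encodeFinset_length]

theorem size_eq_sum (G : MultiHypergraph (Fin n) (Fin m)) :
    ((List.range m).map fun e => (Ram.support n (G.incidenceEntry e)).length).sum = G.size := by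
  rw [← List.map_val_finRange', List.map_map, size, ← List.sum_ofFn, List.ofFn_eq_map]
  congr 1
  exact List.map_congr_left fun e _ => G.support_incidenceEntry_length e

/-- This replaces `m` by `p` in the time bound, and is where empty hyperedges must be excluded. -/
theorem le_size {G : MultiHypergraph (Fin n) (Fin m)} (hG : G.NoEmptyEdge) : m ≤ G.size := by
  have := Finset.card_nsmul_le_sum (Finset.univ : Finset (Fin m)) (fun e => (G.edge e).card) 1
    fun e _ => (hG e).card_pos
  simpa [size] using this

/-- The output of `Ram.contract` encodes a hypergraph with the same number of vertices and the same
size; its source minimal minimum terminal cuts yield those of the original hypergraph. -/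
theorem exists_of_isContraction {G : MultiHypergraph (Fin n) (Fin m)} (hG : G.NoEmptyEdge)
    {S T : Finset (Fin n)} {thr : ℕ} {row : ℕ → ℕ} {o : List ℕ}
    (hS : ∀ v : Fin n, v ∈ S ↔ thr ≤ row v) (hT : ∀ v : Fin n, v ∈ T ↔ 0 < row v ∧ row v < thr)
    (hSne : S.Nonempty) (hTne : T.Nonempty)
    (ho : Ram.IsContraction n m thr row G.incidenceEntry o) :
    ∃ (s t : Fin n) (m' : ℕ) (H : MultiHypergraph (Fin n) (Fin m')),
      s ≠ t ∧ H.NoEmptyEdge ∧ H.size = G.size ∧ o = s.val :: t.val :: H.encode ∧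
      ∀ U, H.IsSourceMinimalCut {s} {t} U →
        G.IsSourceMinimalCut S T (Finset.univ.filter fun v => v ∈ S ∨ v ∉ T ∧ v ∈ U) := by
  obtain ⟨a, ha⟩ := hSne
  obtain ⟨b, hb⟩ := hTne
  obtain ⟨s, hsn, t, htn, pad, hs, ht, ht', hpad, rfl⟩ :=
    ho.eq_contraction ⟨a, a.2, (hS a).mp ha⟩ ⟨b, b.2, (hT b).mp hb⟩
  lift s to Fin n using hsn
  lift t to Fin n using htn
  have hsS : s ∈ S := (hS s).mpr hs
  have htT : t ∈ T := (hT t).mpr ⟨ht, ht'⟩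
  have hST : Disjoint S T := by
    rw [Finset.disjoint_left]
    intro v hv hv'
    have h₁ := (hS v).mp hv
    have h₂ := (hT v).mp hv'
    omega
  have hmap : ∀ v : Fin n, Ram.contraction thr row s t v = contractMap S T s t v := by
    intro v
    have h₁ := hS v
    have h₂ := hT v
    simp only [Ram.contraction, contractMap, h₁, h₂]
    split_ifs <;> first | rfl | omega
  have himg : ∀ e : Fin m,
      Ram.support n (Ram.imageIndicator n (G.incidenceEntry e) (Ram.contraction thr row s t)) =
        encodeFinset ((G.edge e).image (contractMap S T s t)) := by
    intro e
    refine (encodeFinset_eq_support fun v => ?_).symm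
    rw [Ram.imageIndicator_ne_zero, Finset.mem_image]
    constructor
    · rintro ⟨u, hu, hue, huv⟩
      lift u to Fin n using hu
      exact ⟨u, incidenceEntry_ne_zero.mp hue, Fin.val_inj.mp ((hmap u).symm.trans huv)⟩
    · rintro ⟨u, hue, rfl⟩
      exact ⟨u, u.2, incidenceEntry_ne_zero.mpr hue, hmap u⟩
  refine ⟨s, t, _, ofList (G.contractEdges S T s t pad), ?_, ?_, ?_, ?_, fun U hU => ?_⟩
  · rintro rfl
    exact Finset.disjoint_left.mp hST hsS htT
  · intro e
    have : ∀ A ∈ G.contractEdges S T s t pad, A.Nonempty := by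
      intro A hA
      rcases List.mem_append.mp hA with hA | hA
      · obtain ⟨e, -, rfl⟩ := List.mem_map.mp hA
        exact (hG e).image _
      · rw [(List.mem_replicate.mp hA).2]
        exact Finset.singleton_nonempty s
    exact this _ (List.getElem_mem _)
  -- The padding restores the size exactly, so the bound `T n p` applies although `T` need not be
  -- monotone.
  · rw [size_ofList, ← size_eq_sum, ← hpad, ← List.map_val_finRange', List.map_map, contractEdges,
      List.map_append, List.sum_append, List.map_map]
    have : (List.finRange m).map (Finset.card ∘ fun e => (G.edge e).image (contractMap S T s t)) =
        (List.finRange m).map ((fun e => (Ram.support n (Ram.imageIndicator n (G.incidenceEntry e)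
          (Ram.contraction thr row s t))).length) ∘ Fin.val) :=
      List.map_congr_left fun e _ => by
        rw [Function.comp, Function.comp, himg e, encodeFinset_length]
    rw [this]
    simp [add_comm]
  · rw [encode_ofList, encodeSetList, contractEdges, List.flatMap_append, List.length_append,
      List.length_map, List.length_finRange, List.length_replicate, ← List.map_val_finRange',
      List.flatMap_map, List.flatMap_map]
    have h₁ : ((List.finRange m).flatMap fun e : Fin m => Ram.withLength (Ram.support n
        (Ram.imageIndicator n (G.incidenceEntry e.val) (Ram.contraction thr row s t)))) =
        (List.finRange m).flatMap fun e => ((G.edge e).image (contractMap S T s t)).card ::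
          encodeFinset ((G.edge e).image (contractMap S T s t)) := by
      refine congrArg (fun f => List.flatMap f _) (funext fun e => ?_)
      rw [himg e, Ram.withLength, encodeFinset_length]
    have h₂ : (List.replicate pad ({s} : Finset (Fin n))).flatMap
        (fun A => A.card :: encodeFinset A) = (List.replicate pad [1, s.val]).flatten := by
      rw [List.flatMap_def, List.map_replicate, encodeFinset_singleton, Finset.card_singleton]
    rw [h₁, h₂]
    rfl
  · have := isSourceMinimalCut_of_contractEdges hST hsS htT hU
    convert this using 3 with v
    simp only [contractMap]
    have hsU : s ∈ U := by simpa using hU.1.1.1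
    have htU : t ∉ U := by simpa using hU.1.1.2
    split_ifs with h₁ h₂
    · simp [h₁, hsU]
    · simp [h₁, h₂, htU]
    · simp [h₁, h₂]

/-! ### Counting components -/

open Classical in
/-- The hyperedges on which the labels are not constant. -/
noncomputable def nonconstEdges (G : MultiHypergraph (Fin n) (Fin m)) (row : ℕ → ℕ) :
    Finset (Fin m) :=
  Finset.univ.filter fun e => Ram.nonconst n row (G.incidenceEntry e) ≠ 0

theorem mem_nonconstEdges {G : MultiHypergraph (Fin n) (Fin m)} {row : ℕ → ℕ} {e : Fin m} :
    e ∈ G.nonconstEdges row ↔ ∃ u ∈ G.edge e, ∃ v ∈ G.edge e, row u ≠ row v := by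
  simp only [nonconstEdges, Finset.mem_filter, Finset.mem_univ, true_and]
  rw [not_iff_comm, Ram.nonconst_eq_zero]
  push Not
  constructor
  · intro h u hu v hv h₁ h₂
    exact h ⟨u, hu⟩ (incidenceEntry_ne_zero.mp h₁) ⟨v, hv⟩ (incidenceEntry_ne_zero.mp h₂)
  · exact fun h u hu v hv => h u u.2 v v.2 (incidenceEntry_ne_zero.mpr hu)
      (incidenceEntry_ne_zero.mpr hv)

/-- The number of components is the number of representatives. -/
theorem numComponents_eq_of_isRepresentative {G : MultiHypergraph (Fin n) (Fin m)}
    {row lab : ℕ → ℕ}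
    (h₁ : Ram.IsRepresentative n (Ram.IsCompatible n m row G.incidenceEntry) lab)
    (h₂ : Ram.IsCompatible n m row G.incidenceEntry lab) :
    G.numComponents (G.nonconstEdges row) =
      (Ram.support n fun v => if lab v = v then 1 else 0).length := by
  set Γ := G.graphAfterRemoval (G.nonconstEdges row) with hΓ
  have hfin : Finite Γ.ConnectedComponent := Quot.finite _
  have hmono : ∀ e, e ∉ G.nonconstEdges row → ∀ u ∈ G.edge e, ∀ v ∈ G.edge e,
      lab u = lab v := by
    intro e he u hu v hv
    refine h₂ e e.2 ?_ u u.2 v v.2 (incidenceEntry_ne_zero.mpr hu) (incidenceEntry_ne_zero.mpr hv)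
    simpa [nonconstEdges] using he
  let g : Γ.ConnectedComponent → ℕ :=
    Quot.lift (fun v => lab v) fun u v h => eq_of_reachable (f := fun v : Fin n => lab v) hmono h
  -- The function numbering the components is itself compatible, so representatives cannot merge two
  -- components.
  have hreach : ∀ u v : Fin n, lab u = lab v → Γ.connectedComponentMk u = Γ.connectedComponentMk v := by
    intro u v huv
    let c := Finite.equivFin Γ.ConnectedComponent
    let φ : ℕ → ℕ := fun w => if h : w < n then c (Γ.connectedComponentMk ⟨w, h⟩) else 0
    have hφ : ∀ w : Fin n, φ w = c (Γ.connectedComponentMk w) := fun w => by simp [φ]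
    have hcomp : Ram.IsCompatible n m row G.incidenceEntry φ := by
      intro e he hne a ha b hb hae hbe
      lift e to Fin m using he
      lift a to Fin n using ha
      lift b to Fin n using hb
      rw [hφ, hφ, SimpleGraph.ConnectedComponent.eq.mpr (reachable_of_mem_edge (e := e) ?_
        (incidenceEntry_ne_zero.mp hae) (incidenceEntry_ne_zero.mp hbe))]
      simpa [nonconstEdges] using hne
    have h := (h₁.apply_eq φ hcomp u u.2).symm.trans
      ((congrArg φ huv).trans (h₁.apply_eq φ hcomp v v.2))
    rw [hφ, hφ] at h
    exact c.injective (Fin.val_inj.mp h)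
  have hg : Function.Injective g := by
    intro x y
    induction x using Quot.ind with | _ u => ?_
    induction y using Quot.ind with | _ v => ?_
    exact hreach u v
  have hrange : Set.range g = (Ram.support n fun v => if lab v = v then 1 else 0).toFinset := by
    ext x
    simp only [Set.mem_range, List.coe_toFinset, Set.mem_ofPred_eq, Ram.mem_support, ne_eq,
      ite_eq_right_iff, one_ne_zero, imp_false, not_not]
    constructor
    · rintro ⟨y, rfl⟩
      induction y using Quot.ind with | _ v => ?_
      exact ⟨h₁.lt v v.2, h₁.idem v v.2⟩
    · rintro ⟨hx, hx'⟩
      exact ⟨Γ.connectedComponentMk ⟨x, hx⟩, hx'⟩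
  rw [numComponents, ← Nat.card_range_of_injective hg, Nat.card_coe_set_eq, hrange,
    Set.ncard_coe_finset, List.toFinset_card_of_nodup (Ram.support_nodup _ _)]

/-- The binary code of a set of hyperedges. -/
def code (F : Finset (Fin m)) : ℕ := Ram.binary (fun e => if ∃ h : e < m, ⟨e, h⟩ ∈ F then 1 else 0) m

theorem _root_.Ram.binary_inj {f g : ℕ → ℕ} {m : ℕ} (hf : ∀ e, f e ≤ 1) (hg : ∀ e, g e ≤ 1)
    (h : Ram.binary f m = Ram.binary g m) : ∀ e < m, f e = g e := by
  induction m with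
  | zero => intro e he; omega
  | succ m ih =>
    simp only [Ram.binary] at h
    have h₁ := hf m
    have h₂ := hg m
    intro e he
    rcases Nat.lt_succ_iff_lt_or_eq.mp he with he | rfl
    · exact ih (by omega) e he
    · omega

/-- Different sets get different addresses, so one array access detects a duplicate. -/
theorem code_injective : Function.Injective (code (m := m)) := by
  intro F F' h
  ext e
  have := Ram.binary_inj (fun e => by split_ifs <;> simp) (fun e => by split_ifs <;> simp) h e e.2
  by_cases h₁ : e ∈ F <;> by_cases h₂ : e ∈ F' <;> simp_all

theorem eq_of_isEvaluation {G : MultiHypergraph (Fin n) (Fin m)} {row : ℕ → ℕ} {o : List ℕ}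
    (h : Ram.IsEvaluation n m row G.incidenceEntry o) :
    o = G.numComponents (G.nonconstEdges row) :: code (G.nonconstEdges row) ::
      (G.nonconstEdges row).card :: encodeFinset (G.nonconstEdges row) := by
  obtain ⟨lab, h₁, h₂, rfl⟩ := h
  have hF : ∀ e : Fin m, Ram.nonconst n row (G.incidenceEntry e) ≠ 0 ↔ e ∈ G.nonconstEdges row := by
    simp [nonconstEdges]
  have hcode : Ram.binary (fun e => Ram.nonconst n row (G.incidenceEntry e)) m =
      code (G.nonconstEdges row) := by
    have : ∀ j ≤ m, Ram.binary (fun e => Ram.nonconst n row (G.incidenceEntry e)) j =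
        Ram.binary (fun e => if ∃ h : e < m, ⟨e, h⟩ ∈ G.nonconstEdges row then 1 else 0) j := by
      intro j
      induction j with
      | zero => simp [Ram.binary]
      | succ j ih =>
        intro hj
        rw [Ram.binary, Ram.binary, ih (by omega)]
        congr 1
        have hj' := hF ⟨j, hj⟩
        have := Ram.nonconst_le_one n row (G.incidenceEntry j)
        by_cases h : (⟨j, hj⟩ : Fin m) ∈ G.nonconstEdges row
        · rw [if_pos ⟨hj, h⟩]
          have := hj'.mpr h
          simp only at this
          omega
        · rw [if_neg fun ⟨_, h'⟩ => h h']
          by_contra hne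
          exact h (hj'.mp hne)
    exact this m le_rfl
  have hsupp : encodeFinset (G.nonconstEdges row) =
      Ram.support m fun e => Ram.nonconst n row (G.incidenceEntry e) := encodeFinset_eq_support hF
  rw [numComponents_eq_of_isRepresentative h₁ h₂, hcode, Ram.withLength, ← hsupp,
    encodeFinset_length]

end MultiHypergraph

namespace Ram

/-! ### The rows that occur as sums -/

/-- The sum of the rows with the indices in a list, weighted with powers of two. -/
def rowValue (X : ℕ → ℕ → ℕ) : List ℕ → ℕ → ℕ
  | [], _ => 0
  | i :: l, v => rowValue X l v + rowValue X l v + X i v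

theorem treeSize_mono (M : ℕ) : Monotone (treeSize M) := by
  refine monotone_nat_of_le_succ fun j => ?_
  induction j with
  | zero => simp [treeSize]
  | succ j ih =>
    have := Nat.mul_le_mul_right M ih
    simp only [treeSize] at this ⊢
    omega

/-- A list is a path in the tree read from its end: the tail leads to the parent and the head
selects the child. -/
theorem IsRowSums.exists_row {n M r : ℕ} {X : ℕ → ℕ → ℕ} {o : List ℕ} (h : IsRowSums n M r X o)
    {l : List ℕ} (hl : l.length ≤ r) (hM : ∀ i ∈ l, i < M) :
    ∃ a < treeSize M (l.length + 1), ∀ v < n, o.getD (1 + (a * n + v)) 0 = rowValue X l v := by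
  induction l with
  | nil => exact ⟨0, by simp [treeSize], fun v hv => by simpa [rowValue] using h.root v hv⟩
  | cons i l ih =>
    obtain ⟨a, ha, hav⟩ := ih (by simp at hl; omega) fun i hi => hM i (List.mem_cons_of_mem _ hi)
    have hi := hM i (by simp)
    refine ⟨1 + a * M + i, ?_, fun v hv => ?_⟩
    · have := mul_add_lt hi ha
      rw [List.length_cons, treeSize]
      omega
    · rw [h.child a (ha.trans_le (treeSize_mono M (by simpa using hl))) i hi v hv, hav v hv]
      rfl

/-- The head of a list contributes the lowest digit, so an appended list occupies the higher digits.
-/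
theorem rowValue_append (X : ℕ → ℕ → ℕ) (l l' : List ℕ) (v : ℕ) :
    rowValue X (l ++ l') v = 2 ^ l.length * rowValue X l' v + rowValue X l v := by
  induction l with
  | nil => simp [rowValue]
  | cons i l ih =>
    simp only [List.cons_append, rowValue, ih, List.length_cons, pow_succ]
    ring

theorem rowValue_lt {X : ℕ → ℕ → ℕ} {l : List ℕ} {v : ℕ} (h : ∀ i ∈ l, X i v ≤ 1) :
    rowValue X l v < 2 ^ l.length := by
  induction l with
  | nil => simp [rowValue]
  | cons i l ih =>
    have h₁ := ih fun i hi => h i (List.mem_cons_of_mem _ hi)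
    have h₂ := h i (by simp)
    simp only [rowValue, List.length_cons, pow_succ]
    omega

theorem rowValue_pos_iff {X : ℕ → ℕ → ℕ} {l : List ℕ} {v : ℕ} :
    0 < rowValue X l v ↔ ∃ i ∈ l, 0 < X i v := by
  induction l with
  | nil => simp [rowValue]
  | cons i l ih =>
    simp only [rowValue, List.exists_mem_cons_iff, ← ih]
    omega

/-- For entries 0 and 1 the values are binary numbers, and equality is equality of digits. -/
theorem rowValue_eq_iff {X : ℕ → ℕ → ℕ} {l : List ℕ} {u v : ℕ}
    (h : ∀ i ∈ l, X i u ≤ 1 ∧ X i v ≤ 1) :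
    rowValue X l u = rowValue X l v ↔ ∀ i ∈ l, X i u = X i v := by
  induction l with
  | nil => simp [rowValue]
  | cons i l ih =>
    have h₁ := h i (by simp)
    simp only [rowValue, List.forall_mem_cons, ← ih fun i hi => h i (List.mem_cons_of_mem _ hi)]
    omega

end Ram

namespace Ram

open Ram.Expr Ram.Prog

/-! ### Lists of rows -/

theorem getD_flatMap_range (f : ℕ → List ℕ) {m e j : ℕ} (he : e < m) (hj : j < (f e).length) :
    ((List.range m).flatMap f).getD (((List.range e).flatMap f).length + j) 0 =
      (f e).getD j 0 := by
  induction m with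
  | zero => omega
  | succ m ih =>
    rw [List.range_succ, List.flatMap_append]
    rcases Nat.lt_succ_iff_lt_or_eq.mp he with he | rfl
    · have hlt : ((List.range e).flatMap f).length + j < ((List.range m).flatMap f).length := by
        have h₁ : ((List.range (e + 1)).flatMap f).length ≤ ((List.range m).flatMap f).length := by
          obtain ⟨d, rfl⟩ := Nat.exists_eq_add_of_lt he
          rw [show e + d + 1 = e + 1 + d by omega, List.range_add (n := e + 1), List.flatMap_append,
            List.length_append]
          omega
        rw [List.range_succ, List.flatMap_append, List.length_append] at h₁
        simp only [List.flatMap_cons, List.flatMap_nil, List.append_nil] at h₁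
        omega
      rw [List.getD_append _ _ _ _ hlt, ih he]
    · rw [List.getD_append_right _ _ _ _ (by omega)]
      simp

theorem length_flatMap_range {f : ℕ → List ℕ} {m n : ℕ} (h : ∀ e < m, (f e).length = n) :
    ((List.range m).flatMap f).length = m * n := by
  induction m with
  | zero => simp
  | succ m ih =>
    rw [List.range_succ, List.flatMap_append, List.length_append, ih fun e he => h e (by omega)]
    simp [h m (by omega), add_mul]

/-- The list of the rows of an `m × n` matrix. -/
def rows (m n : ℕ) (ρ : ℕ → ℕ → ℕ) : List ℕ :=
  (List.range m).flatMap fun a => (List.range n).map (ρ a)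

theorem rows_succ (m n : ℕ) (ρ : ℕ → ℕ → ℕ) :
    rows (m + 1) n ρ = rows m n ρ ++ (List.range n).map (ρ m) := by
  simp [rows, List.range_succ]

theorem rows_length (m n : ℕ) (ρ : ℕ → ℕ → ℕ) : (rows m n ρ).length = m * n :=
  length_flatMap_range fun _ _ => by simp

theorem rows_getD {m n a v : ℕ} (ρ : ℕ → ℕ → ℕ) (ha : a < m) (hv : v < n) :
    (rows m n ρ).getD (a * n + v) 0 = ρ a v := by
  have h := getD_flatMap_range (fun a => (List.range n).map (ρ a)) ha (j := v) (by simpa using hv)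
  rw [length_flatMap_range (n := n) fun _ _ => by simp] at h
  rw [rows, h]
  simp [hv]

theorem rows_congr {m n : ℕ} {ρ ρ' : ℕ → ℕ → ℕ} (h : ∀ a < m, ∀ v < n, ρ a v = ρ' a v) :
    rows m n ρ = rows m n ρ' := by
  induction m with
  | zero => rfl
  | succ m ih =>
    rw [rows_succ, rows_succ, ih fun a ha => h a (by omega)]
    congr 1
    exact List.map_congr_left fun v hv => h m (by omega) v (List.mem_range.mp hv)

/-! ### Loading the labels -/

theorem IsLabeledMatrix.set {n m thr v x : ℕ} {row : ℕ → ℕ} {X : ℕ → ℕ → ℕ} {w : List ℕ}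
    (h : IsLabeledMatrix n m thr row X w) (hv : v < n) :
    IsLabeledMatrix n m thr (Function.update row v x) X (w.set (3 + v) x) := by
  have hget : ∀ i, i ≠ 3 + v → (w.set (3 + v) x).getD i 0 = w.getD i 0 := fun i hi => by
    simp [List.getD, List.getElem?_set_ne hi.symm]
  refine ⟨by rw [List.length_set, h.length], ?_, ?_, ?_, fun u hu => ?_, fun e he u hu => ?_⟩
  · rw [hget _ (by omega), h.n_eq]
  · rw [hget _ (by omega), h.m_eq]
  · rw [hget _ (by omega), h.thr_eq]
  · by_cases huv : u = v
    · subst huv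
      have : 3 + u < w.length := by rw [h.length]; omega
      simp [List.getD, this]
    · rw [hget _ (by omega), h.row_eq u hu, Function.update_of_ne huv]
  · rw [hget _ (by omega), h.entry e he u hu]

/-- Copy the row that starts at cell `reg 7` of array `b` to the labels in array `5`. -/
def loadRow (b : ℕ) : Prog :=
  forLoop 6 (reg 1)
    (put 5 (add (lit 4) (reg 6)) (get b (reg 7)) ;; set 7 (add (reg 7) (lit 1)))

theorem loadRow_runs {s : State} {n m thr q b : ℕ} {row row' : ℕ → ℕ} {X : ℕ → ℕ → ℕ} (hb : b ≠ 5)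
    (hn : s.reg 1 = n) (hq : s.reg 7 = q)
    (h : IsLabeledMatrix n m thr row' X (s.readList 5)) (hrow : ∀ v < n, s.mem b (q + v) = row v) :
    Runs (loadRow b) s (100 * (n + 1)) fun s' =>
      s'.reg 7 = q + n ∧ IsLabeledMatrix n m thr row X (s'.readList 5) := by
  apply Runs.mono
  · apply Runs.imp
    · apply Runs.forLoop n (fun j s => s.reg 7 = q + j ∧ ∃ ρ, (∀ v < j, ρ v = row v) ∧
        IsLabeledMatrix n m thr ρ X (s.readList 5)) rfl
      · exact ⟨by simp [hq], row', by simp, by simpa using h⟩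
      · intro i s' f _
        rw [Expr.eval, f.reg 1 rfl, hn]
      · rintro j t hj htj f ⟨h7, ρ, hρ, hM⟩
        have hmb : t.mem b = s.mem b := f.mem b (by simp [Prog.forLoop, Prog.writesMem, hb.symm])
        apply Runs.of_simple (by rfl)
        simp only [Prog.eval, Expr.eval, State.setReg_readList, h7, htj, hmb, hrow j hj]
        refine ⟨by simp [h7, add_assoc], Function.update ρ j (row j), fun v hv => ?_, ?_⟩
        · by_cases hvj : v = j
          · simp [hvj]
          · rw [Function.update_of_ne hvj, hρ v (by omega)]
        · rw [show 4 + j = 3 + j + 1 by omega, State.setMem_readList]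
          exact hM.set hj
    · rintro s' - ⟨h7, ρ, hρ, hM⟩
      exact ⟨h7, hM.length, hM.n_eq, hM.m_eq, hM.thr_eq,
        fun v hv => (hM.row_eq v hv).trans (hρ v hv), hM.entry⟩
  · simp only [Prog.cost, Expr.cost]
    ring_nf
    omega

end Ram

/-! ### Encoded hypergraphs and their incidence matrices -/

namespace MultiHypergraph

variable {n m : ℕ}

/-- The vertices of a hyperedge. -/
def edgeList (G : MultiHypergraph (Fin n) (Fin m)) (e : ℕ) : List ℕ :=
  if h : e < m then encodeFinset (G.edge ⟨e, h⟩) else []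

theorem encode_eq (G : MultiHypergraph (Fin n) (Fin m)) :
    G.encode = n :: m :: (List.range m).flatMap fun e => (G.edgeList e).length :: G.edgeList e := by
  rw [encode, encodeSetList, List.length_map, List.length_finRange, ← List.map_val_finRange',
    List.flatMap_map, List.flatMap_map]
  simp [edgeList, encodeFinset_length]

theorem edgeList_length_le (G : MultiHypergraph (Fin n) (Fin m)) (e : ℕ) :
    (G.edgeList e).length ≤ n := by
  rw [edgeList]
  split_ifs
  · rw [encodeFinset_length]
    simpa using Finset.card_le_univ (G.edge _)
  · simp

theorem encode_length_le (G : MultiHypergraph (Fin n) (Fin m)) :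
    G.encode.length ≤ 2 + m * (n + 1) := by
  have : ∀ j, ((List.range j).flatMap fun e => (G.edgeList e).length :: G.edgeList e).length ≤
      j * (n + 1) := by
    intro j
    induction j with
    | zero => simp
    | succ j ih =>
      rw [List.range_succ, List.flatMap_append, List.length_append, add_one_mul]
      have := G.edgeList_length_le j
      simp only [List.flatMap_cons, List.flatMap_nil, List.append_nil, List.length_cons]
      omega
  rw [encode_eq, List.length_cons, List.length_cons]
  have := this m
  omega

theorem incidence_runs (G : MultiHypergraph (Fin n) (Fin m)) (k : ℕ) :
    Ram.Runs Ram.incidence (Ram.State.ofInput (k :: G.encode)) (1000 * ((n + 1) * (m + 1))) fun s =>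
      Ram.IsMatrix n m G.incidenceEntry s.output := by
  set f := fun e => (G.edgeList e).length :: G.edgeList e with hf
  have hget : ∀ i, (k :: G.encode).getD (3 + i) 0 = ((List.range m).flatMap f).getD i 0 := by
    intro i
    rw [encode_eq, show 3 + i = i + 1 + 1 + 1 by omega]
    rfl
  apply Ram.Runs.imp
  · apply Ram.incidence_runs (n := n) (m := m) (L := G.edgeList)
      (off := fun e => ((List.range e).flatMap f).length)
    · rfl
    · rw [encode_eq]
      rfl
    · rfl
    · intro e _
      simp [List.range_succ, hf]
      omega
    · intro e he
      rw [hget]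
      exact Ram.getD_flatMap_range f he (j := 0) (by simp [hf])
    · intro e he j hj
      rw [hget, show ((List.range e).flatMap f).length + 1 + j =
        ((List.range e).flatMap f).length + (j + 1) by omega, Ram.getD_flatMap_range f he]
      · simp [hf]
      · simpa [hf] using hj
    · exact fun e _ => G.edgeList_length_le e
    · intro e he v hv
      rw [edgeList, dif_pos he] at hv
      exact lt_of_mem_encodeFinset hv
  · rintro s - h
    refine ⟨h.length, fun e he v hv => (h.entry e he v hv).trans ?_⟩
    have : v ∈ G.edgeList e ↔ (⟨v, hv⟩ : Fin n) ∈ G.edge ⟨e, he⟩ := by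
      rw [edgeList, dif_pos he]
      exact mem_encodeFinset (v := ⟨v, hv⟩)
    rw [incidenceEntry, dif_pos ⟨he, hv⟩]
    simp only [this]

end MultiHypergraph

namespace Ram

open Ram.Expr Ram.Prog

/-! ### Preparation -/

/-- Compute the labelings that encode all terminal pairs, the threshold that separates sources from
sinks, and the labeled incidence matrix. -/
def setup : Prog :=
  call incidence 2 0 ;;
  (set 3 (lit 1) ;; set 4 (sub (add (reg 0) (reg 0)) (lit 1))) ;;
  forLoop 5 (reg 4) (set 3 (add (reg 3) (reg 3))) ;;
  (push 3 (reg 1) ;; push 3 (reg 1) ;; push 3 (add (reg 4) (reg 4))) ;;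
  forLoop 5 (reg 1) (forLoop 6 (reg 1) (push 3 (eq (reg 5) (reg 6)))) ;;
  call rowSums 4 3 ;;
  (push 5 (reg 1) ;; push 5 (reg 2) ;; push 5 (reg 3)) ;;
  forLoop 5 (reg 1) (push 5 (lit 0)) ;;
  appendDrop 5 5 2 0

/-- The identity matrix. -/
def unitRow (i v : ℕ) : ℕ := if i = v then 1 else 0

set_option maxHeartbeats 1000000 in
theorem setup_runs {s : State} {k n m : ℕ} {G : MultiHypergraph (Fin n) (Fin m)} (hk : 1 ≤ k)
    (hn : 1 ≤ n) (hs : s.readList 0 = k :: G.encode) (h0 : s.reg 0 = k) (h1 : s.reg 1 = n)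
    (h2 : s.reg 2 = m) (h3 : s.readList 3 = []) (h5 : s.readList 5 = []) :
    Runs setup s
      (10000 * (treeSize n (2 * (2 * k - 1) + 1) * ((n + 1) * (n + 1) * (m + 1)))) fun s' =>
      s'.reg 3 = 2 ^ (2 * k - 1) ∧ IsRowSums n n (2 * (2 * k - 1)) unitRow (s'.readList 4) ∧
      IsLabeledMatrix n m (2 ^ (2 * k - 1)) (fun _ => 0) G.incidenceEntry (s'.readList 5) := by
  set d := 2 * k - 1 with hd
  apply Runs.mono
  · unfold setup
    apply Runs.seq (Mid := fun s => IsMatrix n m G.incidenceEntry (s.readList 2))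
    · apply Runs.call (L := m * n) hs (G.incidence_runs k)
      · exact fun o h => h.length.le
      · intro o h
        simpa using h
    intro s₁ f₁ hX₁
    apply Runs.seq (Mid := fun s => s.reg 3 = 1 ∧ s.reg 4 = d)
    · apply Runs.of_simple (by decide)
      simp [Prog.eval, Expr.eval, f₁.reg 0 (by decide), h0]
      omega
    rintro s₂ f₂ ⟨h3₂, h4₂⟩
    apply Runs.seq (Mid := fun s => s.reg 3 = 2 ^ d)
    · apply Runs.forLoop d (fun j s => s.reg 3 = 2 ^ j) (by decide)
      · simp [h3₂]
      · intro i s f _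
        rw [Expr.eval, f.reg 4 (by decide), h4₂]
      · intro j s hj hsj f h
        apply Runs.of_simple (by decide)
        simp [Prog.eval, Expr.eval, h, pow_succ]
        omega
    intro s₃ f₃ h3₃
    have h1₃ : s₃.reg 1 = n := by
      rw [f₃.reg 1 (by decide), f₂.reg 1 (by decide), f₁.reg 1 (by decide), h1]
    have h4₃ : s₃.reg 4 = d := by rw [f₃.reg 4 (by decide), h4₂]
    have h3l₃ : s₃.readList 3 = [] := by
      rw [f₃.readList 3 (by decide), f₂.readList 3 (by decide), f₁.readList 3 (by decide), h3]
    apply Runs.seq (Mid := fun s => s.readList 3 = [n, n, 2 * d])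
    · apply Runs.of_simple (by decide)
      simp [Prog.eval, Prog.push_eval, Expr.eval, h3l₃, h1₃, h4₃]
      omega
    intro s₄ f₄ h3₄
    have h1₄ : s₄.reg 1 = n := by rw [f₄.reg 1 (by decide), h1₃]
    apply Runs.seq (Mid := fun s => s.readList 3 = [n, n, 2 * d] ++ rows n n unitRow)
    · apply Runs.forLoop n (fun i s => s.readList 3 = [n, n, 2 * d] ++ rows i n unitRow) (by decide)
      · simpa [rows] using h3₄
      · intro i s f _
        rw [Expr.eval, f.reg 1 (by decide), h1₄]
      · intro i s hi hsi f h
        apply Runs.imp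
        · apply Runs.forLoop n (fun v s => s.readList 3 = [n, n, 2 * d] ++ rows i n unitRow ++
            (List.range v).map (unitRow i)) (by decide)
          · simpa using h
          · intro v s' f' _
            rw [Expr.eval, f'.reg 1 (by decide), f.reg 1 (by decide), h1₄]
          · intro v s' hv hsv f' h'
            apply Runs.of_simple (by decide)
            simp [Prog.push_eval, Expr.eval, h', f'.reg 5 (by decide), hsi, hsv, unitRow,
              List.range_succ]
        · intro s' f' h'
          rw [State.setReg_readList, h', rows_succ, List.append_assoc]
    intro s₅ f₅ h3₅
    apply Runs.seq (Mid := fun s => IsRowSums n n (2 * d) unitRow (s.readList 4))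
    · apply Runs.call (L := 1 + treeSize n (2 * d + 1) * n) h3₅
      · apply rowSums_runs (n := n) (M := n) (r := 2 * d) (X := unitRow) hn (by omega) rfl rfl rfl
        intro i hi v hv
        rw [List.getD_append_right _ _ _ _ (by simp)]
        simpa using rows_getD unitRow hi hv
      · exact fun o h => h.length.le
      · intro o h
        simpa using h
    intro s₆ f₆ h4₆
    have h1₆ : s₆.reg 1 = n := by rw [f₆.reg 1 (by decide), f₅.reg 1 (by decide), h1₄]
    have h2₆ : s₆.reg 2 = m := by
      rw [f₆.reg 2 (by decide), f₅.reg 2 (by decide), f₄.reg 2 (by decide), f₃.reg 2 (by decide),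
        f₂.reg 2 (by decide), f₁.reg 2 (by decide), h2]
    have h3₆ : s₆.reg 3 = 2 ^ d := by
      rw [f₆.reg 3 (by decide), f₅.reg 3 (by decide), f₄.reg 3 (by decide), h3₃]
    have h5₆ : s₆.readList 5 = [] := by
      rw [f₆.readList 5 (by decide), f₅.readList 5 (by decide), f₄.readList 5 (by decide),
        f₃.readList 5 (by decide), f₂.readList 5 (by decide), f₁.readList 5 (by decide), h5]
    have hX₆ : IsMatrix n m G.incidenceEntry (s₆.readList 2) := by
      rwa [f₆.readList 2 (by decide), f₅.readList 2 (by decide), f₄.readList 2 (by decide),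
        f₃.readList 2 (by decide), f₂.readList 2 (by decide)]
    apply Runs.seq (Mid := fun s => s.readList 5 = [n, m, 2 ^ d])
    · apply Runs.of_simple (by decide)
      simp [Prog.eval, Prog.push_eval, Expr.eval, h5₆, h1₆, h2₆, h3₆]
    intro s₇ f₇ h5₇
    apply Runs.seq (Mid := fun s => s.readList 5 = [n, m, 2 ^ d] ++ List.replicate n 0)
    · apply Runs.forLoop n (fun v s => s.readList 5 = [n, m, 2 ^ d] ++ List.replicate v 0)
        (by decide)
      · simpa using h5₇
      · intro v s' f' _
        rw [Expr.eval, f'.reg 1 (by decide), f₇.reg 1 (by decide), h1₆]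
      · intro v s' hv hsv f' h'
        apply Runs.of_simple (by decide)
        simp [Prog.push_eval, Expr.eval, h', List.replicate_succ']
    intro s₈ f₈ h5₈
    have hX₈ : IsMatrix n m G.incidenceEntry (s₈.readList 2) := by
      rwa [f₈.readList 2 (by decide), f₇.readList 2 (by decide)]
    apply Runs.imp
    · apply Prog.appendDrop_runs (N := m * n) (by decide)
      exact hX₈.length.le
    · intro s₉ f₉ h5₉
      rw [h5₈, List.drop_zero] at h5₉
      refine ⟨?_, ?_, ?_⟩
      · rw [f₉.reg 3 (by decide), f₈.reg 3 (by decide), f₇.reg 3 (by decide), h3₆]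
      · rwa [f₉.readList 4 (by decide), f₈.readList 4 (by decide), f₇.readList 4 (by decide)]
      · rw [h5₉]
        refine ⟨?_, rfl, rfl, rfl, fun v hv => ?_, fun e he v hv => ?_⟩
        · simp [hX₈.length]
          omega
        · rw [List.getD_append _ _ _ _ (by simp; omega), List.getD_append_right _ _ _ _ (by simp)]
          simp
        · rw [List.getD_append_right _ _ _ _ (by simp; omega)]
          have := hX₈.entry e he v hv
          rw [← this]
          congr 1
          simp
          omega
  · have h₁ := le_treeSize hn (2 * d + 1)
    have h₂ := G.encode_length_le
    rw [mul_add_one, mul_comm m n] at h₂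
    have h₃ := one_le_treeSize_succ n (2 * d)
    simp only [Prog.cost, Expr.cost, Prog.push_cost, List.length_append, List.length_cons,
      List.length_nil, rows_length]
    generalize G.encode.length = ℓ at *
    obtain ⟨R, hR⟩ := Nat.exists_eq_add_of_le h₃
    rw [hR] at h₁ ⊢
    ring_nf
    ring_nf at h₁
    omega

end Ram

/-! ### The labelings that occur -/

/-- Repeating one element gives the list length exactly `d`, so that the digits of `T` fill
precisely the places below `2 ^ d`. -/
theorem exists_list_of_nonempty {n d : ℕ} {A : Finset (Fin n)} (hA : A.Nonempty) (hd : A.card ≤ d) :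
    ∃ l : List ℕ, l.length = d ∧ (∀ i ∈ l, i < n) ∧ ∀ v : Fin n, v.val ∈ l ↔ v ∈ A := by
  obtain ⟨x, hx⟩ := hA
  refine ⟨encodeFinset A ++ List.replicate (d - A.card) x.val, ?_, fun i hi => ?_, fun v => ?_⟩
  · rw [List.length_append, encodeFinset_length, List.length_replicate]
    omega
  · rcases List.mem_append.mp hi with hi | hi
    · exact lt_of_mem_encodeFinset hi
    · rw [List.eq_of_mem_replicate hi]
      exact x.2
  · rw [List.mem_append, mem_encodeFinset]
    refine ⟨fun h => h.elim id fun h => ?_, Or.inl⟩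
    rwa [Fin.val_inj.mp (List.eq_of_mem_replicate h)]

/-- A row in the output of `Ram.rowSums`. -/
def Ram.labelRow (n : ℕ) (o : List ℕ) (a v : ℕ) : ℕ := o.getD (1 + (a * n + v)) 0

/-- A labeling encodes a pair of terminal sets. -/
structure IsLabelingOf {n : ℕ} (thr : ℕ) (row : ℕ → ℕ) (S T : Finset (Fin n)) : Prop where
  mem_source : ∀ v : Fin n, v ∈ S ↔ thr ≤ row v
  mem_sink : ∀ v : Fin n, v ∈ T ↔ 0 < row v ∧ row v < thr

theorem IsLabelingOf.unique {n thr : ℕ} {row : ℕ → ℕ} {S T S' T' : Finset (Fin n)}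
    (h : IsLabelingOf thr row S T) (h' : IsLabelingOf thr row S' T') : S = S' ∧ T = T' :=
  ⟨Finset.ext fun v => (h.mem_source v).trans (h'.mem_source v).symm,
    Finset.ext fun v => (h.mem_sink v).trans (h'.mem_sink v).symm⟩

theorem exists_isLabelingOf (n : ℕ) (thr : ℕ) (row : ℕ → ℕ) :
    ∃ S T : Finset (Fin n), IsLabelingOf thr row S T :=
  ⟨Finset.univ.filter fun v => thr ≤ row v, Finset.univ.filter fun v => 0 < row v ∧ row v < thr,
    fun v => by simp, fun v => by simp⟩

/-- Take the row of `lT ++ lS` over the unit vectors: a vertex has a digit 1 in the low half iff it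
is in `T`, and in the high half iff it is in `S`. Disjointness lets the threshold `2 ^ (2k - 1)`
tell them apart. -/
theorem IsTerminalPair.exists_isLabelingOf {n k : ℕ} {S T : Finset (Fin n)} {o : List ℕ}
    (h : MultiHypergraph.IsTerminalPair k S T)
    (ho : Ram.IsRowSums n n (2 * (2 * k - 1)) Ram.unitRow o) :
    ∃ a < Ram.treeSize n (2 * (2 * k - 1) + 1),
      IsLabelingOf (2 ^ (2 * k - 1)) (Ram.labelRow n o a) S T := by
  obtain ⟨hS, hT, hST, hSc, hTc⟩ := h
  obtain ⟨lS, hlS, hltS, hmemS⟩ := exists_list_of_nonempty hS hSc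
  obtain ⟨lT, hlT, hltT, hmemT⟩ := exists_list_of_nonempty hT hTc
  generalize 2 * k - 1 = d at *
  have hlen : (lT ++ lS).length = 2 * d := by
    rw [List.length_append]
    omega
  obtain ⟨a, ha, hav⟩ := ho.exists_row hlen.le fun i hi =>
    (List.mem_append.mp hi).elim (hltT i) (hltS i)
  rw [hlen] at ha
  have hunit : ∀ (l : List ℕ) (v : ℕ), 0 < Ram.rowValue Ram.unitRow l v ↔ v ∈ l := by
    intro l v
    rw [Ram.rowValue_pos_iff]
    simp [Ram.unitRow, Nat.pos_iff_ne_zero]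
  have hrow : ∀ v : Fin n, Ram.labelRow n o a v =
      2 ^ d * Ram.rowValue Ram.unitRow lS v + Ram.rowValue Ram.unitRow lT v := fun v => by
    rw [Ram.labelRow, hav v v.2, Ram.rowValue_append, hlT]
  have hlt : ∀ v : Fin n, Ram.rowValue Ram.unitRow lT v < 2 ^ d := fun v => by
    rw [← hlT]
    refine Ram.rowValue_lt fun i _ => ?_
    rw [Ram.unitRow]
    split_ifs <;> simp
  have hle : ∀ v : Fin n, v ∈ S ↔ 2 ^ d ≤ Ram.labelRow n o a v := fun v => by
    rw [← hmemS, ← hunit, hrow]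
    constructor
    · intro h
      have := Nat.mul_le_mul_left (2 ^ d) h
      omega
    · intro h
      by_contra h0
      rw [Nat.eq_zero_of_not_pos h0] at h
      have := hlt v
      omega
  refine ⟨a, ha, hle, fun v => ?_⟩
  rw [← hmemT, ← hunit]
  constructor
  · intro h
    refine ⟨by rw [hrow]; omega, ?_⟩
    by_contra h'
    rw [hunit, hmemT] at h
    exact Finset.disjoint_left.mp hST ((hle v).mpr (not_lt.mp h')) h
  · rintro ⟨h₁, h₂⟩
    rw [hrow] at h₁ h₂
    by_contra h0
    rw [Nat.eq_zero_of_not_pos h0] at h₁ h₂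
    have h₃ : 0 < Ram.rowValue Ram.unitRow lS v := by
      by_contra h'
      rw [Nat.eq_zero_of_not_pos h'] at h₁
      omega
    have := Nat.mul_le_mul_left (2 ^ d) h₃
    omega

/-! ### Minimum cut-sets as labelings by source sets -/

namespace MultiHypergraph

variable {n m : ℕ}

/-- `ρ` is the indicator function of the source minimal minimum terminal cut for the terminal sets
encoded by the labeling `row`. -/
structure IsSourceRow (G : MultiHypergraph (Fin n) (Fin m)) (thr : ℕ) (row ρ : ℕ → ℕ) : Prop where
  le_one : ∀ v < n, ρ v ≤ 1
  ne_zero_iff : ∀ S T U, IsLabelingOf thr row S T → S.Nonempty → T.Nonempty →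
    G.IsSourceMinimalCut S T U → ∀ v : Fin n, ρ v ≠ 0 ↔ v ∈ U

/-- One of the `k` parts is redundant: a hyperedge meeting two parts meets and leaves one of the
first `k - 1`. A single cut is listed `k - 1` times. -/
theorem exists_sources_of_mem_candidates {G : MultiHypergraph (Fin n) (Fin m)} {k : ℕ}
    (hk : 2 ≤ k) {F : Finset (Fin m)} (hF : F ∈ G.candidates k) :
    ∃ l : List (Finset (Fin n)), l.length = k - 1 ∧ (∀ U ∈ l, U ∈ G.computedSources k) ∧
      ∀ e, e ∈ F ↔ ∃ U ∈ l, e ∈ G.cut U := by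
  rcases hF with ⟨U, hU, -, rfl⟩ | ⟨P, hP, hPC, rfl⟩
  · refine ⟨List.replicate (k - 1) U, List.length_replicate, fun X hX => ?_, fun e => ?_⟩
    · rwa [List.eq_of_mem_replicate hX]
    · constructor
      · exact fun h => ⟨U, List.mem_replicate.mpr ⟨by omega, rfl⟩, h⟩
      · rintro ⟨X, hX, h⟩
        rwa [List.eq_of_mem_replicate hX] at h
  · refine ⟨(List.finRange (k - 1)).map fun i => P (Fin.castLE (by omega) i), by simp,
      fun X hX => ?_, fun e => ?_⟩
    · obtain ⟨i, -, rfl⟩ := List.mem_map.mp hX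
      exact (hPC _).1
    · rw [mem_crossing]
      constructor
      · rintro ⟨i, j, hij, ⟨u, hue, hu⟩, v, hve, hv⟩
        have key : ∀ i' : Fin k, i'.val < k - 1 → (∃ u ∈ G.edge e, u ∈ P i') →
            (∃ v ∈ G.edge e, v ∉ P i') → ∃ U ∈ (List.finRange (k - 1)).map fun i =>
              P (Fin.castLE (by omega) i), e ∈ G.cut U := fun i' hi' h₁ h₂ =>
          ⟨P i', List.mem_map.mpr ⟨⟨i', hi'⟩, List.mem_finRange _, rfl⟩, mem_cut.mpr ⟨h₁, h₂⟩⟩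
        have hne : i.val ≠ j.val := fun h => hij (Fin.val_inj.mp h)
        by_cases hi : i.val < k - 1
        · exact key i hi ⟨u, hue, hu⟩ ⟨v, hve, fun h => hij (hP.unique h hv)⟩
        · exact key j (by omega) ⟨v, hve, hv⟩ ⟨u, hue, fun h => hij (hP.unique hu h)⟩
      · rintro ⟨X, hX, h⟩
        obtain ⟨i, -, rfl⟩ := List.mem_map.mp hX
        obtain ⟨h₁, v, hve, hv⟩ := mem_cut.mp h
        obtain ⟨j, hj⟩ := hP.2.2 v
        refine ⟨Fin.castLE (by omega) i, j, fun hij => hv ?_, h₁, v, hve, hj⟩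
        rwa [hij]

/-- Each minimum `k`-cut-set is the set of hyperedges on which one of the sums of `k - 1` source rows
is not constant. -/
theorem exists_labelRow_of_mem_minKCutSets {G : MultiHypergraph (Fin n) (Fin m)} {k : ℕ}
    (hk : 2 ≤ k) {o o' : List ℕ} {ρ : ℕ → ℕ → ℕ}
    (ho : Ram.IsRowSums n n (2 * (2 * k - 1)) Ram.unitRow o)
    (hρ : ∀ a < Ram.treeSize n (2 * (2 * k - 1) + 1),
      G.IsSourceRow (2 ^ (2 * k - 1)) (Ram.labelRow n o a) (ρ a))
    (ho' : Ram.IsRowSums n (Ram.treeSize n (2 * (2 * k - 1) + 1)) (k - 1) ρ o')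
    {F : Finset (Fin m)} (hF : F ∈ G.minKCutSets k) :
    ∃ b < Ram.treeSize (Ram.treeSize n (2 * (2 * k - 1) + 1)) (k - 1 + 1),
      F = G.nonconstEdges (Ram.labelRow n o' b) := by
  obtain ⟨l, hl, hlU, hlF⟩ :=
    exists_sources_of_mem_candidates hk (G.minKCutSets_subset_candidates hk hF)
  set R := Ram.treeSize n (2 * (2 * k - 1) + 1) with hR
  have hsrc : ∀ U, ∃ a, U ∈ l → a < R ∧ ∀ v : Fin n, ρ a v ≠ 0 ↔ v ∈ U := by
    intro U
    by_cases hU : U ∈ l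
    · obtain ⟨S, T, hST, hmin⟩ := hlU U hU
      obtain ⟨a, ha, hlab⟩ := IsTerminalPair.exists_isLabelingOf hST ho
      exact ⟨a, fun _ => ⟨ha, (hρ a ha).ne_zero_iff S T U hlab hST.1 hST.2.1 hmin⟩⟩
    · exact ⟨0, fun h => absurd h hU⟩
  choose idx hidx using hsrc
  have hlt : ∀ i ∈ l.map idx, i < R := by
    intro i hi
    obtain ⟨U, hU, rfl⟩ := List.mem_map.mp hi
    exact (hidx U hU).1
  have hlen : (l.map idx).length = k - 1 := by rw [List.length_map, hl]
  obtain ⟨b, hb, hbv⟩ := ho'.exists_row hlen.le hlt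
  rw [hlen] at hb
  refine ⟨b, hb, ?_⟩
  ext e
  rw [hlF, mem_nonconstEdges]
  -- The digits of a label record membership in the chosen sources, so labels differ iff some source
  -- separates the two vertices.
  have hrow : ∀ u v : Fin n, Ram.labelRow n o' b u ≠ Ram.labelRow n o' b v ↔
      ∃ U ∈ l, ¬ (u ∈ U ↔ v ∈ U) := by
    intro u v
    rw [Ram.labelRow, Ram.labelRow, hbv u u.2, hbv v v.2, Ne, Ram.rowValue_eq_iff fun i hi =>
      ⟨(hρ i (hlt i hi)).le_one u u.2, (hρ i (hlt i hi)).le_one v v.2⟩]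
    simp only [List.forall_mem_map]
    push Not
    refine exists_congr fun U => and_congr_right fun hU => ?_
    obtain ⟨hlt', hi⟩ := hidx U hU
    have h₁ := (hρ _ hlt').le_one u u.2
    have h₂ := (hρ _ hlt').le_one v v.2
    rw [← hi u, ← hi v]
    constructor
    · intro h
      by_cases hu : ρ (idx U) u = 0
      · exact Or.inr ⟨by simpa using hu, by omega⟩
      · exact Or.inl ⟨hu, by simp; omega⟩
    · rintro (⟨h, h'⟩ | ⟨h, h'⟩) <;> simp only [ne_eq, not_not] at h h' <;> omega
  constructor
  · rintro ⟨U, hU, h⟩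
    obtain ⟨⟨u, hue, hu⟩, v, hve, hv⟩ := mem_cut.mp h
    exact ⟨u, hue, v, hve, (hrow u v).mpr ⟨U, hU, fun h => hv (h.mp hu)⟩⟩
  · rintro ⟨u, hue, v, hve, h⟩
    obtain ⟨U, hU, h⟩ := (hrow u v).mp h
    refine ⟨U, hU, mem_cut.mpr ?_⟩
    by_cases hu : u ∈ U
    · exact ⟨⟨u, hue, hu⟩, v, hve, fun hv => h ⟨fun _ => hv, fun _ => hu⟩⟩
    · refine ⟨⟨v, hve, ?_⟩, u, hue, hu⟩
      by_contra hv
      exact h ⟨fun h => absurd h hu, fun h => absurd h hv⟩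

/-! ### Keeping the cheapest sets -/

/-- `L` lists the sets of cardinality `best` among those of the sets `z 0, …, z (j - 1)` that are
`k`-cut-sets, none of which has a smaller cardinality. The codes of the members of `L` are marked. -/
structure IsBestFamily (G : MultiHypergraph (Fin n) (Fin m)) (k : ℕ) (z : ℕ → Finset (Fin m))
    (j best : ℕ) (mark : ℕ → ℕ) (L : List (Finset (Fin m))) : Prop where
  nodup : L.Nodup
  of_mem : ∀ F ∈ L, F.card = best ∧ G.IsKCutSet k F
  best_le : ∀ a < j, G.IsKCutSet k (z a) → best ≤ (z a).card
  mem_of_eq : ∀ a < j, G.IsKCutSet k (z a) → (z a).card = best → z a ∈ L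
  marked : ∀ F : Finset (Fin m), F.card ≤ best → (mark (code F) ≠ 0 ↔ F ∈ L)

variable {G : MultiHypergraph (Fin n) (Fin m)} {k : ℕ} {z : ℕ → Finset (Fin m)} {j best : ℕ}
  {mark : ℕ → ℕ} {L : List (Finset (Fin m))}

theorem IsBestFamily.zero (h : ∀ c, mark c = 0) : IsBestFamily G k z 0 best mark [] :=
  ⟨List.nodup_nil, by simp, by simp, by simp, by simp [h]⟩

theorem IsBestFamily.skip (h : IsBestFamily G k z j best mark L)
    (hz : G.IsKCutSet k (z j) → best < (z j).card ∨ (z j).card = best ∧ z j ∈ L) :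
    IsBestFamily G k z (j + 1) best mark L := by
  refine ⟨h.nodup, h.of_mem, fun a ha hg => ?_, fun a ha hg hc => ?_, h.marked⟩
  · rcases Nat.lt_succ_iff_lt_or_eq.mp ha with ha | rfl
    · exact h.best_le a ha hg
    · have := hz hg
      omega
  · rcases Nat.lt_succ_iff_lt_or_eq.mp ha with ha | rfl
    · exact h.mem_of_eq a ha hg hc
    · rcases hz hg with h' | h'
      · omega
      · exact h'.2

/-- Marks need not be erased: `marked` now concerns only sets of at most `c` elements, while
everything in the old list has `best > c` elements. -/
theorem IsBestFamily.improve (h : IsBestFamily G k z j best mark L) {c : ℕ} (hc : c < best) :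
    IsBestFamily G k z j c mark [] := by
  refine ⟨List.nodup_nil, by simp, fun a ha hg => ?_, fun a ha hg hca => ?_, fun F hF => ?_⟩
  · exact hc.le.trans (h.best_le a ha hg)
  · have := h.best_le a ha hg
    omega
  · rw [h.marked F (by omega)]
    simp only [List.not_mem_nil, iff_false]
    intro hFL
    have := (h.of_mem F hFL).1
    omega

theorem IsBestFamily.push (h : IsBestFamily G k z j best mark L) (hz : G.IsKCutSet k (z j))
    (hc : (z j).card = best) (hm : mark (code (z j)) = 0) {mark' : ℕ → ℕ}
    (hmark : ∀ c, mark' c = if c = code (z j) then 1 else mark c) :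
    IsBestFamily G k z (j + 1) best mark' (L ++ [z j]) := by
  have hnot : z j ∉ L := fun h' => (h.marked _ hc.le).mpr h' hm
  refine ⟨?_, fun F hF => ?_, fun a ha hg => ?_, fun a ha hg hca => ?_, fun F hF => ?_⟩
  · rw [List.nodup_append]
    exact ⟨h.nodup, List.nodup_singleton _, fun F hF F' hF' => by
      rw [List.mem_singleton.mp hF']
      rintro rfl
      exact hnot hF⟩
  · rcases List.mem_append.mp hF with hF | hF
    · exact h.of_mem F hF
    · rw [List.mem_singleton.mp hF]
      exact ⟨hc, hz⟩
  · rcases Nat.lt_succ_iff_lt_or_eq.mp ha with ha | rfl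
    · exact h.best_le a ha hg
    · exact hc.ge
  · rcases Nat.lt_succ_iff_lt_or_eq.mp ha with ha | rfl
    · exact List.mem_append_left _ (h.mem_of_eq a ha hg hca)
    · simp
  · rw [hmark, List.mem_append, List.mem_singleton, ← h.marked F hF]
    by_cases hFz : F = z j
    · simp [hFz]
    · rw [if_neg fun h => hFz (code_injective h)]
      simp [hFz]

/-- The initial value `m + 1` exceeds every cardinality, and any other value of `best` is attained
in `L`. So `best` cannot lie below the optimum, nor above it once a minimum set has been seen. -/
theorem IsBestFamily.mem_iff (h : IsBestFamily G k z j best mark L) (hL : best = m + 1 ∨ L ≠ [])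
    (hz : ∀ F ∈ G.minKCutSets k, ∃ a < j, F = z a) (F : Finset (Fin m)) :
    F ∈ L ↔ F ∈ G.minKCutSets k := by
  constructor
  · intro hF
    refine ⟨(h.of_mem F hF).2, fun F' hF' => ?_⟩
    obtain ⟨F₀, hF₀, hmin⟩ := Set.exists_min_image {X | G.IsKCutSet k X} Finset.card
      (Set.toFinite _) ⟨F', hF'⟩
    obtain ⟨a, ha, rfl⟩ := hz F₀ ⟨hF₀, hmin⟩
    rw [(h.of_mem F hF).1]
    exact (h.best_le a ha hF₀).trans (hmin F' hF')
  · intro hF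
    obtain ⟨a, ha, rfl⟩ := hz F hF
    have hle := h.best_le a ha hF.1
    refine h.mem_of_eq a ha hF.1 (le_antisymm ?_ hle)
    rcases hL with hL | hL
    · have : (z a).card ≤ m := by simpa using Finset.card_le_univ (z a)
      omega
    · obtain ⟨F', hF'⟩ := List.exists_mem_of_ne_nil L hL
      rw [← (h.of_mem F' hF').1]
      exact hF.2 F' (h.of_mem F' hF').2

end MultiHypergraph

namespace Ram

open Ram.Expr Ram.Prog MultiHypergraph

/-! ### Computing the source sets -/

theorem IsContraction.length_le {n m thr : ℕ} {row : ℕ → ℕ} {X : ℕ → ℕ → ℕ} {o : List ℕ}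
    (h : IsContraction n m thr row X o) : o.length ≤ 4 + m + 2 * (m * n) := by
  by_cases hs : ∃ v < n, thr ≤ row v
  · by_cases ht : ∃ v < n, 0 < row v ∧ row v < thr
    · obtain ⟨s, -, t, -, pad, -, -, -, hpad, rfl⟩ := h.eq_contraction hs ht
      have h₁ : ∀ j, ((List.range j).flatMap fun e =>
          withLength (support n (imageIndicator n (X e) (contraction thr row s t)))).length =
          j + ((List.range j).map fun e =>
            (support n (imageIndicator n (X e) (contraction thr row s t))).length).sum := by
        intro j
        induction j with
        | zero => simp
        | succ j ih =>
          rw [List.range_succ, List.flatMap_append, List.length_append, ih]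
          simp [withLength]
          omega
      have h₂ : ∀ j, ((List.range j).map fun e => (support n (X e)).length).sum ≤ j * n := by
        intro j
        induction j with
        | zero => simp
        | succ j ih =>
          have := support_length_le n (X j)
          rw [List.range_succ, List.map_append, List.sum_append, add_one_mul]
          simp only [List.map_cons, List.map_nil, List.sum_cons, List.sum_nil, add_zero]
          omega
      have h₃ : (List.replicate pad [1, s]).flatten.length = 2 * pad := by
        simp [mul_comm]
      have := h₂ m
      simp only [List.length_append, List.length_cons, h₁, h₃]
      omega
    · rw [h.eq_nil (Or.inr fun v hv => ?_)]
      · simp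
      · by_contra h'
        push Not at h'
        exact ht ⟨v, hv, by omega, h'.2⟩
  · rw [h.eq_nil (Or.inl fun v hv => ?_)]
    · simp
    · by_contra h'
      exact hs ⟨v, hv, by omega⟩

/-- Compute a source row from the labels at cell `reg 7` of array `4`, and append it to the list in
array `6`. The program `Q` computes source minimal minimum terminal cuts. -/
def sourceStep (Q : Prog) : Prog :=
  loadRow 4 ;;
  call contract 7 5 ;;
  ite (get 7 (lit 0)) (call Q 8 7) (put 8 (lit 0) (lit 0)) ;;
  forLoop 6 (reg 1) (put 9 (reg 6) (lit 0)) ;;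
  forLoop 6 (get 8 (lit 0)) (put 9 (get 8 (add (reg 6) (lit 1))) (lit 1)) ;;
  forLoop 6 (reg 1)
    (ite (lt (get 5 (add (lit 4) (reg 6))) (reg 3))
      (ite (lt (lit 0) (get 5 (add (lit 4) (reg 6)))) (push 6 (lit 0)) (push 6 (get 9 (reg 6))))
      (push 6 (lit 1)))

/-- The list contains the elements of a source minimal minimum terminal cut in the contracted
hypergraph. -/
def IsSourceList {n m : ℕ} (G : MultiHypergraph (Fin n) (Fin m)) (thr : ℕ) (row : ℕ → ℕ)
    (o : List ℕ) : Prop :=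
  o.length ≤ n ∧ ∀ S T, IsLabelingOf thr row S T → S.Nonempty → T.Nonempty →
    ∀ U, G.IsSourceMinimalCut S T U → ∀ v : Fin n, v ∈ U ↔ v ∈ S ∨ v ∉ T ∧ v.val ∈ o

/-- The output of `contract` is empty iff a terminal set is empty. In that case nothing is required
of the result and `Q` is not called. -/
theorem call_runs_isSourceList {n m thr : ℕ} {G : MultiHypergraph (Fin n) (Fin m)} {row : ℕ → ℕ}
    {Q : Prog} {T : ℕ → ℕ → ℕ} (hQ : SolvesSourceMinimalCut Q T) (hG : G.NoEmptyEdge) {s : State}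
    (h : IsContraction n m thr row G.incidenceEntry (s.readList 7)) :
    Runs (ite (get 7 (lit 0)) (call Q 8 7) (put 8 (lit 0) (lit 0))) s
      (T n G.size + 100 * ((n + 1) * (m + 1))) fun s' => IsSourceList G thr row (s'.readList 8) := by
  obtain ⟨S, U, hlab⟩ := exists_isLabelingOf n thr row
  apply Runs.mono (B := (get 7 (lit 0)).cost + 1 + (T n G.size + (4 + m + 2 * (m * n)) + n + 10))
  · apply Runs.ite
    · intro hb
      have hne : s.readList 7 ≠ [] := by
        intro h0
        rw [← List.length_eq_zero_iff, State.readList_length] at h0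
        exact hb h0
      have hS : S.Nonempty := by
        by_contra h0
        refine hne (h.eq_nil (Or.inl fun v hv => ?_))
        by_contra h'
        exact h0 ⟨⟨v, hv⟩, (hlab.mem_source ⟨v, hv⟩).mpr (not_lt.mp h')⟩
      have hU : U.Nonempty := by
        by_contra h0
        refine hne (h.eq_nil (Or.inr fun v hv => ?_))
        by_contra h'
        push Not at h'
        exact h0 ⟨⟨v, hv⟩, (hlab.mem_sink ⟨v, hv⟩).mpr ⟨by simp; omega, h'.2⟩⟩
      obtain ⟨x, y, m', H, hxy, hH, hsize, ho, htrans⟩ :=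
        exists_of_isContraction hG hlab.mem_source hlab.mem_sink hS hU h
      obtain ⟨W, out, time, hW, hperm, hrun, htime⟩ := hQ n m' H hH x y hxy
      have hlen : out.length ≤ n := by
        rw [hperm.length_eq, encodeFinset_length]
        simpa using Finset.card_le_univ W
      apply Runs.mono
      · apply Runs.call (L := n) (Spec := fun o => o = out) rfl
        · rw [ho]
          exact hrun.runs htime
        · rintro o rfl
          exact hlen
        · rintro o rfl
          rw [State.writeList_readList]
          refine ⟨hlen, fun S' T' hlab' _ _ U' hU' v => ?_⟩
          obtain ⟨rfl, rfl⟩ := hlab.unique hlab'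
          rw [hU'.unique (htrans W hW), hperm.mem_iff, mem_encodeFinset]
          simp
      · have := h.length_le
        rw [hsize]
        omega
    · intro hb
      refine Runs.mono (Runs.of_simple (by rfl) ?_) (B := Prog.cost (put 8 (lit 0) (lit 0))) ?_
      · have h0 : (s.setMem 8 0 0).readList 8 = [] := State.readList_eq_nil _ _ (by simp)
        have hnil : s.readList 7 = [] := State.readList_eq_nil _ _ hb
        simp only [Prog.eval, Expr.eval, h0]
        refine ⟨by simp, fun S' T' hlab' hS' hT' _ _ _ => ?_⟩
        obtain ⟨rfl, rfl⟩ := hlab.unique hlab'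
        obtain ⟨_, _, _, _, _, _, _, ho, _⟩ :=
          exists_of_isContraction hG hlab.mem_source hlab.mem_sink hS' hT' h
        rw [hnil] at ho
        cases ho
      · simp only [Prog.cost, Expr.cost]
        omega
  · simp only [Expr.cost]
    ring_nf
    omega

set_option maxHeartbeats 1000000 in
theorem sourceStep_runs {n m thr q : ℕ} {G : MultiHypergraph (Fin n) (Fin m)} {row row' : ℕ → ℕ}
    {Q : Prog} {T : ℕ → ℕ → ℕ} (hQ : SolvesSourceMinimalCut Q T) (hG : G.NoEmptyEdge) {s : State}
    (h1 : s.reg 1 = n) (h3 : s.reg 3 = thr) (h7 : s.reg 7 = q)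
    (h5 : IsLabeledMatrix n m thr row' G.incidenceEntry (s.readList 5))
    (h4 : ∀ v < n, s.mem 4 (q + v) = row v) :
    Runs (sourceStep Q) s (T n G.size + 100000 * ((n + 1) * (m + 1))) fun s' =>
      s'.reg 7 = q + n ∧ IsLabeledMatrix n m thr row G.incidenceEntry (s'.readList 5) ∧
      ∃ ρ, G.IsSourceRow thr row ρ ∧ s'.readList 6 = s.readList 6 ++ (List.range n).map ρ := by
  apply Runs.mono
  · unfold sourceStep
    apply Runs.seq
    · exact loadRow_runs (by decide) h1 h7 h5 h4
    rintro s₁ f₁ ⟨h7₁, h5₁⟩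
    apply Runs.seq (Mid := fun s => IsContraction n m thr row G.incidenceEntry (s.readList 7))
    · apply Runs.mono (B' := 20000 * ((n + 1) * (m + 1)))
      · apply Runs.call (L := 4 + m + 2 * (m * n)) rfl
        · exact contract_runs h5₁
        · exact fun o h => h.length_le
        · intro o h
          simpa using h
      · rw [h5₁.length]
        ring_nf
        omega
    intro s₂ f₂ h7₂
    apply Runs.seq
    · exact call_runs_isSourceList hQ hG h7₂
    intro s₃ f₃ h8₃
    have h1₃ : s₃.reg 1 = n := by
      rw [f₃.reg 1 rfl, f₂.reg 1 rfl, f₁.reg 1 rfl, h1]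
    apply Runs.seq (Mid := fun s => ∀ v < n, s.mem 9 v = 0)
    · apply Runs.forLoop n (fun j s => ∀ v < j, s.mem 9 v = 0) (by decide)
      · simp
      · intro i s f _
        rw [Expr.eval, f.reg 1 (by decide), h1₃]
      · intro j s hj hsj f h
        apply Runs.of_simple (by decide)
        simp only [Prog.eval, Expr.eval, State.setReg_mem, State.setMem_mem, hsj, true_and]
        intro v hv
        split_ifs with hvj
        exacts [rfl, h v (by omega)]
    intro s₄ f₄ h9₄
    have h8₄ : s₄.readList 8 = s₃.readList 8 := f₄.readList 8 (by decide)
    set l := s₃.readList 8 with hl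
    have hlen : s₄.mem 8 0 = l.length := by rw [← h8₄, State.readList_length]
    apply Runs.seq (Mid := fun s => ∀ v < n, s.mem 9 v = if v ∈ l then 1 else 0)
    · apply Runs.imp
      · apply Runs.forLoop_le n (N := l.length)
          (fun j s => ∀ v < n, s.mem 9 v = if v ∈ l.take j then 1 else 0) h8₃.1 (by decide)
        · simpa using h9₄
        · intro i s f _
          simp [Expr.eval, f.mem 8 (by decide), hlen]
        · intro j s hj hsj f h
          have hget : s.mem 8 (j + 1) = l[j] := by
            rw [f.mem 8 (by decide), ← State.readList_getD _ _ _ (by omega), h8₄,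
              List.getD_eq_getElem]
          apply Runs.of_simple (by decide)
          simp only [Prog.eval, Expr.eval, State.setReg_mem, State.setMem_mem, hsj, true_and, hget]
          intro v hv
          have hiff : v ∈ l.take (j + 1) ↔ v = l[j] ∨ v ∈ l.take j := by
            rw [List.take_add_one, List.mem_append, or_comm]
            simp [hj]
          simp only [hiff, h v hv]
          split_ifs <;> first | rfl | (exfalso; tauto)
      · intro s f h
        simpa using h
    intro s₅ f₅ h9₅
    have h1₅ : s₅.reg 1 = n := by rw [f₅.reg 1 (by decide), f₄.reg 1 (by decide), h1₃]
    have h3₅ : s₅.reg 3 = thr := by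
      rw [f₅.reg 3 (by decide), f₄.reg 3 (by decide), f₃.reg 3 rfl, f₂.reg 3 rfl, f₁.reg 3 rfl, h3]
    have h7₅ : s₅.reg 7 = q + n := by
      rw [f₅.reg 7 (by decide), f₄.reg 7 (by decide), f₃.reg 7 rfl, f₂.reg 7 rfl, h7₁]
    have h5₅ : IsLabeledMatrix n m thr row G.incidenceEntry (s₅.readList 5) := by
      rwa [f₅.readList 5 (by decide), f₄.readList 5 (by decide), f₃.readList 5 rfl,
        f₂.readList 5 rfl]
    have h6₅ : s₅.readList 6 = s.readList 6 := by
      rw [f₅.readList 6 (by decide), f₄.readList 6 (by decide), f₃.readList 6 rfl,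
        f₂.readList 6 rfl, f₁.readList 6 rfl]
    have hrow₅ : ∀ v < n, s₅.mem 5 (4 + v) = row v := by
      intro v hv
      have hlt : 3 + v < s₅.mem 5 0 := by
        rw [← State.readList_length, h5₅.length]
        omega
      rw [show 4 + v = 3 + v + 1 by omega, ← State.readList_getD _ _ _ hlt, h5₅.row_eq v hv]
    -- On the terminals the labels decide, because the contracted cut knows only one vertex of each
    -- terminal set; elsewhere the returned list decides.
    set ρ : ℕ → ℕ := fun v =>
      if row v < thr then if 0 < row v then 0 else if v ∈ l then 1 else 0 else 1 with hρ
    apply Runs.imp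
    · apply Runs.forLoop n
        (fun j t => t.readList 6 = s.readList 6 ++ (List.range j).map ρ) (by decide)
      · simpa using h6₅
      · intro i s f _
        rw [Expr.eval, f.reg 1 (by decide), h1₅]
      · intro j t hj htj f h
        apply Runs.of_simple (by decide)
        have hr : t.mem 5 (4 + j) = row j := by rw [f.mem 5 (by decide), hrow₅ j hj]
        have h9 : t.mem 9 j = if j ∈ l then 1 else 0 := by rw [f.mem 9 (by decide), h9₅ j hj]
        have ht3 : t.reg 3 = thr := by rw [f.reg 3 (by decide), h3₅]
        simp only [Prog.eval, Prog.push_eval, Expr.eval, State.setReg_readList, htj, hr, h9, ht3,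
          List.range_succ, List.map_append, List.map_cons, List.map_nil, ← List.append_assoc, ← h]
        by_cases h₁ : row j < thr <;> by_cases h₂ : 0 < row j <;> simp [hρ, h₁, h₂]
    · intro t f h
      refine ⟨by rw [f.reg 7 (by decide), h7₅], by rwa [f.readList 5 (by decide)], ρ,
        ⟨fun v _ => ?_, fun S T U hlab hS hT hU v => ?_⟩, h⟩
      · simp only [hρ]
        split_ifs <;> simp
      · rw [h8₃.2 S T hlab hS hT U hU v, hlab.mem_source, hlab.mem_sink]
        simp only [hρ]
        split_ifs with h₁ h₂ h₃
        · simp [h₁, h₂]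
        · simp [h₁, h₂, h₃]
        · simp [h₁, h₂, h₃]
        · simp [not_lt.mp h₁]
  · simp only [Prog.cost, Expr.cost, Prog.push_cost]
    ring_nf
    omega

/-- Compute the source rows for all labelings in array `4`. -/
def sourcesPhase (Q : Prog) : Prog :=
  (push 6 (reg 1) ;; push 6 (get 4 (lit 1)) ;; push 6 (sub (reg 0) (lit 1)) ;; set 7 (lit 2)) ;;
  forLoop 8 (get 4 (lit 1)) (sourceStep Q)

-- The three numbers in front make array `6` directly an input for the second run of `rowSums`.
set_option maxHeartbeats 1000000 in
theorem sourcesPhase_runs {n m k thr r : ℕ} {G : MultiHypergraph (Fin n) (Fin m)} {row : ℕ → ℕ}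
    {X : ℕ → ℕ → ℕ} {Q : Prog} {T : ℕ → ℕ → ℕ} (hQ : SolvesSourceMinimalCut Q T)
    (hG : G.NoEmptyEdge) {s : State}
    (h0 : s.reg 0 = k) (h1 : s.reg 1 = n) (h3 : s.reg 3 = thr) (h6 : s.readList 6 = [])
    (h5 : IsLabeledMatrix n m thr row G.incidenceEntry (s.readList 5))
    (h4 : IsRowSums n n r X (s.readList 4)) :
    Runs (sourcesPhase Q) s
      (treeSize n (r + 1) * (T n G.size + 200000 * ((n + 1) * (m + 1)))) fun s' =>
      (∃ row', IsLabeledMatrix n m thr row' G.incidenceEntry (s'.readList 5)) ∧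
      ∃ ρ, (∀ a < treeSize n (r + 1), G.IsSourceRow thr (labelRow n (s.readList 4) a) (ρ a)) ∧
        s'.readList 6 = [n, treeSize n (r + 1), k - 1] ++ rows (treeSize n (r + 1)) n ρ := by
  have hone := one_le_treeSize_succ n r
  set R := treeSize n (r + 1) with hR
  have hmem : ∀ j < 1 + R * n, s.mem 4 (j + 1) = (s.readList 4).getD j 0 := by
    intro j hj
    refine (State.readList_getD _ _ _ ?_).symm
    rwa [← State.readList_length, h4.length]
  apply Runs.mono
  · unfold sourcesPhase
    apply Runs.seq (Mid := fun s => s.readList 6 = [n, R, k - 1] ∧ s.reg 7 = 2)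
    · apply Runs.of_simple (by decide)
      have := hmem 0 (by omega)
      rw [h4.head] at this
      simp [Prog.eval, Prog.push_eval, Expr.eval, h6, h0, h1, this, hR]
    rintro s₁ f₁ ⟨h6₁, h7₁⟩
    apply Runs.imp
    · apply Runs.forLoop R (fun a t => t.reg 7 = 2 + a * n ∧
        (∃ row', IsLabeledMatrix n m thr row' G.incidenceEntry (t.readList 5)) ∧
        ∃ ρ, (∀ a' < a, G.IsSourceRow thr (labelRow n (s.readList 4) a') (ρ a')) ∧
          t.readList 6 = [n, R, k - 1] ++ rows a n ρ) rfl
      · refine ⟨by simpa using h7₁, ⟨row, ?_⟩, fun _ _ => 0, by simp, ?_⟩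
        · rwa [State.setReg_readList, f₁.readList 5 (by decide)]
        · simpa [rows] using h6₁
      · intro i t f _
        have := hmem 0 (by omega)
        rw [h4.head] at this
        rw [Expr.eval, f.mem 4 rfl, f₁.mem 4 (by decide)]
        exact this
      · rintro a t ha hta f ⟨h7, ⟨row', h5'⟩, ρ, hρ, h6'⟩
        apply Runs.imp
        · apply sourceStep_runs hQ hG (thr := thr) (row := labelRow n (s.readList 4) a) _ _ h7 h5'
          · intro v hv
            rw [f.mem 4 rfl, f₁.mem 4 (by decide), labelRow, ← hmem]
            · congr 1
              omega
            · have := mul_add_lt hv ha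
              omega
          · rw [f.reg 1 rfl, f₁.reg 1 (by decide), h1]
          · rw [f.reg 3 rfl, f₁.reg 3 (by decide), h3]
        · rintro t' f' ⟨h7', h5'', ρ', hρ', h6''⟩
          refine ⟨?_, ⟨_, h5''⟩, Function.update ρ a ρ', fun a' ha' => ?_, ?_⟩
          · simp [h7']
            ring
          · by_cases haa : a' = a
            · subst haa
              simpa using hρ'
            · rw [Function.update_of_ne haa]
              exact hρ a' (by omega)
          · rw [State.setReg_readList, h6'', h6', rows_succ, List.append_assoc,
              Function.update_self,
              rows_congr (ρ' := Function.update ρ a ρ') fun a' ha' v _ => by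
                rw [Function.update_of_ne ha'.ne]]
    · rintro t f ⟨-, h5', h⟩
      exact ⟨h5', h⟩
  · simp only [Prog.cost, Expr.cost, Prog.push_cost]
    obtain ⟨R', hR'⟩ := Nat.exists_eq_add_of_le hone
    rw [hR']
    ring_nf
    omega

end Ram

namespace Ram

open Ram.Expr Ram.Prog MultiHypergraph

variable {n m : ℕ}

/-! ### Searching for the minimum `k`-cut-sets -/

/-- Record the set of hyperedges described by the list in array `7` if no cheaper one is known. -/
def recordSet : Prog :=
  ite (lt (get 7 (lit 3)) (reg 9))
    (set 9 (get 7 (lit 3)) ;; set 10 (lit 0) ;; put 1 (lit 0) (lit 1)) skip ;;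
  ite (eq (get 7 (lit 3)) (reg 9))
    (ite (get 11 (get 7 (lit 2))) skip
      ((put 11 (get 7 (lit 2)) (lit 1) ;; set 10 (add (reg 10) (lit 1))) ;; appendDrop 6 1 7 2))
    skip

/-- Evaluate the labels at cell `reg 7` of array `10`. -/
def searchStep : Prog :=
  loadRow 10 ;; call evaluate 7 5 ;; ite (lt (get 7 (lit 1)) (reg 0)) skip recordSet

/-- The list in array `1` consists of a number and of the cheapest `k`-cut-sets found so far. -/
def IsRecorded (G : MultiHypergraph (Fin n) (Fin m)) (k : ℕ) (z : ℕ → Finset (Fin m)) (j : ℕ)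
    (good : ℕ → List (Finset (Fin m)) → Prop) (s : State) : Prop :=
  ∃ L c, s.reg 10 = L.length ∧ s.readList 1 = c :: L.flatMap (fun A => A.card :: encodeFinset A) ∧
    G.IsBestFamily k z j (s.reg 9) (s.mem 11) L ∧ good (s.reg 9) L

/-- After the first conditional `best` is at most `|z j|`, with equality if the list is empty. The
second conditional appends `z j` when equality holds and its code is unmarked. -/
theorem recordSet_runs {G : MultiHypergraph (Fin n) (Fin m)} {k c j : ℕ} {z : ℕ → Finset (Fin m)}
    {s : State} (h7 : s.readList 7 = c :: code (z j) :: (z j).card :: encodeFinset (z j))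
    (hz : G.IsKCutSet k (z j))
    (h : IsRecorded G k z j (fun best L => best = m + 1 ∨ L ≠ []) s) :
    Runs recordSet s (400 * (m + 1)) (IsRecorded G k z (j + 1) fun best L =>
      best = m + 1 ∨ L ≠ []) := by
  have hcard : (z j).card ≤ m := by simpa using Finset.card_le_univ (z j)
  have hlen : s.mem 7 0 = 3 + (z j).card := by
    rw [← State.readList_length, h7]
    simp [encodeFinset_length]
    omega
  have hcode : s.mem 7 2 = code (z j) := by
    rw [← State.readList_getD s 7 1 (by omega), h7]
    rfl
  have hc : s.mem 7 3 = (z j).card := by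
    rw [← State.readList_getD s 7 2 (by omega), h7]
    rfl
  apply Runs.mono
  · unfold recordSet
    apply Runs.seq (Mid := IsRecorded G k z j fun best L => best ≤ (z j).card ∧
      (best = (z j).card ∨ L ≠ []))
    · obtain ⟨L, d, h10, h1, hbest, hL⟩ := h
      apply Runs.of_simple (by decide)
      simp only [Prog.eval, Expr.eval, hc]
      by_cases hlt : (z j).card < s.reg 9
      · rw [if_pos hlt, if_neg one_ne_zero]
        refine ⟨[], s.mem 1 1, by simp, ?_, ?_, by simp⟩
        · simp [State.readList]
        · have hm : ((((s.setReg 9 (z j).card).setReg 10 0).setMem 1 0 1).mem 11) = s.mem 11 := by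
            ext i
            simp
          rw [hm]
          simpa using hbest.improve hlt
      · rw [if_neg hlt, if_pos rfl]
        exact ⟨L, d, h10, h1, hbest, by omega, hL.imp (by omega) id⟩
    rintro s₁ f₁ ⟨L, d, h10₁, h1₁, hbest₁, hle₁, hL₁⟩
    have hm₁ : s₁.mem 7 = s.mem 7 := f₁.mem 7 (by decide)
    apply Runs.ite (B := 300 * (m + 1))
    · intro hb
      have heq : (z j).card = s₁.reg 9 := by
        by_contra hne
        simp [Expr.eval, hm₁, hc, hne] at hb
      apply Runs.mono (B := (get 11 (get 7 (lit 2))).cost + 1 + 200 * (m + 1))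
      · apply Runs.ite
        · intro hb'
          simp only [Expr.eval, hm₁, hcode] at hb'
          have hmem := (hbest₁.marked _ heq.le).mp hb'
          refine Runs.mono (B := Prog.cost skip) (Runs.of_simple (by decide) ?_)
            (by simp only [Prog.cost]; omega)
          exact ⟨L, d, h10₁, h1₁, hbest₁.skip fun _ => Or.inr ⟨heq, hmem⟩,
            Or.inr (List.ne_nil_of_mem hmem)⟩
        · intro hb'
          simp only [Expr.eval, hm₁, hcode] at hb'
          apply Runs.mono
          · apply Runs.seq (Mid := fun t => t = (s₁.setMem 11 (code (z j)) 1).setReg 10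
              (L.length + 1))
            · apply Runs.of_simple (by decide)
              simp [Prog.eval, Expr.eval, hm₁, hcode, h10₁]
            intro t ft ht
            apply Runs.imp
            · apply Prog.appendDrop_runs (N := 3 + m) (by decide)
              rw [State.readList_length, ft.mem 7 (by decide), hm₁, hlen]
              omega
            · intro t' ft' h1'
              refine ⟨L ++ [z j], d, ?_, ?_, ?_, by simp⟩
              · simp [ft'.reg 10 (by decide), ht]
              · rw [h1', ft.readList 1 (by decide), ft.readList 7 (by decide),
                  f₁.readList 7 (by decide), h1₁, h7]
                simp
              · have h9 : t'.reg 9 = s₁.reg 9 := by rw [ft'.reg 9 (by decide), ft.reg 9 (by decide)]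
                rw [h9, ft'.mem 11 (by decide), ht]
                refine hbest₁.push hz heq hb' fun i => ?_
                simp
          · simp only [Prog.cost, Expr.cost]
            omega
      · simp only [Expr.cost]
        omega
    · intro hb
      have hne : (z j).card ≠ s₁.reg 9 := by
        intro heq
        simp [Expr.eval, hm₁, hc, heq] at hb
      refine Runs.mono (B := Prog.cost skip) (Runs.of_simple (by decide) ?_)
        (by simp only [Prog.cost]; omega)
      exact ⟨L, d, h10₁, h1₁, hbest₁.skip fun _ => Or.inl (by omega),
        Or.inr (hL₁.resolve_left fun h => hne h.symm)⟩
  · simp only [Prog.cost, Expr.cost]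
    omega

set_option maxHeartbeats 1000000 in
theorem searchStep_runs {G : MultiHypergraph (Fin n) (Fin m)} {k j q thr : ℕ}
    {z : ℕ → Finset (Fin m)} {row row' : ℕ → ℕ} {s : State} (h0 : s.reg 0 = k) (h1 : s.reg 1 = n)
    (h7 : s.reg 7 = q) (h5 : IsLabeledMatrix n m thr row' G.incidenceEntry (s.readList 5))
    (h10 : ∀ v < n, s.mem 10 (q + v) = row v) (hz : z j = G.nonconstEdges row)
    (h : IsRecorded G k z j (fun best L => best = m + 1 ∨ L ≠ []) s) :
    Runs searchStep s (20000 * ((n + 1) * (n + 1) * (m + 1))) fun s' =>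
      s'.reg 7 = q + n ∧ IsLabeledMatrix n m thr row G.incidenceEntry (s'.readList 5) ∧
      IsRecorded G k z (j + 1) (fun best L => best = m + 1 ∨ L ≠ []) s' := by
  have hcard : (z j).card ≤ m := by simpa using Finset.card_le_univ (z j)
  apply Runs.mono
  · unfold searchStep
    apply Runs.seq
    · exact loadRow_runs (by decide) h1 h7 h5 h10
    rintro s₁ f₁ ⟨h7₁, h5₁⟩
    apply Runs.seq (Mid := fun s => s.readList 7 =
      G.numComponents (z j) :: code (z j) :: (z j).card :: encodeFinset (z j))
    · apply Runs.mono (B' := 15000 * ((n + 1) * (n + 1) * (m + 1)))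
      · apply Runs.call (L := 3 + m) (Spec := IsEvaluation n m row G.incidenceEntry) rfl
        · exact evaluate_runs h5₁
        · intro o ho
          rw [eq_of_isEvaluation ho, ← hz]
          simp only [List.length_cons, encodeFinset_length]
          omega
        · intro o ho
          rw [State.writeList_readList, eq_of_isEvaluation ho, hz]
      · rw [h5₁.length]
        ring_nf
        omega
    intro s₂ f₂ h7₂
    have hrec : IsRecorded G k z j (fun best L => best = m + 1 ∨ L ≠ []) s₂ := by
      obtain ⟨L, c, h₁, h₂, h₃, h₄⟩ := h
      have h9 : s₂.reg 9 = s.reg 9 := by rw [f₂.reg 9 (by decide), f₁.reg 9 (by decide)]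
      refine ⟨L, c, ?_, ?_, ?_, ?_⟩
      · rw [f₂.reg 10 (by decide), f₁.reg 10 (by decide), h₁]
      · rw [f₂.readList 1 (by decide), f₁.readList 1 (by decide), h₂]
      · rw [f₂.mem 11 (by decide), f₁.mem 11 (by decide), h9]
        exact h₃
      · rw [h9]
        exact h₄
    have hnum : s₂.mem 7 1 = G.numComponents (z j) := by
      have hlen : 0 < s₂.mem 7 0 := by
        rw [← State.readList_length, h7₂]
        simp
      rw [← State.readList_getD s₂ 7 0 hlen, h7₂]
      rfl
    have hk₂ : s₂.reg 0 = k := by rw [f₂.reg 0 (by decide), f₁.reg 0 (by decide), h0]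
    apply Runs.imp
    · apply Runs.ite (Post := IsRecorded G k z (j + 1) fun best L => best = m + 1 ∨ L ≠ [])
        (B := 400 * (m + 1))
      · intro hb
        have hlt : ¬ G.IsKCutSet k (z j) := by
          intro hle
          rw [IsKCutSet] at hle
          simp only [Expr.eval, hnum, hk₂] at hb
          exact hb (if_neg (by omega))
        refine Runs.mono (B := Prog.cost skip) (Runs.of_simple (by decide) ?_)
          (by simp only [Prog.cost]; omega)
        obtain ⟨L, c, h₁, h₂, h₃, h₄⟩ := hrec
        exact ⟨L, c, h₁, h₂, h₃.skip fun h => absurd h hlt, h₄⟩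
      · intro hb
        have hle : G.IsKCutSet k (z j) := by
          by_contra hlt
          rw [IsKCutSet] at hlt
          simp only [Expr.eval, hnum, hk₂] at hb
          rw [if_pos (by omega)] at hb
          exact one_ne_zero hb
        exact recordSet_runs h7₂ hle hrec
    · intro s₃ f₃ h₃
      refine ⟨?_, ?_, h₃⟩
      · rw [f₃.reg 7 (by decide), f₂.reg 7 (by decide), h7₁]
      · rwa [f₃.readList 5 (by decide), f₂.readList 5 (by decide)]
  · simp only [Expr.cost]
    ring_nf
    omega

/-- Evaluate all sums of source rows, and write the encoding of the minimum `k`-cut-sets. -/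
def searchPhase : Prog :=
  call rowSums 10 6 ;;
  (push 1 (lit 0) ;; set 9 (add (reg 2) (lit 1)) ;; set 10 (lit 0) ;; set 7 (lit 2)) ;;
  forLoop 8 (get 10 (lit 1)) searchStep ;;
  put 1 (lit 1) (reg 10)

-- The first cell of the output list is reserved for the number of sets and filled in at the end. In
-- `hcov` all `o` are allowed, since the second tree is known only by its specification.
set_option maxHeartbeats 1000000 in
theorem searchPhase_runs {G : MultiHypergraph (Fin n) (Fin m)} {k R thr : ℕ} {row : ℕ → ℕ}
    {ρ : ℕ → ℕ → ℕ} {s : State} (hk : 2 ≤ k) (hR : 1 ≤ R) (h0 : s.reg 0 = k) (h1 : s.reg 1 = n)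
    (h2 : s.reg 2 = m) (h5 : IsLabeledMatrix n m thr row G.incidenceEntry (s.readList 5))
    (h6 : s.readList 6 = [n, R, k - 1] ++ rows R n ρ) (hout : s.readList 1 = [])
    (h11 : ∀ c, s.mem 11 c = 0)
    (hcov : ∀ o, IsRowSums n R (k - 1) ρ o → ∀ F ∈ G.minKCutSets k,
      ∃ b < treeSize R (k - 1 + 1), F = G.nonconstEdges (labelRow n o b)) :
    Runs searchPhase s (30000 * (treeSize R (k - 1 + 1) * ((n + 1) * (n + 1) * (m + 1)))) fun s' =>
      ∃ L : List (Finset (Fin m)), s'.output = encodeSetList L ∧ L.Nodup ∧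
        ∀ F, F ∈ L ↔ F ∈ G.minKCutSets k := by
  have hone := one_le_treeSize_succ R (k - 1)
  have hRle : R ≤ treeSize R (k - 1 + 1) := by
    refine le_trans ?_ (treeSize_mono R (show 2 ≤ k - 1 + 1 by omega))
    simp [treeSize]
  set N := treeSize R (k - 1 + 1) with hN
  apply Runs.mono
  · unfold searchPhase
    apply Runs.seq (Mid := fun s => IsRowSums n R (k - 1) ρ (s.readList 10))
    · apply Runs.call (L := 1 + N * n) (Spec := IsRowSums n R (k - 1) ρ) h6
      · apply rowSums_runs (n := n) (M := R) (r := k - 1) hR (by omega) rfl rfl rfl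
        intro i hi v hv
        rw [List.getD_append_right _ _ _ _ (by simp)]
        simpa using rows_getD ρ hi hv
      · exact fun o h => h.length.le
      · intro o h
        simpa using h
    intro s₁ f₁ h10₁
    set o := s₁.readList 10 with ho
    have hmem : ∀ j < 1 + N * n, s₁.mem 10 (j + 1) = o.getD j 0 := by
      intro j hj
      refine (State.readList_getD _ _ _ ?_).symm
      rwa [← State.readList_length, ← ho, h10₁.length]
    have h11₁ : s₁.mem 11 = s.mem 11 := f₁.mem 11 (by decide)
    apply Runs.seq (Mid := fun t => t.reg 7 = 2 ∧ IsRecorded G k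
      (fun b => G.nonconstEdges (labelRow n o b)) 0 (fun best L => best = m + 1 ∨ L ≠ []) t)
    · apply Runs.of_simple (by decide)
      refine ⟨by simp [Prog.eval, Expr.eval], [], 0, ?_, ?_, ?_, ?_⟩
      · simp [Prog.eval, Expr.eval]
      · simp [Prog.eval, Prog.push_eval, Expr.eval, f₁.readList 1 (by decide), hout]
      · refine IsBestFamily.zero fun c => ?_
        simp [Prog.eval, Prog.push_eval, Expr.eval, h11₁, h11]
      · simp [Prog.eval, Prog.push_eval, Expr.eval, f₁.reg 2 (by decide), h2]
    rintro s₂ f₂ ⟨h7₂, hrec₂⟩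
    apply Runs.seq (Mid := IsRecorded G k (fun b => G.nonconstEdges (labelRow n o b)) N
      fun best L => best = m + 1 ∨ L ≠ [])
    · apply Runs.imp
      · apply Runs.forLoop N (fun b t => t.reg 7 = 2 + b * n ∧
          (∃ row', IsLabeledMatrix n m thr row' G.incidenceEntry (t.readList 5)) ∧
          IsRecorded G k (fun b => G.nonconstEdges (labelRow n o b)) b
            (fun best L => best = m + 1 ∨ L ≠ []) t) (by decide)
        · refine ⟨by simpa using h7₂, ⟨row, ?_⟩, ?_⟩
          · rwa [State.setReg_readList, f₂.readList 5 (by decide), f₁.readList 5 (by decide)]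
          · simpa [IsRecorded] using hrec₂
        · intro i t f _
          rw [Expr.eval, f.mem 10 (by decide), f₂.mem 10 (by decide)]
          have := hmem 0 (by omega)
          rw [h10₁.head] at this
          exact this
        · rintro b t hb htb f ⟨h7, ⟨row', h5'⟩, hrec⟩
          apply Runs.imp
          · apply searchStep_runs (row := labelRow n o b) _ _ h7 h5' _ rfl hrec
            · rw [f.reg 0 (by decide), f₂.reg 0 (by decide), f₁.reg 0 (by decide), h0]
            · rw [f.reg 1 (by decide), f₂.reg 1 (by decide), f₁.reg 1 (by decide), h1]
            · intro v hv
              rw [f.mem 10 (by decide), f₂.mem 10 (by decide), labelRow, ← hmem]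
              · congr 1
                omega
              · have := mul_add_lt hv hb
                omega
          · rintro t' f' ⟨h7', h5'', hrec'⟩
            refine ⟨?_, ⟨_, h5''⟩, ?_⟩
            · simp [h7']
              ring
            · simpa [IsRecorded] using hrec'
      · exact fun t f h => h.2.2
    rintro s₃ f₃ ⟨L, c, h10₃, h1₃, hbest, hL⟩
    apply Runs.of_simple (by decide)
    refine ⟨L, ?_, hbest.nodup, hbest.mem_iff hL (hcov o h10₁)⟩
    rw [State.output, Prog.eval, Expr.eval, Expr.eval, State.setMem_readList s₃ 1 0, h1₃, h10₃]
    rfl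
  · simp only [Prog.cost, Expr.cost, Prog.push_cost, List.length_append, List.length_cons,
      List.length_nil, rows_length, ← hN]
    have h₂ := Nat.mul_le_mul_left n hRle
    obtain ⟨N', hN'⟩ := Nat.exists_eq_add_of_le hone
    rw [hN'] at hRle h₂ ⊢
    rw [mul_add, mul_one, mul_comm n N'] at h₂
    ring_nf
    omega

end Ram

/-! ### The range of the number of components -/

namespace MultiHypergraph

variable {n m : ℕ}

theorem numComponents_le (G : MultiHypergraph (Fin n) (Fin m)) (F : Finset (Fin m)) :
    G.numComponents F ≤ n := by
  have := Nat.card_le_card_of_surjective (G.graphAfterRemoval F).connectedComponentMk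
    Quot.mk_surjective
  simpa [numComponents] using this

theorem le_numComponents_univ (G : MultiHypergraph (Fin n) (Fin m)) :
    n ≤ G.numComponents Finset.univ := by
  have hfin : Finite (G.graphAfterRemoval Finset.univ).ConnectedComponent := Quot.finite _
  have hinj : Function.Injective (G.graphAfterRemoval Finset.univ).connectedComponentMk := by
    intro u v h
    exact eq_of_reachable (f := id) (fun e he => absurd (Finset.mem_univ e) he)
      (SimpleGraph.ConnectedComponent.eq.mp h)
  simpa [numComponents] using Nat.card_le_card_of_injective _ hinj

theorem minKCutSets_eq_empty {G : MultiHypergraph (Fin n) (Fin m)} {k : ℕ} (h : n < k) :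
    G.minKCutSets k = ∅ := by
  refine Set.eq_empty_of_forall_notMem fun F hF => ?_
  have h₁ := G.numComponents_le F
  have h₂ : k ≤ G.numComponents F := hF.1
  omega

end MultiHypergraph

namespace Ram

open Ram.Expr Ram.Prog MultiHypergraph

variable {n m : ℕ}

/-! ### The whole algorithm -/

/-- The implementation of `Enum-Cuts`, with the subroutine `Q` for terminal cuts. -/
def enumCuts (Q : Prog) : Prog :=
  (set 0 (get 0 (lit 1)) ;; set 1 (get 0 (lit 2)) ;; set 2 (get 0 (lit 3))) ;;
  ite (lt (reg 1) (reg 0)) (push 1 (lit 0))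
    (ite (reg 2) (setup ;; sourcesPhase Q ;; searchPhase) (push 1 (lit 1) ;; push 1 (lit 0)))

/-- The output lists the minimum `k`-cut-sets. -/
def IsListing (G : MultiHypergraph (Fin n) (Fin m)) (k : ℕ) (o : List ℕ) : Prop :=
  ∃ L : List (Finset (Fin m)), o = encodeSetList L ∧ L.Nodup ∧ ∀ F, F ∈ L ↔ F ∈ G.minKCutSets k

theorem enumCuts_init (G : MultiHypergraph (Fin n) (Fin m)) (k : ℕ) :
    let s := State.ofInput (k :: G.encode)
    Runs (set 0 (get 0 (lit 1)) ;; set 1 (get 0 (lit 2)) ;; set 2 (get 0 (lit 3))) s 100 fun s' =>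
      s'.reg 0 = k ∧ s'.reg 1 = n ∧ s'.reg 2 = m ∧ s'.mem = s.mem := by
  refine (Runs.of_simple (by decide) ?_).mono (by simp [Prog.cost, Expr.cost])
  rw [encode_eq]
  refine ⟨?_, ?_, ?_, ?_⟩ <;>
    simp [Prog.eval, Expr.eval, State.ofInput_mem_succ 0, State.ofInput_mem_succ 1,
      State.ofInput_mem_succ 2]

/-- For `m = 0` the size is zero, so the second summand of the time bound vanishes and could not pay
for a search. These cases are answered in constant time. -/
theorem enumCuts_runs_of_trivial {G : MultiHypergraph (Fin n) (Fin m)} {k : ℕ} (Q : Prog)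
    (h : n < k ∨ m = 0) :
    Runs (enumCuts Q) (State.ofInput (k :: G.encode)) 200 fun s => IsListing G k s.output := by
  apply Runs.mono
  · unfold enumCuts
    apply Runs.seq
    · exact enumCuts_init G k
    rintro s f ⟨h0, h1, h2, hmem⟩
    have hout : s.readList 1 = [] := State.readList_eq_nil _ _ (by simp [hmem])
    apply Runs.ite (B := 50)
    · intro hb
      have hlt : n < k := by
        by_contra hle
        simp [Expr.eval, h0, h1, hle] at hb
      refine Runs.mono (B := Prog.cost (push 1 (lit 0))) (Runs.of_simple (by decide) ?_)
        (by simp [Prog.push_cost, Expr.cost])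
      refine ⟨[], ?_, List.nodup_nil, fun F => ?_⟩
      · simp [State.output, Prog.push_eval, hout, Expr.eval, encodeSetList]
      · simp [minKCutSets_eq_empty hlt]
    · intro hb
      have hle : k ≤ n := by
        by_contra hlt
        rw [Expr.eval, Expr.eval, Expr.eval, h0, h1, if_pos (by omega)] at hb
        exact one_ne_zero hb
      obtain rfl : m = 0 := h.resolve_left (by omega)
      apply Runs.mono (B := (reg 2).cost + 1 + 40)
      · apply Runs.ite
        · exact fun hb' => absurd h2 hb'
        · intro _
          refine Runs.mono (B := Prog.cost (push 1 (lit 1) ;; push 1 (lit 0)))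
            (Runs.of_simple (by decide) ?_) (by simp [Prog.cost, Prog.push_cost, Expr.cost])
          refine ⟨[∅], ?_, List.nodup_singleton _, fun F => ?_⟩
          · simp [State.output, Prog.eval, Prog.push_eval, hout, Expr.eval, encodeSetList,
              encodeFinset]
          · rw [Subsingleton.elim F Finset.univ]
            refine ⟨fun _ => ⟨hle.trans G.le_numComponents_univ, fun F' _ => ?_⟩, fun _ => ?_⟩
            · simp
            · exact List.mem_singleton.mpr (Subsingleton.elim _ _)
      · simp [Expr.cost]
  · simp [Expr.cost]

theorem enumCuts_runs {G : MultiHypergraph (Fin n) (Fin m)} {k : ℕ} {Q : Prog} {T : ℕ → ℕ → ℕ}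
    (hQ : SolvesSourceMinimalCut Q T) (hG : G.NoEmptyEdge) (hk : 2 ≤ k) (hn : k ≤ n) (hm : 1 ≤ m) :
    Runs (enumCuts Q) (State.ofInput (k :: G.encode))
      (treeSize n (4 * k - 1) * T n G.size +
        300000 * (treeSize (treeSize n (4 * k - 1)) k * ((n + 1) * (n + 1) * (m + 1))))
      fun s => IsListing G k s.output := by
  have hd : 2 * (2 * k - 1) + 1 = 4 * k - 1 := by omega
  have hk' : k - 1 + 1 = k := by omega
  have hR₁ : 1 ≤ treeSize n (4 * k - 1) := by
    rw [← hd]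
    exact one_le_treeSize_succ _ _
  have hR₂ : treeSize n (4 * k - 1) ≤ treeSize (treeSize n (4 * k - 1)) k := by
    refine le_trans ?_ (treeSize_mono _ hk)
    simp [treeSize]
  apply Runs.mono
  · unfold enumCuts
    apply Runs.seq
    · exact enumCuts_init G k
    rintro s f ⟨h0, h1, h2, hmem⟩
    have hnil : ∀ a, a ≠ 0 → s.readList a = [] := fun a ha =>
      State.readList_eq_nil _ _ (by simp [hmem, ha])
    have hin : s.readList 0 = k :: G.encode := by
      rw [State.readList_congr (s := State.ofInput (k :: G.encode)) (by rw [hmem]), State.ofInput,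
        State.writeList_readList]
    apply Runs.ite
    · intro hb
      rw [Expr.eval, Expr.eval, Expr.eval, h0, h1, if_neg (by omega)] at hb
      exact absurd rfl hb
    · intro _
      apply Runs.ite
      · intro _
        apply Runs.seq
        · exact setup_runs (G := G) (by omega) (by omega) hin h0 h1 h2 (hnil 3 (by decide))
            (hnil 5 (by decide))
        rintro s₁ f₁ ⟨h3₁, h4₁, h5₁⟩
        apply Runs.seq
        · exact sourcesPhase_runs hQ hG ((f₁.reg 0 (by decide)).trans h0)
            ((f₁.reg 1 (by decide)).trans h1) h3₁
            ((f₁.readList 6 (by decide)).trans (hnil 6 (by decide))) h5₁ h4₁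
        rintro s₂ f₂ ⟨⟨row, h5₂⟩, ρ, hρ, h6₂⟩
        apply searchPhase_runs hk (one_le_treeSize_succ _ _)
          (((f₂.reg 0 rfl).trans (f₁.reg 0 (by decide))).trans h0)
          (((f₂.reg 1 rfl).trans (f₁.reg 1 (by decide))).trans h1)
          (((f₂.reg 2 rfl).trans (f₁.reg 2 (by decide))).trans h2) h5₂ h6₂
        · rw [f₂.readList 1 rfl, f₁.readList 1 (by decide), hnil 1 (by decide)]
        · intro c
          rw [f₂.mem 11 rfl, f₁.mem 11 (by decide), hmem]
          simp
        · exact fun o ho F hF => exists_labelRow_of_mem_minKCutSets hk h4₁ hρ ho hF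
      · intro hb
        rw [Expr.eval, h2] at hb
        omega
  · simp only [Expr.cost, hd, hk']
    generalize treeSize (treeSize n (4 * k - 1)) k = N at *
    generalize treeSize n (4 * k - 1) = R at *
    -- As the second tree is at least as large as the first, the search bound absorbs the
    -- preparation and the overhead of the source phase.
    have h₁ := Nat.mul_le_mul_right ((n + 1) * (n + 1) * (m + 1)) hR₂
    have h₂ : R * ((n + 1) * (m + 1)) ≤ R * ((n + 1) * (n + 1) * (m + 1)) :=
      Nat.mul_le_mul_left _ (Nat.mul_le_mul_right _ (Nat.le_mul_of_pos_right _ (by omega)))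
    have h₃ : 1 ≤ N * ((n + 1) * (n + 1) * (m + 1)) :=
      Nat.mul_pos (by omega) (by positivity)
    rw [mul_add R, mul_left_comm R 200000]
    omega

/-! ### Comparison with the claimed running time -/

/-- The constant in the running time. -/
def timeConstant (k : ℕ) : ℕ := 4 * k + 2400000 * (k * (4 * k) ^ (k - 1))

/-- The first tree has at most `4k * n ^ (4k - 2)` nodes and the second has depth `k - 1`, so
evaluating all its rows involves the exponent `(4k - 2)(k - 1) + 2 = 4k² - 6k + 4 ≤ 4k² - 2k`. -/
theorem time_le {n m p k t : ℕ} (hk : 2 ≤ k) (hn : 1 ≤ n) (hm : 1 ≤ m) (hp : m ≤ p) :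
    treeSize n (4 * k - 1) * t +
        300000 * (treeSize (treeSize n (4 * k - 1)) k * ((n + 1) * (n + 1) * (m + 1))) ≤
      timeConstant k * (n ^ (4 * k - 2) * t + n ^ (4 * k ^ 2 - 2 * k) * p) := by
  have hR : treeSize n (4 * k - 1) ≤ 4 * k * n ^ (4 * k - 2) := by
    have h := treeSize_succ_le hn (4 * k - 2)
    rw [show 4 * k - 2 + 1 = 4 * k - 1 by omega] at h
    exact h.trans (Nat.mul_le_mul_right _ (by omega))
  have hR₁ : 1 ≤ treeSize n (4 * k - 1) := by
    rw [show 4 * k - 1 = 4 * k - 2 + 1 by omega]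
    exact one_le_treeSize_succ _ _
  have hN : treeSize (treeSize n (4 * k - 1)) k ≤
      k * ((4 * k) ^ (k - 1) * n ^ ((4 * k - 2) * (k - 1))) := by
    have h := treeSize_succ_le hR₁ (k - 1)
    rw [show k - 1 + 1 = k by omega] at h
    refine h.trans (Nat.mul_le_mul_left _ ?_)
    rw [pow_mul, ← mul_pow]
    exact Nat.pow_le_pow_left hR _
  have hK : (n + 1) * (n + 1) * (m + 1) ≤ 8 * (n ^ 2 * p) := by
    calc (n + 1) * (n + 1) * (m + 1) ≤ (2 * n) * (2 * n) * (2 * p) := by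
          gcongr <;> omega
      _ = 8 * (n ^ 2 * p) := by ring
  have hexp : n ^ ((4 * k - 2) * (k - 1)) * n ^ 2 ≤ n ^ (4 * k ^ 2 - 2 * k) := by
    rw [← pow_add]
    refine Nat.pow_le_pow_right hn ?_
    obtain ⟨j, rfl⟩ := Nat.exists_eq_add_of_le hk
    have h₁ : 4 * (2 + j) - 2 = 4 * j + 6 := by omega
    have h₂ : 2 + j - 1 = j + 1 := by omega
    rw [h₁, h₂]
    refine Nat.le_sub_of_add_le ?_
    nlinarith
  set A := k * (4 * k) ^ (k - 1) with hA
  calc treeSize n (4 * k - 1) * t +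
        300000 * (treeSize (treeSize n (4 * k - 1)) k * ((n + 1) * (n + 1) * (m + 1)))
      ≤ 4 * k * n ^ (4 * k - 2) * t + 300000 *
        (k * ((4 * k) ^ (k - 1) * n ^ ((4 * k - 2) * (k - 1))) * (8 * (n ^ 2 * p))) := by
        gcongr
    _ = 4 * k * (n ^ (4 * k - 2) * t) +
        2400000 * A * (n ^ ((4 * k - 2) * (k - 1)) * n ^ 2 * p) := by
        rw [hA]
        ring
    _ ≤ 4 * k * (n ^ (4 * k - 2) * t) + 2400000 * A * (n ^ (4 * k ^ 2 - 2 * k) * p) := by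
        gcongr
    _ ≤ timeConstant k * (n ^ (4 * k - 2) * t) +
        timeConstant k * (n ^ (4 * k ^ 2 - 2 * k) * p) := by
        gcongr
        · exact Nat.le_add_right _ _
        · exact Nat.le_add_left _ _
    _ = _ := (mul_add _ _ _).symm

end Ram

/-! ### Assembly of the three claims -/

theorem mainTheorem2 :
    -- the algorithm returns exactly the family of all minimum `k`-cut-sets
    (∀ (V E : Type*) [Fintype V] [Fintype E] (G : MultiHypergraph V E) (k : ℕ), 2 ≤ k →
      G.enumCuts k = G.minKCutSets k) ∧
    -- cardinality of the family returned
    (∀ k : ℕ, 2 ≤ k → ∃ C : ℕ, ∀ (V E : Type*) [Fintype V] [Fintype E]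
      (G : MultiHypergraph V E),
      (G.enumCuts k).ncard ≤ C * Fintype.card V ^ (2 * k * (2 * k - 1))) ∧
    -- implementation and running time: `P` lists every member of the family exactly once
    (∃ C : ℕ → ℕ, ∀ (Q : Ram.Prog) (T : ℕ → ℕ → ℕ),
      SolvesSourceMinimalCut Q T → (∀ n p, 1 ≤ T n p) →
      ∃ P : Ram.Prog, ∀ k : ℕ, 2 ≤ k → ∀ n : ℕ, 1 ≤ n →
        ∀ (m : ℕ) (G : MultiHypergraph (Fin n) (Fin m)), G.NoEmptyEdge →
          ∃ (L : List (Finset (Fin m))) (time : ℕ),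
            L.Nodup ∧ (∀ F, F ∈ L ↔ F ∈ G.enumCuts k) ∧
            P.RunsTo (k :: G.encode) time (encodeSetList L) ∧
            time ≤ C k * (n ^ (4 * k - 2) * T n G.size + n ^ (4 * k ^ 2 - 2 * k) * G.size)) := by
  refine ⟨fun V E _ _ G k hk => G.enumCuts_eq_minKCutSets hk,
    fun k hk => ⟨2, fun V E _ _ G => G.ncard_enumCuts_le hk⟩,
    fun k => Ram.timeConstant k + 200, fun Q T hQ hT => ⟨Ram.enumCuts Q, fun k hk n hn m G hG => ?_⟩⟩
  suffices h : ∃ B ≤ (Ram.timeConstant k + 200) *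
      (n ^ (4 * k - 2) * T n G.size + n ^ (4 * k ^ 2 - 2 * k) * G.size),
      Ram.Runs (Ram.enumCuts Q) (Ram.State.ofInput (k :: G.encode)) B
        fun s => Ram.IsListing G k s.output by
    obtain ⟨B, hB, hrun⟩ := h
    obtain ⟨t, out, ht, hto, L, rfl, hnodup, hL⟩ := hrun.exists_runsTo
    refine ⟨L, t, hnodup, fun F => ?_, hto, ht.trans hB⟩
    rw [hL, G.enumCuts_eq_minKCutSets hk]
  by_cases h : n < k ∨ m = 0
  · refine ⟨200, ?_, Ram.enumCuts_runs_of_trivial Q h⟩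
    -- Since `T ≥ 1` and `n ≥ 1`, the first summand pays for the constant.
    have h₁ : 1 ≤ n ^ (4 * k - 2) * T n G.size := Nat.mul_pos (Nat.pow_pos hn) (hT _ _)
    calc 200 = 200 * 1 := rfl
      _ ≤ _ := Nat.mul_le_mul (Nat.le_add_left _ _) (h₁.trans (Nat.le_add_right _ _))
  · push Not at h
    refine ⟨_, ?_, Ram.enumCuts_runs hQ hG hk h.1 (Nat.pos_of_ne_zero h.2)⟩
    exact (Ram.time_le hk hn (Nat.pos_of_ne_zero h.2) (MultiHypergraph.le_size hG)).trans
      (Nat.mul_le_mul_right _ (Nat.le_add_right _ _))
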